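/- **Conventions.** Manifolds are smooth, finite-dimensional, Hausdorff, $\sigma$-compact and without boundary. An *almost product singular semi-Riemannian manifold* $(M,g,J)$ is a manifold $M$ with a smooth symmetric bilinear form $g=\langle\cdot,\cdot\rangle$ (possibly degenerate, possibly of variable signature) and a smooth field $J:TM\to TM$ of endomorphisms with $J^2=\mathrm{id}$ and $g(JX,JY)=g(X,Y)$. It is *non-degenerate* if every $g_p$ is. Let $$\mathcal K(X,Y,Z)=\tfrac12\{X\langle Y,Z\rangle+Y\langle Z,X\rangle-Z\langle X,Y\rangle-\langle X,[Y,Z]\rangle+\langle Y,[Z,X]\rangle+\langle Z,[X,Y]\rangle\},$$ $$\widetilde{\mathcal K}(X,Y,Z)=\tfrac12[\mathcal K(X,Y,Z)+\mathcal K(X,JY,JZ)],\qquad (\widetilde\nabla^\flat_XY)(Z)=\widetilde{\mathcal K}(X,Y,Z)$$ for $X,Y,Z\in\Gamma(TM)$. Let $T^\bullet_pM=\{g_p(u,\cdot):u\in T_pM\}$, with the inner product $\langle\langle g_p(u,\cdot),g_p(v,\cdot)\rangle\rangle_\bullet=g_p(u,v)$, and let $\mathcal A^\bullet(M)$ be the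 set of smooth $1$-forms $\omega$ with $\omega_p\in T^\bullet_pM$ for all $p$. For $\omega\in\mathcal A^\bullet(M)$, and when all $\widetilde\nabla^\flat_XY$ lie in $\mathcal A^\bullet(M)$, set $$(\widetilde\nabla_X\omega)(Y)=X(\omega(Y))-\langle\langle\widetilde\nabla^\flat_XY,\omega\rangle\rangle_\bullet$$ on the dense open set of points near which the signature of $g$ is constant, extended by continuity to the other points where possible. $(M,g,J)$ is *almost product semi-regular* if $\widetilde\nabla^\flat_XY\in\mathcal A^\bullet(M)$ and $\widetilde\nabla_Z(\widetilde\nabla^\flat_XY)\in\mathcal A^\bullet(M)$ for all $X,Y,Z\in\Gamma(TM)$; its curvature is then $$\widetilde R(X,Y,Z,T)=(\widetilde\nabla_X\widetilde\nabla^\flat_YZ)(T)-(\widetilde\nabla_Y\widetilde\nabla^\flat_XZ)(T)-(\widetilde\nabla^\flat_{[X,Y]}Z)(T).$$ **Theorem.** Let $(B,g_B,J_1)$ be a non-degenerate almost product semi-Riemannian manifold, $(F,g_F,J_2)$ an almost product semi-regular semi-Riemannian manifold, and $f\in C^\infty(B)$ (zeros of $f$ are allowed). Let $B\times_fF$ be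 $B\times F$ with the form $\pi_B^*g_B+(f\circ\pi_B)^2\pi_F^*g_F$ and $J=(J_1,J_2)$. Then $B\times_fF$ is almost product semi-regular, so that its curvature $\widetilde R$ is defined. Let $X,Y,Z,T\in\Gamma(TB)$ and $U,V,W,Q\in\Gamma(TF)$, identified with their lifts to $B\times F$; let $\widetilde R_B,\widetilde R_F$ be the curvatures of $B,F$, let $\mathcal K_F$ be the Koszul form $\mathcal K$ of $g_F$, let $g_B^*$ be the inner product on covectors dual to $g_B$, and let $H^f(X,T)=(\widetilde\nabla_Xdf)(T)=X(T(f))-g_B^*(\widetilde\nabla^\flat_XT,df)$ be the Hessian of $f$ with respect to the almost product covariant derivative of $B$. Then, at every point of $B\times F$: 1. $\widetilde R(X,Y,Z,T)=\widetilde R_B(X,Y,Z,T)$. 2. $\widetilde R(X,Y,Z,Q)=\widetilde R(Z,Q,X,Y)=0$. 3. $\widetilde R(X,Y,W,Q)=\widetilde R(W,Q,X,Y)=0$. 4. $\widetilde R(X,V,W,T)=-\frac12 fH^f(X,T)g_F(V,W)-\frac f2\big[X\big((J_1T)(f)\big)-g_B^*(\widetilde\nabla^\flat_XT,df\circ J_1)\big]g_F(V,J_2W)$.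 5. $\widetilde R(U,V,Z,Q)=\frac14 fZ(f)\big[-\mathcal K_F(V,Q,U)+\mathcal K_F(V,J_2Q,J_2U)+\mathcal K_F(U,Q,V)-\mathcal K_F(U,J_2Q,J_2V)\big]$ $-\frac14 f(J_1Z)(f)\big[\mathcal K_F(V,J_2Q,U)-\mathcal K_F(V,Q,J_2U)-\mathcal K_F(U,J_2Q,V)+\mathcal K_F(U,Q,J_2V)\big]$. 6. $\widetilde R(Z,Q,U,V)=0$. 7. $\widetilde R(U,V,W,Q)=f^2\widetilde R_F(U,V,W,Q)+\frac{f^2}4\Big\{g_B^*(df,df)\big[g_F(U,W)g_F(V,Q)-g_F(V,W)g_F(U,Q)\big]$ $+g_B^*(df\circ J_1,df)\big[g_F(U,J_2W)g_F(V,Q)+g_F(U,W)g_F(V,J_2Q)-g_F(V,J_2W)g_F(U,Q)-g_F(V,W)g_F(U,J_2Q)\big]$ $+g_B^*(df\circ J_1,df\circ J_1)\big[g_F(U,J_2W)g_F(V,J_2Q)-g_F(V,J_2W)g_F(U,J_2Q)\big]\Big\}$. -/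

import Mathlib

open Set Filter Topology Bundle
open scoped Manifold ContDiff

noncomputable section

namespace SingularGeometry

section Manifold

variable {E : Type*} [NormedAddCommGroup E] [NormedSpace ℝ E]
  {H : Type*} [TopologicalSpace H] {I : ModelWithCorners ℝ E H}
  {M : Type*} [TopologicalSpace M] [ChartedSpace H M] [IsManifold I ∞ M]

/-- `X` is a smooth vector field, i.e. an element of `Γ(TM)`. -/
def IsSmoothField (X : (x : M) → TangentSpace I x) : Prop :=
  ContMDiff I I.tangent ∞ (fun x => (⟨x, X x⟩ : TangentBundle I M))

/-- The function `X(h)`, the derivative of `h` in the direction of the vector field `X`. -/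
def dirDeriv (X : (x : M) → TangentSpace I x) (h : M → ℝ) : M → ℝ :=
  fun x => mvfderiv I h x (X x)

/-- The vector field `J X`, for a field `J` of endomorphisms of the tangent spaces. -/
def applyField (J : (x : M) → TangentSpace I x →L[ℝ] TangentSpace I x)
    (X : (x : M) → TangentSpace I x) : (x : M) → TangentSpace I x :=
  fun x => J x (X x)

/-- The function `⟨X, Y⟩ = g(X, Y)`. -/
def pairing (g : (x : M) → TangentSpace I x →L[ℝ] TangentSpace I x →L[ℝ] ℝ)
    (X Y : (x : M) → TangentSpace I x) : M → ℝ :=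
  fun x => g x (X x) (Y x)

/-- `(M, g, J)` is an almost product singular semi-Riemannian manifold: `g` is a smooth symmetric
bilinear form, which may be degenerate and of variable signature, and `J` is a smooth field of
endomorphisms of the tangent spaces with `J² = id` and `g(JX, JY) = g(X, Y)`. -/
structure IsAlmostProduct (g : (x : M) → TangentSpace I x →L[ℝ] TangentSpace I x →L[ℝ] ℝ)
    (J : (x : M) → TangentSpace I x →L[ℝ] TangentSpace I x) : Prop where
  symm : ∀ (x : M) (v w : TangentSpace I x), g x v w = g x w v
  contMDiff_metric : ContMDiff I (I.prod 𝓘(ℝ, E →L[ℝ] E →L[ℝ] ℝ)) ∞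
    (fun x => TotalSpace.mk' (E →L[ℝ] E →L[ℝ] ℝ)
      (E := fun x : M => TangentSpace I x →L[ℝ] TangentSpace I x →L[ℝ] ℝ) x (g x))
  contMDiff_structure : ContMDiff I (I.prod 𝓘(ℝ, E →L[ℝ] E)) ∞
    (fun x => TotalSpace.mk' (E →L[ℝ] E)
      (E := fun x : M => TangentSpace I x →L[ℝ] TangentSpace I x) x (J x))
  involutive : ∀ (x : M) (v : TangentSpace I x), J x (J x v) = v
  isometry : ∀ (x : M) (v w : TangentSpace I x), g x (J x v) (J x w) = g x v w

/-- `g` is non-degenerate at every point. -/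
def IsNondegenerate (g : (x : M) → TangentSpace I x →L[ℝ] TangentSpace I x →L[ℝ] ℝ) : Prop :=
  ∀ (x : M) (v : TangentSpace I x), (∀ w : TangentSpace I x, g x v w = 0) → v = 0

/-- The Koszul form `𝒦(X, Y, Z)` of `g`. -/
def koszul (g : (x : M) → TangentSpace I x →L[ℝ] TangentSpace I x →L[ℝ] ℝ)
    (X Y Z : (x : M) → TangentSpace I x) : M → ℝ :=
  fun x => (1 / 2 : ℝ) *
    (dirDeriv X (pairing g Y Z) x + dirDeriv Y (pairing g Z X) x - dirDeriv Z (pairing g X Y) x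
      - pairing g X (VectorField.mlieBracket I Y Z) x
      + pairing g Y (VectorField.mlieBracket I Z X) x
      + pairing g Z (VectorField.mlieBracket I X Y) x)

/-- The almost product Koszul form `𝒦̃(X, Y, Z) = (𝒦(X, Y, Z) + 𝒦(X, JY, JZ)) / 2`. -/
def apKoszul (g : (x : M) → TangentSpace I x →L[ℝ] TangentSpace I x →L[ℝ] ℝ)
    (J : (x : M) → TangentSpace I x →L[ℝ] TangentSpace I x)
    (X Y Z : (x : M) → TangentSpace I x) : M → ℝ :=
  fun x => (1 / 2 : ℝ) *
    (koszul g X Y Z x + koszul g X (applyField J Y) (applyField J Z) x)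

/-! A 1-form is treated as a map from vector fields to functions, evaluated on smooth vector
fields only. -/

/-- The differential `df`. -/
def differential (I : ModelWithCorners ℝ E H) (f : M → ℝ) :
    ((x : M) → TangentSpace I x) → M → ℝ :=
  fun Z => dirDeriv Z f

/-- The composition `α ∘ J`. -/
def formComp (α : ((x : M) → TangentSpace I x) → M → ℝ)
    (J : (x : M) → TangentSpace I x →L[ℝ] TangentSpace I x) :
    ((x : M) → TangentSpace I x) → M → ℝ :=
  fun Z => α (applyField J Z)

/-- The almost product lower covariant derivative `∇̃♭_X Y`, the 1-form `Z ↦ 𝒦̃(X, Y, Z)`. -/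
def lowerDeriv (g : (x : M) → TangentSpace I x →L[ℝ] TangentSpace I x →L[ℝ] ℝ)
    (J : (x : M) → TangentSpace I x →L[ℝ] TangentSpace I x)
    (X Y : (x : M) → TangentSpace I x) : ((x : M) → TangentSpace I x) → M → ℝ :=
  fun Z => apKoszul g J X Y Z

/-- The value of the 1-form `α` at `p` is the covector `g_p(u, ·)`. -/
def Represents (g : (x : M) → TangentSpace I x →L[ℝ] TangentSpace I x →L[ℝ] ℝ)
    (α : ((x : M) → TangentSpace I x) → M → ℝ) (p : M) (u : TangentSpace I p) : Prop :=
  ∀ Z : (x : M) → TangentSpace I x, IsSmoothField Z → α Z p = g p u (Z p)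

/-- `α ∈ 𝒜•(M)`: `α` is a smooth 1-form whose value at each point `p` lies in `T•_p M`, the image
of `T_p M` under `u ↦ g_p(u, ·)`. (`C^∞(M)`-linearity of `α` follows from the second condition.) -/
def IsAnnihilatorForm (g : (x : M) → TangentSpace I x →L[ℝ] TangentSpace I x →L[ℝ] ℝ)
    (α : ((x : M) → TangentSpace I x) → M → ℝ) : Prop :=
  (∀ Z : (x : M) → TangentSpace I x, IsSmoothField Z → ContMDiff I 𝓘(ℝ, ℝ) ∞ (α Z)) ∧
    ∀ p : M, ∃ u : TangentSpace I p, Represents g α p u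

open Classical in
/-- The covariant contraction `⟨⟨α, τ⟩⟩_•` at `p`: the inner product induced by `g_p` on `T•_p M`,
`⟨⟨g_p(u, ·), g_p(v, ·)⟩⟩ = g_p(u, v)`. For a non-degenerate `g` it is `g^*(α, τ)`. -/
def contraction (g : (x : M) → TangentSpace I x →L[ℝ] TangentSpace I x →L[ℝ] ℝ)
    (α τ : ((x : M) → TangentSpace I x) → M → ℝ) (p : M) : ℝ :=
  if h : (∃ u : TangentSpace I p, Represents g α p u) ∧
      (∃ v : TangentSpace I p, Represents g τ p v) then
    g p h.1.choose h.2.choose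
  else 0

/-- The quadratic form `v ↦ g_p(v, v)`. -/
def quadForm (g : (x : M) → TangentSpace I x →L[ℝ] TangentSpace I x →L[ℝ] ℝ) (p : M) :
    QuadraticForm ℝ (TangentSpace I p) :=
  LinearMap.BilinMap.toQuadraticMap (g p).toLinearMap₁₂

/-- The union of the regions of constant signature: the points near which the signature of `g` is
constant. -/
def regularSet (g : (x : M) → TangentSpace I x →L[ℝ] TangentSpace I x →L[ℝ] ℝ) : Set M :=
  {p | ∀ᶠ q in 𝓝 p, sigPos (quadForm g q) = sigPos (quadForm g p) ∧
    sigNeg (quadForm g q) = sigNeg (quadForm g p)}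

open Classical in
/-- The almost product covariant derivative `∇̃_X α` of `α ∈ 𝒜•(M)`. On the regions of constant
signature, which form a dense open set,
`(∇̃_X α)(Y) = X(α(Y)) - ⟨⟨∇̃♭_X Y, α⟩⟩_•`; at the other points it is the extension by continuity. -/
def covDeriv (g : (x : M) → TangentSpace I x →L[ℝ] TangentSpace I x →L[ℝ] ℝ)
    (J : (x : M) → TangentSpace I x →L[ℝ] TangentSpace I x)
    (X : (x : M) → TangentSpace I x) (α : ((x : M) → TangentSpace I x) → M → ℝ) :
    ((x : M) → TangentSpace I x) → M → ℝ :=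
  fun Y =>
    let D : M → ℝ := fun p => dirDeriv X (α Y) p - contraction g (lowerDeriv g J X Y) α p
    (regularSet g).piecewise D (extendFrom (regularSet g) D)

/-- `(M, g, J)` is an almost product semi-regular semi-Riemannian manifold: `∇̃♭_X Y ∈ 𝒜•(M)` and
`∇̃_Z (∇̃♭_X Y) ∈ 𝒜•(M)` for all smooth vector fields. -/
structure IsSemiRegular
    (g : (x : M) → TangentSpace I x →L[ℝ] TangentSpace I x →L[ℝ] ℝ)
    (J : (x : M) → TangentSpace I x →L[ℝ] TangentSpace I x) : Prop where
  isAlmostProduct : IsAlmostProduct g J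
  lowerDeriv_mem : ∀ X Y : (x : M) → TangentSpace I x, IsSmoothField X → IsSmoothField Y →
    IsAnnihilatorForm g (lowerDeriv g J X Y)
  covDeriv_mem : ∀ X Y Z : (x : M) → TangentSpace I x,
    IsSmoothField X → IsSmoothField Y → IsSmoothField Z →
    IsAnnihilatorForm g (covDeriv g J Z (lowerDeriv g J X Y))

/-- The curvature of the almost product covariant derivative,
`R̃(X, Y, Z, T) = (∇̃_X ∇̃♭_Y Z)(T) - (∇̃_Y ∇̃♭_X Z)(T) - (∇̃♭_[X,Y] Z)(T)`. -/
def curvature (g : (x : M) → TangentSpace I x →L[ℝ] TangentSpace I x →L[ℝ] ℝ)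
    (J : (x : M) → TangentSpace I x →L[ℝ] TangentSpace I x)
    (X Y Z T : (x : M) → TangentSpace I x) : M → ℝ :=
  fun x => covDeriv g J X (lowerDeriv g J Y Z) T x - covDeriv g J Y (lowerDeriv g J X Z) T x
    - lowerDeriv g J (VectorField.mlieBracket I X Y) Z T x

/-- The Hessian of `f` with respect to the almost product covariant derivative,
`H^f(X, T) = (∇̃_X df)(T)`. -/
def hessian (g : (x : M) → TangentSpace I x →L[ℝ] TangentSpace I x →L[ℝ] ℝ)
    (J : (x : M) → TangentSpace I x →L[ℝ] TangentSpace I x) (f : M → ℝ)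
    (X T : (x : M) → TangentSpace I x) : M → ℝ :=
  covDeriv g J X (differential I f) T

end Manifold

section WarpedProduct

variable {E : Type*} [NormedAddCommGroup E] [NormedSpace ℝ E]
  {H : Type*} [TopologicalSpace H] {I : ModelWithCorners ℝ E H}
  {B : Type*} [TopologicalSpace B] [ChartedSpace H B]
  {E' : Type*} [NormedAddCommGroup E'] [NormedSpace ℝ E']
  {H' : Type*} [TopologicalSpace H'] {I' : ModelWithCorners ℝ E' H'}
  {F : Type*} [TopologicalSpace F] [ChartedSpace H' F]

/-- The bilinear form `(v, w) ↦ β(A v, A w)`. -/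
def pullbackForm {V W : Type*} [TopologicalSpace V] [AddCommGroup V] [Module ℝ V]
    [TopologicalSpace W] [AddCommGroup W] [Module ℝ W]
    (β : W →L[ℝ] W →L[ℝ] ℝ) (A : V →L[ℝ] W) : V →L[ℝ] V →L[ℝ] ℝ :=
  (ContinuousLinearMap.precomp ℝ A).comp (β.comp A)

/-- The warped product metric `π_B^* g_B + (f ∘ π_B)² π_F^* g_F` on `B × F`. -/
def warpedMetric (gB : (x : B) → TangentSpace I x →L[ℝ] TangentSpace I x →L[ℝ] ℝ)
    (gF : (y : F) → TangentSpace I' y →L[ℝ] TangentSpace I' y →L[ℝ] ℝ) (f : B → ℝ) :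
    (p : B × F) →
      TangentSpace (I.prod I') p →L[ℝ] TangentSpace (I.prod I') p →L[ℝ] ℝ :=
  fun p =>
    pullbackForm (gB p.1) (mfderiv (I.prod I') I Prod.fst p) +
      (f p.1) ^ 2 • pullbackForm (gF p.2) (mfderiv (I.prod I') I' Prod.snd p)

/-- The product structure `J = (J₁, J₂)` on `T_(x,y)(B × F) = T_x B × T_y F`. -/
def productStructure (J₁ : (x : B) → TangentSpace I x →L[ℝ] TangentSpace I x)
    (J₂ : (y : F) → TangentSpace I' y →L[ℝ] TangentSpace I' y) :
    (p : B × F) → TangentSpace (I.prod I') p →L[ℝ] TangentSpace (I.prod I') p :=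
  fun p => (J₁ p.1).prodMap (J₂ p.2)

/-- The lift to `B × F` of a vector field on `B`. -/
def liftBase (I' : ModelWithCorners ℝ E' H') (F : Type*) [TopologicalSpace F] [ChartedSpace H' F]
    (X : (x : B) → TangentSpace I x) : (p : B × F) → TangentSpace (I.prod I') p :=
  fun p => (X p.1, (0 : TangentSpace I' p.2))

/-- The lift to `B × F` of a vector field on `F`. -/
def liftFiber (I : ModelWithCorners ℝ E H) (B : Type*) [TopologicalSpace B] [ChartedSpace H B]
    (V : (y : F) → TangentSpace I' y) : (p : B × F) → TangentSpace (I.prod I') p :=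
  fun p => ((0 : TangentSpace I p.1), V p.2)

end WarpedProduct

end SingularGeometry

end

set_option linter.unusedSectionVars false

noncomputable section

namespace SingularGeometry

theorem two_le_infty : (2 : WithTop ℕ∞) ≤ ∞ :=
  WithTop.coe_le_coe.2 (le_top : (2 : ℕ∞) ≤ ⊤)

section Calculus

variable {E : Type*} [NormedAddCommGroup E] [NormedSpace ℝ E]
  {H : Type*} [TopologicalSpace H] {I : ModelWithCorners ℝ E H}
  {M : Type*} [TopologicalSpace M] [ChartedSpace H M] [IsManifold I ∞ M]
  {X Y Z : (x : M) → TangentSpace I x} {h k : M → ℝ}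

theorem _root_.ContMDiff.mdiffAt (hh : ContMDiff I 𝓘(ℝ, ℝ) ∞ h) (x : M) :
    MDifferentiableAt I 𝓘(ℝ, ℝ) h x :=
  hh.contMDiffAt.mdifferentiableAt (by simp)

namespace IsSmoothField

theorem mdiffAt (hX : IsSmoothField X) (x : M) :
    MDifferentiableAt I I.tangent (fun x => (⟨x, X x⟩ : TangentBundle I M)) x :=
  ContMDiffAt.mdifferentiableAt (ContMDiff.contMDiffAt hX) (by simp)

theorem add (hX : IsSmoothField X) (hY : IsSmoothField Y) : IsSmoothField (X + Y) :=
  ContMDiff.add_section hX hY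

theorem smul (hh : ContMDiff I 𝓘(ℝ, ℝ) ∞ h) (hX : IsSmoothField X) : IsSmoothField (h • X) :=
  ContMDiff.smul_section hh hX

theorem zero : IsSmoothField (0 : (x : M) → TangentSpace I x) :=
  contMDiff_zeroSection ℝ (TangentSpace I)

theorem finsetSum {ι : Type*} {s : Finset ι} {X : ι → (x : M) → TangentSpace I x}
    (hX : ∀ i ∈ s, IsSmoothField (X i)) : IsSmoothField (∑ i ∈ s, X i) := by
  classical
  induction s using Finset.induction_on with
  | empty => simpa using zero
  | insert a s ha ih =>
    rw [Finset.sum_insert ha]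
    exact (hX a (by simp)).add (ih fun i hi => hX i (by simp [hi]))

theorem mlieBracket [CompleteSpace E] (hX : IsSmoothField X) (hY : IsSmoothField Y) :
    IsSmoothField (VectorField.mlieBracket I X Y) := by
  have : IsManifold I (minSmoothness ℝ 2) M := IsManifold.of_le (n := ∞) (by simpa using two_le_infty)
  have : IsManifold I (((⊤ : ℕ∞) : WithTop ℕ∞) + 1) M := IsManifold.of_le (n := ∞) (by simp)
  intro x
  exact ContMDiffAt.mlieBracket_vectorField (m := ⊤) (n := ⊤) hX.contMDiffAt hY.contMDiffAt
    (by simp)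

theorem contMDiff_dirDeriv (hX : IsSmoothField X) (hh : ContMDiff I 𝓘(ℝ, ℝ) ∞ h) :
    ContMDiff I 𝓘(ℝ, ℝ) ∞ (dirDeriv X h) := by
  have h1 : ContMDiff I.tangent 𝓘(ℝ, ℝ).tangent ∞ (tangentMap I 𝓘(ℝ, ℝ) h) :=
    hh.contMDiff_tangentMap (by simp)
  have h2 := contMDiff_snd_tangentBundle_modelSpace ℝ 𝓘(ℝ, ℝ) (n := ∞)
  exact h2.comp (h1.comp hX)

end IsSmoothField

theorem IsAlmostProduct.contMDiff_pairing
    {g : (x : M) → TangentSpace I x →L[ℝ] TangentSpace I x →L[ℝ] ℝ}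
    {J : (x : M) → TangentSpace I x →L[ℝ] TangentSpace I x} (hg : IsAlmostProduct g J)
    (hX : IsSmoothField X) (hY : IsSmoothField Y) :
    ContMDiff I 𝓘(ℝ, ℝ) ∞ (pairing g X Y) := by
  have := ContMDiff.clm_bundle_apply₂ (F₁ := E) (F₂ := E) (F₃ := ℝ)
    (E₃ := Bundle.Trivial M ℝ) hg.contMDiff_metric hX hY
  intro x
  have := this x
  simp only [contMDiffAt_section] at this
  exact this

theorem IsAlmostProduct.isSmoothField_applyField
    {g : (x : M) → TangentSpace I x →L[ℝ] TangentSpace I x →L[ℝ] ℝ}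
    {J : (x : M) → TangentSpace I x →L[ℝ] TangentSpace I x} (hg : IsAlmostProduct g J)
    (hX : IsSmoothField X) : IsSmoothField (applyField J X) :=
  ContMDiff.clm_bundle_apply (F₁ := E) (F₂ := E) hg.contMDiff_structure hX

theorem dirDeriv_add (hh : ContMDiff I 𝓘(ℝ, ℝ) ∞ h) (hk : ContMDiff I 𝓘(ℝ, ℝ) ∞ k) (x : M) :
    dirDeriv X (h + k) x = dirDeriv X h x + dirDeriv X k x := by
  simp [dirDeriv, mvfderiv_add (hh.mdiffAt x) (hk.mdiffAt x)]

theorem dirDeriv_mul (hh : ContMDiff I 𝓘(ℝ, ℝ) ∞ h) (hk : ContMDiff I 𝓘(ℝ, ℝ) ∞ k) (x : M) :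
    dirDeriv X (h * k) x = h x * dirDeriv X k x + dirDeriv X h x * k x := by
  simp [dirDeriv, mvfderiv_mul (hh.mdiffAt x) (hk.mdiffAt x)]
  ring

theorem dirDeriv_const (c : ℝ) (x : M) : dirDeriv X (fun _ => c) x = 0 := by
  simp [dirDeriv, mvfderiv_const]

theorem dirDeriv_const_mul (c : ℝ) (hh : ContMDiff I 𝓘(ℝ, ℝ) ∞ h) (x : M) :
    dirDeriv X (fun y => c * h y) x = c * dirDeriv X h x := by
  have := dirDeriv_mul (X := X) (h := fun _ => c) contMDiff_const hh x
  rw [dirDeriv_const] at this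
  simpa using! this

theorem dirDeriv_zero (x : M) : dirDeriv X (0 : M → ℝ) x = 0 := dirDeriv_const 0 x

theorem dirDeriv_congr {x : M} (hX : X x = Y x) (hh : h =ᶠ[𝓝 x] k) :
    dirDeriv X h x = dirDeriv Y k x := by
  unfold dirDeriv mvfderiv
  rw [hh.mfderiv_eq, hX, hh.self_of_nhds]

end Calculus

section Commutator

variable {E : Type*} [NormedAddCommGroup E] [NormedSpace ℝ E] [CompleteSpace E]
  {H : Type*} [TopologicalSpace H] {I : ModelWithCorners ℝ E H} [I.Boundaryless]
  {M : Type*} [TopologicalSpace M] [ChartedSpace H M] [IsManifold I ∞ M]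
  {X Y Z : (x : M) → TangentSpace I x} {h k : M → ℝ}

/-- The coordinate expression of the vector field `X` in the preferred chart at `x`. -/
def chartField (X : (x : M) → TangentSpace I x) (x : M) : E → E :=
  VectorField.mpullbackWithin 𝓘(ℝ, E) I (extChartAt I x).symm X (range I)

theorem dirDeriv_extChartAt_symm (hh : ContMDiff I 𝓘(ℝ, ℝ) ∞ h) (x : M) {y : E}
    (hy : y ∈ (extChartAt I x).target) :
    fderiv ℝ (h ∘ (extChartAt I x).symm) y (chartField X x y) =
      dirDeriv X h ((extChartAt I x).symm y) := by
  have hM : IsManifold I 1 M := IsManifold.of_le (n := ∞) (by simp)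
  have h1 : MDifferentiableAt 𝓘(ℝ, E) I (extChartAt I x).symm y := by
    have := mdifferentiableWithinAt_extChartAt_symm (I := I) hy
    rwa [I.range_eq_univ, mdifferentiableWithinAt_univ] at this
  have h2 := (hh.mdiffAt ((extChartAt I x).symm y))
  have h3 : fderiv ℝ (h ∘ (extChartAt I x).symm) y =
      (mfderiv I 𝓘(ℝ, ℝ) h ((extChartAt I x).symm y)).comp
        (mfderiv 𝓘(ℝ, E) I (extChartAt I x).symm y) := by
    rw [← mfderiv_comp y h2 h1, mfderiv_eq_fderiv]
  have h4 := isInvertible_mfderivWithin_extChartAt_symm (I := I) hy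
  rw [I.range_eq_univ, mfderivWithin_univ] at h4
  rw [h3, chartField, VectorField.mpullbackWithin_apply, I.range_eq_univ, mfderivWithin_univ]
  have h5 := h4.self_apply_inverse (X ((extChartAt I x).symm y))
  change mfderiv I 𝓘(ℝ, ℝ) h ((extChartAt I x).symm y)
    ((mfderiv 𝓘(ℝ, E) I (extChartAt I x).symm y) ((mfderiv 𝓘(ℝ, E) I (extChartAt I x).symm y).inverse
    (X ((extChartAt I x).symm y)))) = _
  rw [h5]
  rfl

theorem dirDeriv_eq_fderiv (hh : ContMDiff I 𝓘(ℝ, ℝ) ∞ h) (x : M) :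
    dirDeriv X h x =
      fderiv ℝ (h ∘ (extChartAt I x).symm) (extChartAt I x x)
        (chartField X x (extChartAt I x x)) := by
  rw [dirDeriv_extChartAt_symm hh x (mem_extChartAt_target x), extChartAt_to_inv]

theorem chartField_self (x : M) : chartField X x (extChartAt I x x) = X x := by
  have hM : IsManifold I 1 M := IsManifold.of_le (n := ∞) (by simp)
  have h1 : (X ((extChartAt I x).symm (extChartAt I x x)) : E) = X x :=
    congrArg (fun y => (X y : E)) (extChartAt_to_inv (I := I) x)
  exact (congrArg (fun v : E => ((mfderivWithin 𝓘(ℝ, E) I (extChartAt I x).symm (range I)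
    (extChartAt I x x)).inverse v : E)) h1).trans
      (mfderivWithin_extChartAt_symm_inverse_apply (I := I) (X x))

theorem chartField_mlieBracket (x : M) :
    chartField (VectorField.mlieBracket I X Y) x (extChartAt I x x) =
      VectorField.lieBracket ℝ (chartField X x) (chartField Y x) (extChartAt I x x) := by
  have hM : IsManifold I 1 M := IsManifold.of_le (n := ∞) (by simp)
  have h1 : ∀ v : E, ((mfderiv I 𝓘(ℝ, E) (extChartAt I x) x).inverse v : E) = v := by
    intro v
    rw [mfderiv_extChartAt_self]
    exact DFunLike.congr_fun (ContinuousLinearMap.inverse_id (R := ℝ) (M := E)) v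
  have h2 : VectorField.lieBracketWithin ℝ (chartField X x) (chartField Y x)
      ((extChartAt I x).symm ⁻¹' univ ∩ range I) (extChartAt I x x) =
      VectorField.lieBracket ℝ (chartField X x) (chartField Y x) (extChartAt I x x) := by
    rw [preimage_univ, univ_inter, I.range_eq_univ, VectorField.lieBracketWithin_univ]
  rw [chartField_self, ← h2]
  exact h1 _

theorem dirDeriv_mlieBracket (hX : IsSmoothField X) (hY : IsSmoothField Y)
    (hh : ContMDiff I 𝓘(ℝ, ℝ) ∞ h) (x : M) :
    dirDeriv (VectorField.mlieBracket I X Y) h x =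
      dirDeriv X (dirDeriv Y h) x - dirDeriv Y (dirDeriv X h) x := by
  set φ := extChartAt I x with hφ
  have hev : ∀ Z : (x : M) → TangentSpace I x, dirDeriv Z h ∘ φ.symm =ᶠ[𝓝 (φ x)]
      fun y => fderiv ℝ (h ∘ φ.symm) y (chartField Z x y) := by
    intro Z
    filter_upwards [extChartAt_target_mem_nhds (I := I) x] with y hy
    exact (dirDeriv_extChartAt_symm hh x hy).symm
  have hsm : ContDiffAt ℝ ∞ (h ∘ φ.symm) (φ x) := by
    have h1 := (hh.comp_contMDiffOn (contMDiffOn_extChartAt_symm (I := I) (n := ∞) x))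
    have h2 := h1.contMDiffAt (extChartAt_target_mem_nhds (I := I) x)
    exact h2.contDiffAt
  have hdf : DifferentiableAt ℝ (fderiv ℝ (h ∘ φ.symm)) (φ x) :=
    (hsm.fderiv_right (m := 1) (by rw [one_add_one_eq_two]; exact two_le_infty)).differentiableAt (by simp)
  have hd : ∀ {Z : (x : M) → TangentSpace I x}, IsSmoothField Z →
      DifferentiableAt ℝ (chartField Z x) (φ x) := by
    intro Z hZ
    have hM : IsManifold I 2 M := IsManifold.of_le (n := ∞) two_le_infty
    have := MDifferentiableWithinAt.differentiableWithinAt_mpullbackWithin_vectorField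
      (s := univ) (hZ.mdiffAt x).mdifferentiableWithinAt
    change DifferentiableWithinAt ℝ (chartField Z x) _ _ at this
    rwa [preimage_univ, univ_inter, I.range_eq_univ, differentiableWithinAt_univ] at this
  have hfd : ∀ {Z : (x : M) → TangentSpace I x}, IsSmoothField Z → ∀ v,
      fderiv ℝ (dirDeriv Z h ∘ φ.symm) (φ x) v =
      fderiv ℝ (h ∘ φ.symm) (φ x) (fderiv ℝ (chartField Z x) (φ x) v)
      + fderiv ℝ (fderiv ℝ (h ∘ φ.symm)) (φ x) v (chartField Z x (φ x)) := by
    intro Z hZ v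
    rw [(hev Z).fderiv_eq, fderiv_clm_apply hdf (hd hZ)]
    simp
  rw [dirDeriv_eq_fderiv hh x, dirDeriv_eq_fderiv (hY.contMDiff_dirDeriv hh) x,
    dirDeriv_eq_fderiv (hX.contMDiff_dirDeriv hh) x, chartField_mlieBracket, ← hφ,
    hfd hX, hfd hY, VectorField.lieBracket, map_sub]
  have := hsm.isSymmSndFDerivAt (by simpa using two_le_infty) (chartField X x (φ x)) (chartField Y x (φ x))
  rw [this]
  ring

end Commutator

section Extension

variable {E : Type*} [NormedAddCommGroup E] [NormedSpace ℝ E] [FiniteDimensional ℝ E]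
  {H : Type*} [TopologicalSpace H] {I : ModelWithCorners ℝ E H}
  {M : Type*} [TopologicalSpace M] [ChartedSpace H M] [IsManifold I ∞ M] [T2Space M]
  {X Y Z : (x : M) → TangentSpace I x} {h k : M → ℝ}

variable (I) in
theorem exists_smoothBump_subset {p : M} {u : Set M} (hu : u ∈ 𝓝 p) :
    ∃ ψ : M → ℝ, ContMDiff I 𝓘(ℝ, ℝ) ∞ ψ ∧ tsupport ψ ⊆ u ∧ ψ =ᶠ[𝓝 p] 1 := by
  obtain ⟨ψ, -, hψ⟩ := (SmoothBumpFunction.nhds_basis_tsupport (I := I) p).mem_iff.1 hu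
  exact ⟨ψ, ψ.contMDiff, hψ, ψ.eventuallyEq_one⟩

theorem exists_contMDiff_eventuallyEq {p : M} {u : Set M} (hu : IsOpen u) (hp : p ∈ u)
    (hh : ContMDiffOn I 𝓘(ℝ, ℝ) ∞ h u) :
    ∃ h' : M → ℝ, ContMDiff I 𝓘(ℝ, ℝ) ∞ h' ∧ h' =ᶠ[𝓝 p] h := by
  obtain ⟨ψ, hψ, hs, h1⟩ := exists_smoothBump_subset I (hu.mem_nhds hp)
  refine ⟨ψ * h, ?_, ?_⟩
  · refine contMDiff_of_tsupport fun x hx => ?_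
    have hxu : x ∈ u := hs (tsupport_mul_subset_left hx)
    exact hψ.contMDiffAt.mul (hh.contMDiffAt (hu.mem_nhds hxu))
  · filter_upwards [h1] with x hx
    simp [hx]

theorem exists_isSmoothField_eventuallyEq {p : M} {u : Set M} (hu : IsOpen u) (hp : p ∈ u)
    (hX : ContMDiffOn I I.tangent ∞ (fun x => (⟨x, X x⟩ : TangentBundle I M)) u) :
    ∃ X' : (x : M) → TangentSpace I x, IsSmoothField X' ∧ X' =ᶠ[𝓝 p] X := by
  obtain ⟨ψ, hψ, hs, h1⟩ := exists_smoothBump_subset I (hu.mem_nhds hp)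
  refine ⟨ψ • X, ContMDiffOn.smul_section_of_tsupport hψ.contMDiffOn hu hs hX, ?_⟩
  filter_upwards [h1] with x hx
  rw [Pi.smul_apply', hx]
  exact one_smul ℝ (X x)

/-- The index type of a basis of the model space. -/
abbrev FrameIndex (E : Type*) [NormedAddCommGroup E] [NormedSpace ℝ E] : Type :=
  Fin (Module.finrank ℝ E)

/-- The coordinates of a tangent vector with respect to the frame given by the preferred
trivialization at `p`. -/
def frameCoord (p : M) (i : FrameIndex E) (v : TangentBundle I M) : ℝ :=
  (Module.finBasis ℝ E).repr (trivializationAt E (TangentSpace I) p v).2 i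

theorem contMDiffOn_frameCoord (p : M) (i : FrameIndex E) :
    ContMDiffOn I.tangent 𝓘(ℝ, ℝ) ∞ (frameCoord (I := I) p i)
      (trivializationAt E (TangentSpace I) p).source := by
  have h1 := (trivializationAt E (TangentSpace I) p).contMDiffOn (IB := I) (n := ∞)
  have h2 := contMDiff_snd.comp_contMDiffOn h1
  have h3 : ContMDiff 𝓘(ℝ, E) 𝓘(ℝ, ℝ) ∞
      (LinearMap.toContinuousLinearMap ((Module.finBasis ℝ E).coord i)) :=
    ContinuousLinearMap.contMDiff _
  exact h3.comp_contMDiffOn h2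

/-- Near every point there is a frame consisting of globally defined smooth vector fields. -/
theorem exists_smooth_frame (p : M) :
    ∃ e : FrameIndex E → (x : M) → TangentSpace I x, (∀ i, IsSmoothField (e i)) ∧
      ∀ᶠ x in 𝓝 p, x ∈ (trivializationAt E (TangentSpace I) p).baseSet ∧
        ∀ v : TangentSpace I x, v = ∑ i, frameCoord p i ⟨x, v⟩ • e i x := by
  have hM : IsManifold I 1 M := IsManifold.of_le (n := ∞) (by simp)
  set t := trivializationAt E (TangentSpace I) p
  set b := Module.finBasis ℝ E
  have hp : p ∈ t.baseSet := FiberBundle.mem_baseSet_trivializationAt E (TangentSpace I) p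
  have := fun i => exists_isSmoothField_eventuallyEq t.open_baseSet hp
    (t.contMDiffOn_localFrame_baseSet (I := I) ∞ b i)
  choose e he hee using this
  refine ⟨e, he, ?_⟩
  filter_upwards [t.open_baseSet.mem_nhds hp, eventually_all.2 hee] with x hx hex
  refine ⟨hx, fun v => ?_⟩
  have h1 := t.eq_sum_localFrameCoeff_smul (I := I) (b := b) (s := fun _ => (v : E)) hx
  refine h1.trans (Finset.sum_congr rfl fun i _ => ?_)
  have h2 : t.localFrameCoeff I b i x v = frameCoord p i ⟨x, v⟩ :=
    t.localFrameCoeff_eq_coeff (s := fun _ => (v : E)) hx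
  rw [h2, hex i]

theorem exists_isSmoothField_apply_eq (p : M) (v : TangentSpace I p) :
    ∃ X : (x : M) → TangentSpace I x, IsSmoothField X ∧ X p = v := by
  obtain ⟨e, he, hev⟩ := exists_smooth_frame (I := I) p
  refine ⟨∑ i, (fun _ => frameCoord p i ⟨p, v⟩ : M → ℝ) • e i,
    .finsetSum fun i _ => .smul contMDiff_const (he i), ?_⟩
  have := hev.self_of_nhds.2 v
  simp only [Finset.sum_apply, Pi.smul_apply']
  exact this.symm

/-- Tangent vectors are separated by the differentials of smooth functions. -/
theorem eq_of_forall_mvfderiv_eq {p : M} {v w : TangentSpace I p}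
    (hvw : ∀ h : M → ℝ, ContMDiff I 𝓘(ℝ, ℝ) ∞ h → mvfderiv I h p v = mvfderiv I h p w) :
    v = w := by
  have hM : IsManifold I 1 M := IsManifold.of_le (n := ∞) (by simp)
  refine (Module.finBasis ℝ E).ext_elem fun i => ?_
  set L : E →L[ℝ] ℝ := LinearMap.toContinuousLinearMap ((Module.finBasis ℝ E).coord i)
  have h1 : ContMDiffOn I 𝓘(ℝ, ℝ) ∞ (L ∘ extChartAt I p) (chartAt H p).source :=
    L.contMDiff.comp_contMDiffOn contMDiffOn_extChartAt
  obtain ⟨h, hh, hev⟩ := exists_contMDiff_eventuallyEq (chartAt H p).open_source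
    (mem_chart_source H p) h1
  have h2 : ∀ u : TangentSpace I p, mvfderiv I h p u = L u := by
    intro u
    have h3 : mfderiv I 𝓘(ℝ, ℝ) h p = mfderiv I 𝓘(ℝ, ℝ) (L ∘ extChartAt I p) p := hev.mfderiv_eq
    have h4 : mfderiv I 𝓘(ℝ, ℝ) (L ∘ extChartAt I p) p =
        (mfderiv 𝓘(ℝ, E) 𝓘(ℝ, ℝ) L (extChartAt I p p)).comp
          (mfderiv I 𝓘(ℝ, E) (extChartAt I p) p) :=
      mfderiv_comp p L.mdifferentiableAt (mdifferentiableAt_extChartAt (mem_chart_source H p))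
    rw [mfderiv_extChartAt_self, ContinuousLinearMap.mfderiv_eq] at h4
    change mfderiv I 𝓘(ℝ, ℝ) h p u = L u
    rw [h3, h4]
    rfl
  have := hvw h hh
  rw [h2, h2] at this
  exact this

/-- A section of a bundle of homomorphisms out of the tangent bundle is smooth if it maps smooth
vector fields to smooth sections. -/
theorem contMDiff_hom_section_of_apply {F₂ : Type*} [NormedAddCommGroup F₂] [NormedSpace ℝ F₂]
    {E₂ : M → Type*} [TopologicalSpace (TotalSpace F₂ E₂)] [∀ x, AddCommGroup (E₂ x)]
    [∀ x, Module ℝ (E₂ x)] [∀ x, TopologicalSpace (E₂ x)] [FiberBundle F₂ E₂]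
    [VectorBundle ℝ F₂ E₂] [∀ x, IsTopologicalAddGroup (E₂ x)] [∀ x, ContinuousSMul ℝ (E₂ x)]
    {φ : (x : M) → TangentSpace I x →L[ℝ] E₂ x}
    (hφ : ∀ X : (x : M) → TangentSpace I x, IsSmoothField X →
      ContMDiff I (I.prod 𝓘(ℝ, F₂)) ∞ (fun x => TotalSpace.mk' F₂ (E := E₂) x (φ x (X x)))) :
    ContMDiff I (I.prod 𝓘(ℝ, E →L[ℝ] F₂)) ∞
      (fun x => TotalSpace.mk' (E →L[ℝ] F₂)
        (E := fun x : M => TangentSpace I x →L[ℝ] E₂ x) x (φ x)) := by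
  have hM : IsManifold I 1 M := IsManifold.of_le (n := ∞) (by simp)
  intro p
  rw [contMDiffAt_hom_bundle]
  refine ⟨contMDiffAt_id, ?_⟩
  set t := trivializationAt E (TangentSpace I) p
  set b := Module.finBasis ℝ E
  have hp : p ∈ t.baseSet := FiberBundle.mem_baseSet_trivializationAt E (TangentSpace I) p
  have hp₂ : p ∈ (trivializationAt F₂ E₂ p).baseSet :=
    FiberBundle.mem_baseSet_trivializationAt F₂ E₂ p
  have := fun i => exists_isSmoothField_eventuallyEq t.open_baseSet hp
    (t.contMDiffOn_localFrame_baseSet (I := I) ∞ b i)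
  choose e he hee using this
  have h1 : ∀ i, ContMDiffAt I 𝓘(ℝ, F₂) ∞
      (fun x => (trivializationAt F₂ E₂ p ⟨x, φ x (e i x)⟩).2) p := fun i =>
    (contMDiffAt_section _).1 (hφ (e i) (he i) p)
  have h2 : ContMDiffAt I 𝓘(ℝ, E →L[ℝ] F₂) ∞ (fun x => ∑ i,
      (ContinuousLinearMap.smulRightL ℝ E F₂ (LinearMap.toContinuousLinearMap (b.coord i)))
        (trivializationAt F₂ E₂ p ⟨x, φ x (e i x)⟩).2) p :=
    contMDiffAt_finsetSum fun i _ =>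
      (ContinuousLinearMap.contMDiff _).contMDiffAt.comp p (h1 i)
  refine h2.congr_of_eventuallyEq ?_
  filter_upwards [t.open_baseSet.mem_nhds hp,
    (trivializationAt F₂ E₂ p).open_baseSet.mem_nhds hp₂, eventually_all.2 hee] with x hx hx₂ hex
  refine ContinuousLinearMap.coe_inj.1 (b.ext fun j => ?_)
  have h3 : e j x = t.symm x (b j) := by
    rw [hex j, t.localFrame_apply_of_mem_baseSet b hx]
    simp [Bundle.Trivialization.basisAt]
  have h4 := ContinuousLinearMap.inCoordinates_eq (ϕ := φ x) hx hx₂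
  rw [h4]
  simp [Finsupp.single_apply]
  rw [h3]

end Extension

section Product

variable {E : Type*} [NormedAddCommGroup E] [NormedSpace ℝ E] [FiniteDimensional ℝ E]
  {H : Type*} [TopologicalSpace H] {I : ModelWithCorners ℝ E H}
  {B : Type*} [TopologicalSpace B] [ChartedSpace H B] [IsManifold I ∞ B] [T2Space B]
  {E' : Type*} [NormedAddCommGroup E'] [NormedSpace ℝ E'] [FiniteDimensional ℝ E']
  {H' : Type*} [TopologicalSpace H'] {I' : ModelWithCorners ℝ E' H'}
  {F : Type*} [TopologicalSpace F] [ChartedSpace H' F] [IsManifold I' ∞ F] [T2Space F]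
  {X Y : (x : B) → TangentSpace I x} {V W : (y : F) → TangentSpace I' y}

theorem IsSmoothField.liftBase (hX : IsSmoothField X) :
    IsSmoothField (SingularGeometry.liftBase I' F X) := by
  have hB : IsManifold I 1 B := IsManifold.of_le (n := ∞) (by simp)
  have hF : IsManifold I' 1 F := IsManifold.of_le (n := ∞) (by simp)
  have h1 := (contMDiff_equivTangentBundleProd_symm (I := I) (M := B) (I' := I') (M' := F)
    (n := ∞))
  have h2 : ContMDiff (I.prod I') I.tangent ∞
      (fun p : B × F => (⟨p.1, X p.1⟩ : TangentBundle I B)) := ContMDiff.comp hX contMDiff_fst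
  have h3 : ContMDiff (I.prod I') I'.tangent ∞
      (fun p : B × F => (⟨p.2, 0⟩ : TangentBundle I' F)) :=
    ContMDiff.comp (IsSmoothField.zero (I := I') (M := F)) contMDiff_snd
  exact h1.comp (h2.prodMk h3)

theorem IsSmoothField.liftFiber (hV : IsSmoothField V) :
    IsSmoothField (SingularGeometry.liftFiber I B V) := by
  have hB : IsManifold I 1 B := IsManifold.of_le (n := ∞) (by simp)
  have hF : IsManifold I' 1 F := IsManifold.of_le (n := ∞) (by simp)
  have h1 := (contMDiff_equivTangentBundleProd_symm (I := I) (M := B) (I' := I') (M' := F)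
    (n := ∞))
  have h2 : ContMDiff (I.prod I') I.tangent ∞
      (fun p : B × F => (⟨p.1, 0⟩ : TangentBundle I B)) :=
    ContMDiff.comp (IsSmoothField.zero (I := I) (M := B)) contMDiff_fst
  have h3 : ContMDiff (I.prod I') I'.tangent ∞
      (fun p : B × F => (⟨p.2, V p.2⟩ : TangentBundle I' F)) := ContMDiff.comp hV contMDiff_snd
  exact h1.comp (h2.prodMk h3)

/-- Every smooth vector field on a product is, near a given point, a combination of lifts with
smooth coefficients. -/
theorem exists_eventuallyEq_sum_lifts {A : (p : B × F) → TangentSpace (I.prod I') p}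
    (hA : IsSmoothField A) (p : B × F) :
    ∃ (e : FrameIndex E → (x : B) → TangentSpace I x)
      (ε : FrameIndex E' → (y : F) → TangentSpace I' y)
      (a : FrameIndex E → B × F → ℝ) (c : FrameIndex E' → B × F → ℝ),
      (∀ i, IsSmoothField (e i)) ∧ (∀ j, IsSmoothField (ε j)) ∧
      (∀ i, ContMDiff (I.prod I') 𝓘(ℝ, ℝ) ∞ (a i)) ∧
      (∀ j, ContMDiff (I.prod I') 𝓘(ℝ, ℝ) ∞ (c j)) ∧
      A =ᶠ[𝓝 p] ∑ i, a i • SingularGeometry.liftBase I' F (e i) +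
        ∑ j, c j • SingularGeometry.liftFiber I B (ε j) := by
  have hB : IsManifold I 1 B := IsManifold.of_le (n := ∞) (by simp)
  have hF : IsManifold I' 1 F := IsManifold.of_le (n := ∞) (by simp)
  obtain ⟨e, he, hev⟩ := exists_smooth_frame (I := I) p.1
  obtain ⟨ε, hε, hεv⟩ := exists_smooth_frame (I := I') p.2
  have h0 := (contMDiff_equivTangentBundleProd (I := I) (M := B) (I' := I') (M' := F)
    (n := ∞)).comp hA
  set t := trivializationAt E (TangentSpace I) p.1
  set t' := trivializationAt E' (TangentSpace I') p.2
  have hpt : p.1 ∈ t.baseSet := FiberBundle.mem_baseSet_trivializationAt E (TangentSpace I) p.1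
  have hpt' : p.2 ∈ t'.baseSet :=
    FiberBundle.mem_baseSet_trivializationAt E' (TangentSpace I') p.2
  have h1 : ∀ i, ∃ a : B × F → ℝ, ContMDiff (I.prod I') 𝓘(ℝ, ℝ) ∞ a ∧
      a =ᶠ[𝓝 p] fun q => frameCoord (I := I) p.1 i ⟨q.1, (A q).1⟩ := fun i => by
    refine exists_contMDiff_eventuallyEq (u := Prod.fst ⁻¹' t.baseSet)
      (t.open_baseSet.preimage continuous_fst) hpt ?_
    refine (contMDiffOn_frameCoord (I := I) p.1 i).comp
      (contMDiff_fst.comp h0).contMDiffOn fun q hq => ?_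
    rw [mem_preimage, t.mem_source]
    exact hq
  have h2 : ∀ j, ∃ c : B × F → ℝ, ContMDiff (I.prod I') 𝓘(ℝ, ℝ) ∞ c ∧
      c =ᶠ[𝓝 p] fun q => frameCoord (I := I') p.2 j ⟨q.2, (A q).2⟩ := fun j => by
    refine exists_contMDiff_eventuallyEq (u := Prod.snd ⁻¹' t'.baseSet)
      (t'.open_baseSet.preimage continuous_snd) hpt' ?_
    refine (contMDiffOn_frameCoord (I := I') p.2 j).comp
      (contMDiff_snd.comp h0).contMDiffOn fun q hq => ?_
    rw [mem_preimage, t'.mem_source]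
    exact hq
  choose a ha ha' using h1
  choose c hc hc' using h2
  refine ⟨e, ε, a, c, he, hε, ha, hc, ?_⟩
  filter_upwards [eventually_all.2 ha', eventually_all.2 hc',
    continuous_fst.continuousAt.eventually hev,
    continuous_snd.continuousAt.eventually hεv] with q hq1 hq2 hq3 hq4
  have h5 := hq3.2 (A q).1
  have h6 := hq4.2 (A q).2
  have key : ∀ (n : ℕ) (u : Fin n → ℝ) (w : Fin n → E × E'),
    ((∑ i, u i • w i).1 = ∑ i, u i • (w i).1) ∧ ((∑ i, u i • w i).2 = ∑ i, u i • (w i).2) := by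
    intro n u w
    simp [Prod.fst_sum, Prod.snd_sum]
  have hs1 : (∑ i, a i • SingularGeometry.liftBase I' F (e i)) q = (((A q).1, 0) : E × E') := by
    rw [Finset.sum_apply]
    refine Prod.ext ?_ ?_
    · refine (key _ _ _).1.trans (Eq.trans ?_ h5.symm)
      refine Finset.sum_congr rfl fun i _ => ?_
      rw [hq1 i]
      rfl
    · refine (key _ _ _).2.trans (Finset.sum_eq_zero fun i _ => ?_)
      exact smul_zero (M := ℝ) (A := E') (a i q)
  have hs2 : (∑ j, c j • SingularGeometry.liftFiber I B (ε j)) q = ((0, (A q).2) : E × E') := by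
    rw [Finset.sum_apply]
    refine Prod.ext ?_ ?_
    · refine (key _ _ _).1.trans (Finset.sum_eq_zero fun i _ => ?_)
      exact smul_zero (M := ℝ) (A := E) (c i q)
    · refine (key _ _ _).2.trans (Eq.trans ?_ h6.symm)
      refine Finset.sum_congr rfl fun i _ => ?_
      rw [hq2 i]
      rfl
  rw [Pi.add_apply, hs1, hs2]
  refine Prod.ext ?_ ?_
  · exact (add_zero ((A q).1 : E)).symm
  · exact (zero_add ((A q).2 : E')).symm

/-- Induction principle for smooth vector fields on a product: a property that only depends on the
germ at a point and is stable under addition and multiplication by smooth functions holds for all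
smooth vector fields once it holds for lifts. -/
theorem productField_induction {p : B × F} {P : ((p : B × F) → TangentSpace (I.prod I') p) → Prop}
    (congr : ∀ A A', IsSmoothField A → IsSmoothField A' → A =ᶠ[𝓝 p] A' → P A → P A')
    (add : ∀ A A', IsSmoothField A → IsSmoothField A' → P A → P A' → P (A + A'))
    (smul : ∀ (h : B × F → ℝ) A, ContMDiff (I.prod I') 𝓘(ℝ, ℝ) ∞ h → IsSmoothField A → P A →
      P (h • A))
    (base : ∀ X : (x : B) → TangentSpace I x, IsSmoothField X →
      P (SingularGeometry.liftBase I' F X))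
    (fiber : ∀ V : (y : F) → TangentSpace I' y, IsSmoothField V →
      P (SingularGeometry.liftFiber I B V))
    {A : (p : B × F) → TangentSpace (I.prod I') p} (hA : IsSmoothField A) : P A := by
  obtain ⟨e, ε, a, c, he, hε, ha, hc, hev⟩ := exists_eventuallyEq_sum_lifts hA p
  have zero : P 0 := by
    have := smul 0 _ contMDiff_const (IsSmoothField.zero (I := I) (M := B)).liftBase
      (base 0 .zero)
    rwa [zero_smul] at this
  have sum : ∀ {ι : Type} (s : Finset ι) (A : ι → (p : B × F) → TangentSpace (I.prod I') p),
      (∀ i, IsSmoothField (A i)) → (∀ i, P (A i)) → P (∑ i ∈ s, A i) := by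
    classical
    intro ι s A hA hP
    induction s using Finset.induction_on with
    | empty => simpa using zero
    | insert i s hi ih =>
      rw [Finset.sum_insert hi]
      exact add _ _ (hA i) (.finsetSum fun i _ => hA i) (hP i) ih
  have h1 : ∀ i, IsSmoothField (a i • SingularGeometry.liftBase I' F (e i)) := fun i =>
    .smul (ha i) (he i).liftBase
  have h2 : ∀ j, IsSmoothField (c j • SingularGeometry.liftFiber I B (ε j)) := fun j =>
    .smul (hc j) (hε j).liftFiber
  have h3 := add _ _ (.finsetSum fun i (_ : i ∈ Finset.univ) => h1 i)
    (.finsetSum fun i (_ : i ∈ Finset.univ) => h2 i)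
    (sum Finset.univ _ h1 fun i => smul _ _ (ha i) (he i).liftBase (base _ (he i)))
    (sum Finset.univ _ h2 fun j => smul _ _ (hc j) (hε j).liftFiber (fiber _ (hε j)))
  exact congr _ _ (.add (.finsetSum fun i _ => h1 i) (.finsetSum fun i _ => h2 i)) hA hev.symm h3

end Product

section Koszul

variable {E : Type*} [NormedAddCommGroup E] [NormedSpace ℝ E] [FiniteDimensional ℝ E]
  {H : Type*} [TopologicalSpace H] {I : ModelWithCorners ℝ E H}
  {M : Type*} [TopologicalSpace M] [ChartedSpace H M] [IsManifold I ∞ M]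
  {X X' Y Y' Z Z' : (x : M) → TangentSpace I x} {h k : M → ℝ}
  {g : (x : M) → TangentSpace I x →L[ℝ] TangentSpace I x →L[ℝ] ℝ}
  {J : (x : M) → TangentSpace I x →L[ℝ] TangentSpace I x}

theorem pairing_add_left : pairing g (X + X') Y = pairing g X Y + pairing g X' Y := by
  ext x; simp [pairing]

theorem pairing_add_right : pairing g X (Y + Y') = pairing g X Y + pairing g X Y' := by
  ext x; simp [pairing]

theorem pairing_smul_left : pairing g (h • X) Y = h * pairing g X Y := by
  ext x; simp [pairing]

theorem pairing_smul_right : pairing g X (h • Y) = h * pairing g X Y := by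
  ext x; simp [pairing]

theorem applyField_add : applyField J (X + Y) = applyField J X + applyField J Y := by
  ext x; simp [applyField]

theorem applyField_smul : applyField J (h • X) = h • applyField J X := by
  ext x; simp [applyField]

theorem dirDeriv_add_field (x : M) :
    dirDeriv (X + X') h x = dirDeriv X h x + dirDeriv X' h x := by
  simp [dirDeriv]

theorem dirDeriv_smul_field (x : M) :
    dirDeriv (k • X) h x = k x * dirDeriv X h x := by
  simp [dirDeriv]

theorem mlieBracket_add_left' (hX : IsSmoothField X) (hX' : IsSmoothField X') :
    VectorField.mlieBracket I (X + X') Y =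
      VectorField.mlieBracket I X Y + VectorField.mlieBracket I X' Y := by
  have hM : IsManifold I (minSmoothness ℝ 2) M :=
    IsManifold.of_le (n := ∞) (by simpa using two_le_infty)
  have hM : IsManifold I 2 M := IsManifold.of_le (n := ∞) two_le_infty
  ext x
  exact VectorField.mlieBracket_add_left (hX.mdiffAt x) (hX'.mdiffAt x)

theorem mlieBracket_add_right' (hY : IsSmoothField Y) (hY' : IsSmoothField Y') :
    VectorField.mlieBracket I X (Y + Y') =
      VectorField.mlieBracket I X Y + VectorField.mlieBracket I X Y' := by
  have hM : IsManifold I 2 M := IsManifold.of_le (n := ∞) two_le_infty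
  ext x
  exact VectorField.mlieBracket_add_right (hY.mdiffAt x) (hY'.mdiffAt x)

theorem mlieBracket_smul_left' (hh : ContMDiff I 𝓘(ℝ, ℝ) ∞ h) (hX : IsSmoothField X) :
    VectorField.mlieBracket I (h • X) Y =
      -(dirDeriv Y h • X) + h • VectorField.mlieBracket I X Y := by
  have hM : IsManifold I 2 M := IsManifold.of_le (n := ∞) two_le_infty
  ext x
  rw [VectorField.mlieBracket_smul_left (hh.mdiffAt x) (hX.mdiffAt x)]
  simp [dirDeriv]

theorem mlieBracket_smul_right' (hh : ContMDiff I 𝓘(ℝ, ℝ) ∞ h) (hY : IsSmoothField Y) :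
    VectorField.mlieBracket I X (h • Y) =
      dirDeriv X h • Y + h • VectorField.mlieBracket I X Y := by
  have hM : IsManifold I 2 M := IsManifold.of_le (n := ∞) two_le_infty
  ext x
  rw [VectorField.mlieBracket_smul_right (hh.mdiffAt x) (hY.mdiffAt x)]
  simp [dirDeriv]

theorem pairing_neg_right : pairing g X (-Y) = -pairing g X Y := by
  ext x; simp [pairing]

theorem pairing_comm (hg : IsAlmostProduct g J) (X Y : (x : M) → TangentSpace I x) :
    pairing g X Y = pairing g Y X := by
  ext x; exact hg.symm x _ _

theorem pairing_apply_apply (hg : IsAlmostProduct g J) (X Y : (x : M) → TangentSpace I x) :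
    pairing g (applyField J X) (applyField J Y) = pairing g X Y := by
  ext x; exact hg.isometry x _ _

theorem applyField_applyField (hg : IsAlmostProduct g J) (X : (x : M) → TangentSpace I x) :
    applyField J (applyField J X) = X := by
  ext x; exact hg.involutive x _

theorem pairing_applyField_right (hg : IsAlmostProduct g J) (X Y : (x : M) → TangentSpace I x) :
    pairing g X (applyField J Y) = pairing g (applyField J X) Y := by
  rw [← pairing_apply_apply hg (applyField J X) Y, applyField_applyField hg]

/-- Compatibility of the Koszul form with the metric. -/
theorem koszul_add_koszul_swap (hg : IsAlmostProduct g J) (X Y Z : (x : M) → TangentSpace I x)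
    (x : M) : koszul g X Y Z x + koszul g X Z Y x = dirDeriv X (pairing g Y Z) x := by
  unfold koszul
  rw [pairing_comm hg Z Y, pairing_comm hg Y X, pairing_comm hg X Z,
    VectorField.mlieBracket_swap (V := Z) (W := Y),
    VectorField.mlieBracket_swap (V := Y) (W := X),
    VectorField.mlieBracket_swap (V := X) (W := Z)]
  simp only [pairing_neg_right, Pi.neg_apply]
  ring

/-- The Koszul form is torsion-free. -/
theorem koszul_sub_koszul_swap (hg : IsAlmostProduct g J) (X Y Z : (x : M) → TangentSpace I x)
    (x : M) :
    koszul g X Y Z x - koszul g Y X Z x = pairing g (VectorField.mlieBracket I X Y) Z x := by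
  unfold koszul
  rw [pairing_comm hg (VectorField.mlieBracket I X Y) Z, pairing_comm hg Y X, pairing_comm hg X Z,
    pairing_comm hg Z Y, VectorField.mlieBracket_swap (V := Y) (W := X),
    VectorField.mlieBracket_swap (V := X) (W := Z), VectorField.mlieBracket_swap (V := Z) (W := Y)]
  simp only [pairing_neg_right, Pi.neg_apply]
  ring

variable (hg : IsAlmostProduct g J)
include hg

theorem contMDiff_koszul (hX : IsSmoothField X) (hY : IsSmoothField Y) (hZ : IsSmoothField Z) :
    ContMDiff I 𝓘(ℝ, ℝ) ∞ (koszul g X Y Z) := by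
  have h1 := hX.contMDiff_dirDeriv (hg.contMDiff_pairing hY hZ)
  have h2 := hY.contMDiff_dirDeriv (hg.contMDiff_pairing hZ hX)
  have h3 := hZ.contMDiff_dirDeriv (hg.contMDiff_pairing hX hY)
  have h4 := hg.contMDiff_pairing hX (hY.mlieBracket hZ)
  have h5 := hg.contMDiff_pairing hY (hZ.mlieBracket hX)
  have h6 := hg.contMDiff_pairing hZ (hX.mlieBracket hY)
  exact contMDiff_const.mul (((((h1.add h2).sub h3).sub h4).add h5).add h6)

theorem koszul_add_left (hX : IsSmoothField X) (hX' : IsSmoothField X') (hY : IsSmoothField Y)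
    (hZ : IsSmoothField Z) (x : M) :
    koszul g (X + X') Y Z x = koszul g X Y Z x + koszul g X' Y Z x := by
  unfold koszul
  simp only [pairing_add_left, pairing_add_right, mlieBracket_add_left' hX hX',
    mlieBracket_add_right' hX hX', dirDeriv_add_field,
    dirDeriv_add (hg.contMDiff_pairing hZ hX) (hg.contMDiff_pairing hZ hX'),
    dirDeriv_add (hg.contMDiff_pairing hX hY) (hg.contMDiff_pairing hX' hY), Pi.add_apply]
  ring

theorem koszul_smul_left (hh : ContMDiff I 𝓘(ℝ, ℝ) ∞ h) (hX : IsSmoothField X)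
    (hY : IsSmoothField Y) (hZ : IsSmoothField Z) (x : M) :
    koszul g (h • X) Y Z x = h x * koszul g X Y Z x := by
  unfold koszul
  rw [pairing_comm hg Z (h • X)]
  simp only [pairing_add_right, mlieBracket_smul_left' hh hX, pairing_neg_right,
    mlieBracket_smul_right' hh hX, dirDeriv_smul_field, pairing_smul_left, pairing_smul_right,
    dirDeriv_mul hh (hg.contMDiff_pairing hX hZ),
    dirDeriv_mul hh (hg.contMDiff_pairing hX hY), Pi.add_apply, Pi.mul_apply, Pi.neg_apply]
  rw [pairing_comm hg Z X, pairing_comm hg Y X]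
  ring

theorem koszul_add_middle (hX : IsSmoothField X) (hY : IsSmoothField Y) (hY' : IsSmoothField Y')
    (hZ : IsSmoothField Z) (x : M) :
    koszul g X (Y + Y') Z x = koszul g X Y Z x + koszul g X Y' Z x := by
  unfold koszul
  simp only [pairing_add_left, pairing_add_right, mlieBracket_add_left' hY hY',
    mlieBracket_add_right' hY hY', dirDeriv_add_field,
    dirDeriv_add (hg.contMDiff_pairing hY hZ) (hg.contMDiff_pairing hY' hZ),
    dirDeriv_add (hg.contMDiff_pairing hX hY) (hg.contMDiff_pairing hX hY'), Pi.add_apply]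
  ring

theorem koszul_smul_middle (hh : ContMDiff I 𝓘(ℝ, ℝ) ∞ h) (hX : IsSmoothField X)
    (hY : IsSmoothField Y) (hZ : IsSmoothField Z) (x : M) :
    koszul g X (h • Y) Z x = h x * koszul g X Y Z x + dirDeriv X h x * pairing g Y Z x := by
  unfold koszul
  simp only [pairing_add_right, mlieBracket_smul_left' hh hY, pairing_neg_right,
    mlieBracket_smul_right' hh hY, dirDeriv_smul_field, pairing_smul_left, pairing_smul_right,
    dirDeriv_mul hh (hg.contMDiff_pairing hX hY),
    dirDeriv_mul hh (hg.contMDiff_pairing hY hZ), Pi.add_apply, Pi.mul_apply, Pi.neg_apply]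
  rw [pairing_comm hg Z Y]
  ring

theorem koszul_add_right (hX : IsSmoothField X) (hY : IsSmoothField Y) (hZ : IsSmoothField Z)
    (hZ' : IsSmoothField Z') (x : M) :
    koszul g X Y (Z + Z') x = koszul g X Y Z x + koszul g X Y Z' x := by
  have h1 := koszul_add_koszul_swap hg X Y (Z + Z') x
  rw [pairing_add_right, dirDeriv_add (hg.contMDiff_pairing hY hZ) (hg.contMDiff_pairing hY hZ'),
    koszul_add_middle hg hX hZ hZ' hY] at h1
  linarith [koszul_add_koszul_swap hg X Y Z x, koszul_add_koszul_swap hg X Y Z' x]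

theorem koszul_smul_right (hh : ContMDiff I 𝓘(ℝ, ℝ) ∞ h) (hX : IsSmoothField X)
    (hY : IsSmoothField Y) (hZ : IsSmoothField Z) (x : M) :
    koszul g X Y (h • Z) x = h x * koszul g X Y Z x := by
  have h1 := koszul_add_koszul_swap hg X Y (h • Z) x
  rw [pairing_smul_right, dirDeriv_mul hh (hg.contMDiff_pairing hY hZ),
    koszul_smul_middle hg hh hX hZ hY, pairing_comm hg Z Y] at h1
  linear_combination h1 - h x * koszul_add_koszul_swap hg X Y Z x

omit hg in
theorem koszul_congr {x : M} (hX : X =ᶠ[𝓝 x] X') (hY : Y =ᶠ[𝓝 x] Y') (hZ : Z =ᶠ[𝓝 x] Z') :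
    koszul g X Y Z x = koszul g X' Y' Z' x := by
  have hp : ∀ {A A' C C' : (x : M) → TangentSpace I x}, A =ᶠ[𝓝 x] A' → C =ᶠ[𝓝 x] C' →
      pairing g A C =ᶠ[𝓝 x] pairing g A' C' := by
    intro A A' C C' h1 h2
    filter_upwards [h1, h2] with y hy1 hy2
    simp [pairing, hy1, hy2]
  unfold koszul
  rw [dirDeriv_congr hX.self_of_nhds (hp hY hZ), dirDeriv_congr hY.self_of_nhds (hp hZ hX),
    dirDeriv_congr hZ.self_of_nhds (hp hX hY)]
  unfold pairing
  rw [hY.mlieBracket_vectorField_eq hZ, hZ.mlieBracket_vectorField_eq hX,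
    hX.mlieBracket_vectorField_eq hY, hX.self_of_nhds, hY.self_of_nhds, hZ.self_of_nhds]

theorem contMDiff_apKoszul (hX : IsSmoothField X) (hY : IsSmoothField Y) (hZ : IsSmoothField Z) :
    ContMDiff I 𝓘(ℝ, ℝ) ∞ (apKoszul g J X Y Z) :=
  contMDiff_const.mul ((contMDiff_koszul hg hX hY hZ).add (contMDiff_koszul hg hX
    (hg.isSmoothField_applyField hY) (hg.isSmoothField_applyField hZ)))

theorem apKoszul_add_left (hX : IsSmoothField X) (hX' : IsSmoothField X') (hY : IsSmoothField Y)
    (hZ : IsSmoothField Z) (x : M) :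
    apKoszul g J (X + X') Y Z x = apKoszul g J X Y Z x + apKoszul g J X' Y Z x := by
  unfold apKoszul
  rw [koszul_add_left hg hX hX' hY hZ, koszul_add_left hg hX hX' (hg.isSmoothField_applyField hY)
    (hg.isSmoothField_applyField hZ)]
  ring

theorem apKoszul_smul_left (hh : ContMDiff I 𝓘(ℝ, ℝ) ∞ h) (hX : IsSmoothField X)
    (hY : IsSmoothField Y) (hZ : IsSmoothField Z) (x : M) :
    apKoszul g J (h • X) Y Z x = h x * apKoszul g J X Y Z x := by
  unfold apKoszul
  rw [koszul_smul_left hg hh hX hY hZ, koszul_smul_left hg hh hX (hg.isSmoothField_applyField hY)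
    (hg.isSmoothField_applyField hZ)]
  ring

theorem apKoszul_add_middle (hX : IsSmoothField X) (hY : IsSmoothField Y) (hY' : IsSmoothField Y')
    (hZ : IsSmoothField Z) (x : M) :
    apKoszul g J X (Y + Y') Z x = apKoszul g J X Y Z x + apKoszul g J X Y' Z x := by
  unfold apKoszul
  rw [applyField_add, koszul_add_middle hg hX hY hY' hZ, koszul_add_middle hg hX
    (hg.isSmoothField_applyField hY) (hg.isSmoothField_applyField hY')
    (hg.isSmoothField_applyField hZ)]
  ring

theorem apKoszul_smul_middle (hh : ContMDiff I 𝓘(ℝ, ℝ) ∞ h) (hX : IsSmoothField X)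
    (hY : IsSmoothField Y) (hZ : IsSmoothField Z) (x : M) :
    apKoszul g J X (h • Y) Z x =
      h x * apKoszul g J X Y Z x + dirDeriv X h x * pairing g Y Z x := by
  unfold apKoszul
  rw [applyField_smul, koszul_smul_middle hg hh hX hY hZ, koszul_smul_middle hg hh hX
    (hg.isSmoothField_applyField hY) (hg.isSmoothField_applyField hZ), pairing_apply_apply hg]
  ring

theorem apKoszul_add_right (hX : IsSmoothField X) (hY : IsSmoothField Y) (hZ : IsSmoothField Z)
    (hZ' : IsSmoothField Z') (x : M) :
    apKoszul g J X Y (Z + Z') x = apKoszul g J X Y Z x + apKoszul g J X Y Z' x := by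
  unfold apKoszul
  rw [applyField_add, koszul_add_right hg hX hY hZ hZ', koszul_add_right hg hX
    (hg.isSmoothField_applyField hY) (hg.isSmoothField_applyField hZ)
    (hg.isSmoothField_applyField hZ')]
  ring

theorem apKoszul_smul_right (hh : ContMDiff I 𝓘(ℝ, ℝ) ∞ h) (hX : IsSmoothField X)
    (hY : IsSmoothField Y) (hZ : IsSmoothField Z) (x : M) :
    apKoszul g J X Y (h • Z) x = h x * apKoszul g J X Y Z x := by
  unfold apKoszul
  rw [applyField_smul, koszul_smul_right hg hh hX hY hZ, koszul_smul_right hg hh hX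
    (hg.isSmoothField_applyField hY) (hg.isSmoothField_applyField hZ)]
  ring

omit hg in
theorem apKoszul_congr {x : M} (hX : X =ᶠ[𝓝 x] X') (hY : Y =ᶠ[𝓝 x] Y') (hZ : Z =ᶠ[𝓝 x] Z') :
    apKoszul g J X Y Z x = apKoszul g J X' Y' Z' x := by
  have hJ : ∀ {A A' : (x : M) → TangentSpace I x}, A =ᶠ[𝓝 x] A' →
      applyField J A =ᶠ[𝓝 x] applyField J A' := by
    intro A A' h1
    filter_upwards [h1] with y hy
    exact congrArg (J y) hy
  unfold apKoszul
  rw [koszul_congr hX hY hZ, koszul_congr hX (hJ hY) (hJ hZ)]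

theorem apKoszul_add_apKoszul_swap (X Y Z : (x : M) → TangentSpace I x) (x : M) :
    apKoszul g J X Y Z x + apKoszul g J X Z Y x = dirDeriv X (pairing g Y Z) x := by
  have h1 := koszul_add_koszul_swap hg X Y Z x
  have h2 := koszul_add_koszul_swap hg X (applyField J Y) (applyField J Z) x
  rw [pairing_apply_apply hg] at h2
  unfold apKoszul
  linarith

end Koszul

section Signature

variable {E : Type*} [NormedAddCommGroup E] [NormedSpace ℝ E] [FiniteDimensional ℝ E]
  {H : Type*} [TopologicalSpace H] {I : ModelWithCorners ℝ E H}
  {M : Type*} [TopologicalSpace M] [ChartedSpace H M] [IsManifold I ∞ M] [T2Space M]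
  {g : (x : M) → TangentSpace I x →L[ℝ] TangentSpace I x →L[ℝ] ℝ}
  {J : (x : M) → TangentSpace I x →L[ℝ] TangentSpace I x}

theorem quadForm_apply (p : M) (v : TangentSpace I p) : quadForm g p v = g p v v := rfl

/-- The positive index of inertia of a continuous field of forms is lower semicontinuous. -/
theorem eventually_sigPos_le
    (hg : ∀ X Y : (x : M) → TangentSpace I x, IsSmoothField X → IsSmoothField Y →
      Continuous (pairing g X Y)) (p : M) :
    ∀ᶠ q in 𝓝 p, sigPos (quadForm g p) ≤ sigPos (quadForm g q) := by
  have fin : ∀ q : M, Module.Finite ℝ (TangentSpace I q) := fun q =>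
    inferInstanceAs (Module.Finite ℝ E)
  obtain ⟨V, hV, hpos⟩ := exists_finrank_eq_sigPos_and_posDef (quadForm g p)
  rw [← hV]
  set n := Module.finrank ℝ V
  let b : Module.Basis (Fin n) ℝ V := Module.finBasis ℝ V
  choose X hX hXp using fun i : Fin n => exists_isSmoothField_apply_eq p (b i : TangentSpace I p)
  let s : (q : M) → (Fin n → ℝ) → TangentSpace I q := fun q c => ∑ i, c i • X i q
  have hexp : ∀ q c, g q (s q c) (s q c) = ∑ i, ∑ j, c i * c j * pairing g (X i) (X j) q := by
    intro q c
    simp only [s, map_sum, sum_apply, map_smul, smul_apply,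
      smul_eq_mul, Finset.mul_sum, pairing]
    rw [Finset.sum_comm]
    refine Finset.sum_congr rfl fun i _ => Finset.sum_congr rfl fun j _ => ?_
    ring
  have hcont : Continuous fun z : M × (Fin n → ℝ) => g z.1 (s z.1 z.2) (s z.1 z.2) := by
    simp only [hexp]
    refine continuous_finsetSum _ fun i _ => continuous_finsetSum _ fun j _ => ?_
    have := hg (X i) (X j) (hX i) (hX j)
    fun_prop
  have hposp : ∀ c : Fin n → ℝ, c ≠ 0 → 0 < g p (s p c) (s p c) := by
    intro c hc
    have hsv : s p c = (∑ i, c i • b i : V) := by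
      simp [s, hXp]
    rw [hsv]
    refine hpos _ fun h0 => hc ?_
    funext i
    exact Fintype.linearIndependent_iff.1 b.linearIndependent c h0 i
  have hev : ∀ᶠ q in 𝓝 p, ∀ c ∈ Metric.sphere (0 : Fin n → ℝ) 1, 0 < g q (s q c) (s q c) := by
    refine (isCompact_sphere _ _).eventually_forall_of_forall_eventually fun c hc => ?_
    have hc0 : c ≠ 0 := by
      rintro rfl
      simp at hc
    exact hcont.continuousAt.eventually (lt_mem_nhds (hposp c hc0))
  filter_upwards [hev] with q hq
  have hposq : ∀ c : Fin n → ℝ, c ≠ 0 → 0 < g q (s q c) (s q c) := by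
    intro c hc
    have hn : 0 < ‖c‖ := norm_pos_iff.2 hc
    have h1 := hq (‖c‖⁻¹ • c) (by simp [norm_smul, hn.ne'])
    have h2 : s q (‖c‖⁻¹ • c) = ‖c‖⁻¹ • s q c := by
      simp [s, Finset.smul_sum, smul_smul]
    rw [h2] at h1
    simp only [map_smul, smul_apply, smul_eq_mul] at h1
    have h3 : 0 < ‖c‖⁻¹ := inv_pos.2 hn
    exact pos_of_mul_pos_right (pos_of_mul_pos_right h1 h3.le) h3.le
  have hli : LinearIndependent ℝ fun i => X i q := by
    rw [Fintype.linearIndependent_iff]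
    intro c hc
    by_contra! hne
    obtain ⟨i, hi⟩ := hne
    have := hposq c fun h0 => hi (by simp [h0])
    rw [show s q c = 0 from hc] at this
    simp at this
  have hdim : n = Module.finrank ℝ (Submodule.span ℝ (range fun i => X i q)) := by
    rw [finrank_span_eq_card hli, Fintype.card_fin]
  rw [hdim]
  refine le_sigPos_of_posDef _ ?_
  rintro ⟨v, hv⟩ hv0
  obtain ⟨c, rfl⟩ := (Submodule.mem_span_range_iff_exists_fun ℝ).1 hv
  refine hposq c ?_
  rintro rfl
  exact hv0 (by simp)

theorem eventually_sigNeg_le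
    (hg : ∀ X Y : (x : M) → TangentSpace I x, IsSmoothField X → IsSmoothField Y →
      Continuous (pairing g X Y)) (p : M) :
    ∀ᶠ q in 𝓝 p, sigNeg (quadForm g p) ≤ sigNeg (quadForm g q) := by
  have h1 := eventually_sigPos_le (g := fun x => -g x) (fun X Y hX hY => (hg X Y hX hY).neg) p
  have h2 : ∀ q, quadForm (fun x => -g x) q = -quadForm g q := fun q => by
    ext v
    simp [quadForm_apply]
  simpa only [h2, sigPos_neg] using h1

variable (hg : IsAlmostProduct g J)
include hg

theorem IsAlmostProduct.continuous_pairing (X Y : (x : M) → TangentSpace I x)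
    (hX : IsSmoothField X) (hY : IsSmoothField Y) : Continuous (pairing g X Y) :=
  (hg.contMDiff_pairing hX hY).continuous

theorem mem_radical_quadForm (p : M) (v : TangentSpace I p) :
    v ∈ (quadForm g p).radical ↔ ∀ w, g p v w = 0 := by
  have hpol : ∀ w, (quadForm g p).polarBilin v w = 2 * g p v w := by
    intro w
    rw [QuadraticMap.polarBilin_apply_apply, QuadraticMap.polar]
    simp only [quadForm_apply, map_add, add_apply]
    rw [hg.symm p w v]
    ring
  constructor
  · rintro ⟨-, h⟩ w
    have := hpol w
    rw [h] at this
    simpa using this.symm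
  · intro h
    refine ⟨h v, ?_⟩
    ext w
    rw [hpol, h w]
    simp

theorem sigPos_add_sigNeg_add_finrank_radical (p : M) :
    sigPos (quadForm g p) + sigNeg (quadForm g p) + Module.finrank ℝ (quadForm g p).radical =
      Module.finrank ℝ E := by
  have fin : Module.Finite ℝ (TangentSpace I p) := inferInstanceAs (Module.Finite ℝ E)
  exact QuadraticForm.sigPos_add_sigNeg_add_radical

theorem mem_regularSet_iff (p : M) :
    p ∈ regularSet g ↔ ∀ᶠ q in 𝓝 p,
      Module.finrank ℝ (quadForm g q).radical = Module.finrank ℝ (quadForm g p).radical := by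
  have h0 := sigPos_add_sigNeg_add_finrank_radical hg
  constructor
  · intro h
    filter_upwards [h] with q hq
    have := h0 p
    have := h0 q
    omega
  · intro h
    filter_upwards [h, eventually_sigPos_le hg.continuous_pairing p,
      eventually_sigNeg_le hg.continuous_pairing p] with q h1 h2 h3
    have := h0 p
    have := h0 q
    omega

/-- The points near which the signature is constant form a dense set. -/
theorem dense_regularSet : Dense (regularSet g) := by
  have h0 := sigPos_add_sigNeg_add_finrank_radical hg
  rw [dense_iff_inter_open]
  intro U hU hne
  obtain ⟨p, hpU, hp⟩ := WellFounded.has_min (measure fun q : M =>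
    Module.finrank ℝ (quadForm g q).radical).wf U hne
  refine ⟨p, hpU, (mem_regularSet_iff hg p).2 ?_⟩
  filter_upwards [hU.mem_nhds hpU, eventually_sigPos_le hg.continuous_pairing p,
      eventually_sigNeg_le hg.continuous_pairing p] with q h1 h2 h3
  have h4 : ¬ Module.finrank ℝ (quadForm g q).radical < Module.finrank ℝ (quadForm g p).radical :=
    hp q h1
  have := h0 p
  have := h0 q
  omega

theorem regularSet_eq_univ (hg' : IsNondegenerate g) : regularSet g = univ := by
  refine eq_univ_of_forall fun p => (mem_regularSet_iff hg p).2 (Eventually.of_forall fun q => ?_)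
  have : ∀ q, Module.finrank ℝ (quadForm g q).radical = 0 := fun q => by
    rw [(Submodule.eq_bot_iff _).2 fun v hv => hg' q v ((mem_radical_quadForm hg q v).1 hv)]
    exact finrank_bot _ _
  rw [this, this]

end Signature

section CovariantDerivative

variable {E : Type*} [NormedAddCommGroup E] [NormedSpace ℝ E] [FiniteDimensional ℝ E]
  {H : Type*} [TopologicalSpace H] {I : ModelWithCorners ℝ E H}
  {M : Type*} [TopologicalSpace M] [ChartedSpace H M] [IsManifold I ∞ M] [T2Space M]
  {X X' Y Y' Z Z' T T' : (x : M) → TangentSpace I x} {h k : M → ℝ}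
  {g : (x : M) → TangentSpace I x →L[ℝ] TangentSpace I x →L[ℝ] ℝ}
  {J : (x : M) → TangentSpace I x →L[ℝ] TangentSpace I x}
  {α τ : ((x : M) → TangentSpace I x) → M → ℝ} {p : M} {u v u' : TangentSpace I p}

theorem Represents.apply_eq (hu : Represents g α p u) (hu' : Represents g α p u')
    (w : TangentSpace I p) : g p u w = g p u' w := by
  obtain ⟨Z, hZ, rfl⟩ := exists_isSmoothField_apply_eq p w
  rw [← hu Z hZ, ← hu' Z hZ]

/-- The contraction can be computed from arbitrary representatives. -/
theorem contraction_eq (hg : IsAlmostProduct g J) (hu : Represents g α p u)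
    (hv : Represents g τ p v) : contraction g α τ p = g p u v := by
  have h : (∃ u : TangentSpace I p, Represents g α p u) ∧
      (∃ v : TangentSpace I p, Represents g τ p v) := ⟨⟨u, hu⟩, ⟨v, hv⟩⟩
  rw [contraction, dif_pos h, h.1.choose_spec.apply_eq hu, hg.symm p u, hg.symm p u,
    h.2.choose_spec.apply_eq hv]

/-- All forms `∇̃♭_X Y` have values in the image of `g`. -/
def IsRepresentable (g : (x : M) → TangentSpace I x →L[ℝ] TangentSpace I x →L[ℝ] ℝ)
    (J : (x : M) → TangentSpace I x →L[ℝ] TangentSpace I x) : Prop :=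
  ∀ X Y : (x : M) → TangentSpace I x, IsSmoothField X → IsSmoothField Y →
    ∀ p, ∃ u : TangentSpace I p, Represents g (lowerDeriv g J X Y) p u

/-- Near `p`, the function `c` agrees on the regular set of `g` with a smooth function. -/
def HasSmoothExtension (g : (x : M) → TangentSpace I x →L[ℝ] TangentSpace I x →L[ℝ] ℝ)
    (c : M → ℝ) (p : M) : Prop :=
  ∃ G : M → ℝ, ContMDiff I 𝓘(ℝ, ℝ) ∞ G ∧ ∀ᶠ q in 𝓝 p, q ∈ regularSet g → c q = G q

theorem HasSmoothExtension.of_eventually {c c' : M → ℝ} (hc : HasSmoothExtension g c p)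
    (h : ∀ᶠ q in 𝓝 p, c' q = c q) : HasSmoothExtension g c' p := by
  obtain ⟨G, hG, hGc⟩ := hc
  refine ⟨G, hG, ?_⟩
  filter_upwards [h, hGc] with q h1 h2 h3
  rw [h1, h2 h3]

theorem HasSmoothExtension.of_contMDiff {c : M → ℝ} (hc : ContMDiff I 𝓘(ℝ, ℝ) ∞ c) :
    HasSmoothExtension g c p :=
  ⟨c, hc, Eventually.of_forall fun _ _ => rfl⟩

theorem HasSmoothExtension.add {c c' : M → ℝ} (hc : HasSmoothExtension g c p)
    (hc' : HasSmoothExtension g c' p) : HasSmoothExtension g (c + c') p := by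
  obtain ⟨G, hG, hGc⟩ := hc
  obtain ⟨G', hG', hGc'⟩ := hc'
  refine ⟨G + G', hG.add hG', ?_⟩
  filter_upwards [hGc, hGc'] with q h1 h2 h3
  simp [h1 h3, h2 h3]

theorem HasSmoothExtension.sub {c c' : M → ℝ} (hc : HasSmoothExtension g c p)
    (hc' : HasSmoothExtension g c' p) : HasSmoothExtension g (c - c') p := by
  obtain ⟨G, hG, hGc⟩ := hc
  obtain ⟨G', hG', hGc'⟩ := hc'
  refine ⟨G - G', hG.sub hG', ?_⟩
  filter_upwards [hGc, hGc'] with q h1 h2 h3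
  simp [h1 h3, h2 h3]

theorem HasSmoothExtension.mul {c c' : M → ℝ} (hc : HasSmoothExtension g c p)
    (hc' : HasSmoothExtension g c' p) : HasSmoothExtension g (c * c') p := by
  obtain ⟨G, hG, hGc⟩ := hc
  obtain ⟨G', hG', hGc'⟩ := hc'
  refine ⟨G * G', hG.mul hG', ?_⟩
  filter_upwards [hGc, hGc'] with q h1 h2 h3
  simp [h1 h3, h2 h3]

/-- The contractions `⟨⟨∇̃♭_X T, ∇̃♭_Y Z⟩⟩` extend smoothly. -/
def HasSmoothContractions (g : (x : M) → TangentSpace I x →L[ℝ] TangentSpace I x →L[ℝ] ℝ)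
    (J : (x : M) → TangentSpace I x →L[ℝ] TangentSpace I x) : Prop :=
  ∀ X T Y Z : (x : M) → TangentSpace I x,
    IsSmoothField X → IsSmoothField T → IsSmoothField Y → IsSmoothField Z → ∀ p,
      HasSmoothExtension g (contraction g (lowerDeriv g J X T) (lowerDeriv g J Y Z)) p

theorem covDeriv_of_mem (hp : p ∈ regularSet g) :
    covDeriv g J X α T p = dirDeriv X (α T) p - contraction g (lowerDeriv g J X T) α p := by
  simp [covDeriv, hp]

open Classical in
theorem covDeriv_of_notMem (hp : p ∉ regularSet g) :
    covDeriv g J X α T p = extendFrom (regularSet g)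
      (fun p => dirDeriv X (α T) p - contraction g (lowerDeriv g J X T) α p) p := by
  unfold covDeriv
  exact piecewise_eq_of_notMem _ _ _ hp

section

variable (hg : IsAlmostProduct g J)
include hg

theorem contMDiff_lowerDeriv (hX : IsSmoothField X) (hY : IsSmoothField Y)
    (hZ : IsSmoothField Z) : ContMDiff I 𝓘(ℝ, ℝ) ∞ (lowerDeriv g J X Y Z) :=
  contMDiff_apKoszul hg hX hY hZ

theorem covDeriv_eq_of_eventually {G : M → ℝ} (hG : ContinuousAt G p)
    (h : ∀ᶠ q in 𝓝 p, q ∈ regularSet g →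
      dirDeriv X (α T) q - contraction g (lowerDeriv g J X T) α q = G q) :
    covDeriv g J X α T p = G p := by
  by_cases hp : p ∈ regularSet g
  · rw [covDeriv_of_mem hp, h.self_of_nhds hp]
  · rw [covDeriv_of_notMem hp]
    refine extendFrom_eq (dense_regularSet hg p) ?_
    refine (hG.tendsto.mono_left nhdsWithin_le_nhds).congr' ?_
    filter_upwards [mem_nhdsWithin_of_mem_nhds h, self_mem_nhdsWithin] with q h1 h2
    exact (h1 h2).symm

theorem contMDiff_covDeriv_of_hasSmoothExtension (hX : IsSmoothField X)
    (hα : ContMDiff I 𝓘(ℝ, ℝ) ∞ (α T))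
    (hc : ∀ p, HasSmoothExtension g (contraction g (lowerDeriv g J X T) α) p) :
    ContMDiff I 𝓘(ℝ, ℝ) ∞ (covDeriv g J X α T) := by
  intro p
  obtain ⟨G, hG, hGc⟩ :=
    (HasSmoothExtension.of_contMDiff (g := g) (p := p) (hX.contMDiff_dirDeriv hα)).sub (hc p)
  refine hG.contMDiffAt.congr_of_eventuallyEq ?_
  filter_upwards [hGc.eventually_nhds] with q hq
  exact covDeriv_eq_of_eventually hg hG.continuous.continuousAt hq

/-- If the contraction agrees on the regular set with a continuous function, so does the
covariant derivative, everywhere. -/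
theorem covDeriv_eq_sub (hX : IsSmoothField X) (hα : ContMDiff I 𝓘(ℝ, ℝ) ∞ (α T)) {G : M → ℝ}
    (hG : Continuous G)
    (hc : ∀ q ∈ regularSet g, contraction g (lowerDeriv g J X T) α q = G q) (p : M) :
    covDeriv g J X α T p = dirDeriv X (α T) p - G p := by
  refine covDeriv_eq_of_eventually hg (G := fun p => dirDeriv X (α T) p - G p) ?_ ?_
  · exact ((hX.contMDiff_dirDeriv hα).continuous.sub hG).continuousAt
  · exact Eventually.of_forall fun q hq => by rw [hc q hq]

theorem contraction_comm (α τ : ((x : M) → TangentSpace I x) → M → ℝ) (p : M) :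
    contraction g α τ p = contraction g τ α p := by
  by_cases hα : ∃ u : TangentSpace I p, Represents g α p u
  · by_cases hτ : ∃ v : TangentSpace I p, Represents g τ p v
    · obtain ⟨u, hu⟩ := hα
      obtain ⟨v, hv⟩ := hτ
      rw [contraction_eq hg hu hv, contraction_eq hg hv hu, hg.symm]
    · rw [contraction, contraction, dif_neg (by tauto), dif_neg (by tauto)]
  · rw [contraction, contraction, dif_neg (by tauto), dif_neg (by tauto)]

theorem Represents.lowerDeriv_add_left (hX : IsSmoothField X) (hX' : IsSmoothField X')
    (hY : IsSmoothField Y) (hu : Represents g (lowerDeriv g J X Y) p u)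
    (hu' : Represents g (lowerDeriv g J X' Y) p u') :
    Represents g (lowerDeriv g J (X + X') Y) p (u + u') := fun Z hZ => by
  rw [map_add, add_apply, ← hu Z hZ, ← hu' Z hZ]
  exact apKoszul_add_left hg hX hX' hY hZ p

theorem Represents.lowerDeriv_smul_left (hh : ContMDiff I 𝓘(ℝ, ℝ) ∞ h) (hX : IsSmoothField X)
    (hY : IsSmoothField Y) (hu : Represents g (lowerDeriv g J X Y) p u) :
    Represents g (lowerDeriv g J (h • X) Y) p (h p • u) := fun Z hZ => by
  rw [map_smul, smul_apply, ← hu Z hZ]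
  exact apKoszul_smul_left hg hh hX hY hZ p

theorem Represents.lowerDeriv_add_right (hX : IsSmoothField X) (hY : IsSmoothField Y)
    (hY' : IsSmoothField Y') (hu : Represents g (lowerDeriv g J X Y) p u)
    (hu' : Represents g (lowerDeriv g J X Y') p u') :
    Represents g (lowerDeriv g J X (Y + Y')) p (u + u') := fun Z hZ => by
  rw [map_add, add_apply, ← hu Z hZ, ← hu' Z hZ]
  exact apKoszul_add_middle hg hX hY hY' hZ p

theorem Represents.lowerDeriv_smul_right (hh : ContMDiff I 𝓘(ℝ, ℝ) ∞ h) (hX : IsSmoothField X)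
    (hY : IsSmoothField Y) (hu : Represents g (lowerDeriv g J X Y) p u) :
    Represents g (lowerDeriv g J X (h • Y)) p (h p • u + dirDeriv X h p • Y p) := fun Z hZ => by
  rw [map_add, add_apply, map_smul, smul_apply, map_smul, smul_apply, ← hu Z hZ]
  exact apKoszul_smul_middle hg hh hX hY hZ p

omit hg in
theorem Represents.lowerDeriv_congr (hX : X =ᶠ[𝓝 p] X') (hY : Y =ᶠ[𝓝 p] Y')
    (hu : Represents g (lowerDeriv g J X Y) p u) :
    Represents g (lowerDeriv g J X' Y') p u := fun Z hZ => by
  rw [← hu Z hZ]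
  exact apKoszul_congr hX.symm hY.symm (.refl _ _)

theorem contraction_congr (hX : X =ᶠ[𝓝 p] X') (hT : T =ᶠ[𝓝 p] T') :
    contraction g (lowerDeriv g J X T) α p = contraction g (lowerDeriv g J X' T') α p := by
  have key : ∀ u, Represents g (lowerDeriv g J X T) p u ↔
      Represents g (lowerDeriv g J X' T') p u :=
    fun u => ⟨fun hu => hu.lowerDeriv_congr hX hT, fun hu => hu.lowerDeriv_congr hX.symm hT.symm⟩
  by_cases h : (∃ u, Represents g (lowerDeriv g J X T) p u) ∧ ∃ v, Represents g α p v
  · obtain ⟨⟨u, hu⟩, v, hv⟩ := h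
    rw [contraction_eq hg hu hv, contraction_eq hg ((key u).1 hu) hv]
  · have h' := h
    simp only [key] at h'
    rw [contraction, contraction, dif_neg h, dif_neg h']

variable (hr : IsRepresentable g J)
include hr

theorem contraction_add_left (hX : IsSmoothField X) (hX' : IsSmoothField X')
    (hT : IsSmoothField T) (hα : ∃ v, Represents g α p v) :
    contraction g (lowerDeriv g J (X + X') T) α p =
      contraction g (lowerDeriv g J X T) α p + contraction g (lowerDeriv g J X' T) α p := by
  obtain ⟨v, hv⟩ := hα
  obtain ⟨u, hu⟩ := hr X T hX hT p
  obtain ⟨u', hu'⟩ := hr X' T hX' hT p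
  rw [contraction_eq hg (hu.lowerDeriv_add_left hg hX hX' hT hu') hv, contraction_eq hg hu hv,
    contraction_eq hg hu' hv, map_add, add_apply]

theorem contraction_smul_left (hh : ContMDiff I 𝓘(ℝ, ℝ) ∞ h) (hX : IsSmoothField X)
    (hT : IsSmoothField T) (hα : ∃ v, Represents g α p v) :
    contraction g (lowerDeriv g J (h • X) T) α p =
      h p * contraction g (lowerDeriv g J X T) α p := by
  obtain ⟨v, hv⟩ := hα
  obtain ⟨u, hu⟩ := hr X T hX hT p
  rw [contraction_eq hg (hu.lowerDeriv_smul_left hg hh hX hT) hv, contraction_eq hg hu hv,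
    map_smul, smul_apply, smul_eq_mul]

theorem contraction_add_right (hX : IsSmoothField X) (hT : IsSmoothField T)
    (hT' : IsSmoothField T') (hα : ∃ v, Represents g α p v) :
    contraction g (lowerDeriv g J X (T + T')) α p =
      contraction g (lowerDeriv g J X T) α p + contraction g (lowerDeriv g J X T') α p := by
  obtain ⟨v, hv⟩ := hα
  obtain ⟨u, hu⟩ := hr X T hX hT p
  obtain ⟨u', hu'⟩ := hr X T' hX hT' p
  rw [contraction_eq hg (hu.lowerDeriv_add_right hg hX hT hT' hu') hv, contraction_eq hg hu hv,
    contraction_eq hg hu' hv, map_add, add_apply]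

theorem contraction_smul_right (hh : ContMDiff I 𝓘(ℝ, ℝ) ∞ h) (hX : IsSmoothField X)
    (hT : IsSmoothField T) (hα : ∃ v, Represents g α p v) :
    contraction g (lowerDeriv g J X (h • T)) α p =
      h p * contraction g (lowerDeriv g J X T) α p + dirDeriv X h p * α T p := by
  obtain ⟨v, hv⟩ := hα
  obtain ⟨u, hu⟩ := hr X T hX hT p
  rw [contraction_eq hg (hu.lowerDeriv_smul_right hg hh hX hT) hv, contraction_eq hg hu hv,
    map_add, add_apply, map_smul, smul_apply, map_smul, smul_apply, hv T hT, hg.symm p (T p)]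
  rfl

variable (hs : HasSmoothContractions g J)
include hs

theorem contMDiff_covDeriv (hX : IsSmoothField X) (hY : IsSmoothField Y) (hZ : IsSmoothField Z)
    (hT : IsSmoothField T) :
    ContMDiff I 𝓘(ℝ, ℝ) ∞ (covDeriv g J X (lowerDeriv g J Y Z) T) :=
  contMDiff_covDeriv_of_hasSmoothExtension hg hX (contMDiff_lowerDeriv hg hY hZ hT)
    (hs X T Y Z hX hT hY hZ)

theorem covDeriv_add_left (hX : IsSmoothField X) (hX' : IsSmoothField X') (hY : IsSmoothField Y)
    (hZ : IsSmoothField Z) (hT : IsSmoothField T) :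
    covDeriv g J (X + X') (lowerDeriv g J Y Z) T =
      covDeriv g J X (lowerDeriv g J Y Z) T + covDeriv g J X' (lowerDeriv g J Y Z) T := by
  refine Continuous.ext_on (dense_regularSet hg)
    (contMDiff_covDeriv hg hr hs (hX.add hX') hY hZ hT).continuous
    ((contMDiff_covDeriv hg hr hs hX hY hZ hT).add
      (contMDiff_covDeriv hg hr hs hX' hY hZ hT)).continuous fun q hq => ?_
  rw [Pi.add_apply, covDeriv_of_mem hq, covDeriv_of_mem hq, covDeriv_of_mem hq,
    contraction_add_left hg hr hX hX' hT (hr Y Z hY hZ q), dirDeriv_add_field]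
  ring

theorem covDeriv_smul_left (hh : ContMDiff I 𝓘(ℝ, ℝ) ∞ h) (hX : IsSmoothField X)
    (hY : IsSmoothField Y) (hZ : IsSmoothField Z) (hT : IsSmoothField T) :
    covDeriv g J (h • X) (lowerDeriv g J Y Z) T =
      h * covDeriv g J X (lowerDeriv g J Y Z) T := by
  refine Continuous.ext_on (dense_regularSet hg)
    (contMDiff_covDeriv hg hr hs (.smul hh hX) hY hZ hT).continuous
    (hh.mul (contMDiff_covDeriv hg hr hs hX hY hZ hT)).continuous fun q hq => ?_
  rw [Pi.mul_apply, covDeriv_of_mem hq, covDeriv_of_mem hq,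
    contraction_smul_left hg hr hh hX hT (hr Y Z hY hZ q), dirDeriv_smul_field]
  ring

theorem covDeriv_add_right (hX : IsSmoothField X) (hY : IsSmoothField Y)
    (hZ : IsSmoothField Z) (hT : IsSmoothField T) (hT' : IsSmoothField T') :
    covDeriv g J X (lowerDeriv g J Y Z) (T + T') =
      covDeriv g J X (lowerDeriv g J Y Z) T + covDeriv g J X (lowerDeriv g J Y Z) T' := by
  refine Continuous.ext_on (dense_regularSet hg)
    (contMDiff_covDeriv hg hr hs hX hY hZ (hT.add hT')).continuous
    ((contMDiff_covDeriv hg hr hs hX hY hZ hT).add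
      (contMDiff_covDeriv hg hr hs hX hY hZ hT')).continuous fun q hq => ?_
  have h1 : lowerDeriv g J Y Z (T + T') = lowerDeriv g J Y Z T + lowerDeriv g J Y Z T' :=
    funext fun x => apKoszul_add_right hg hY hZ hT hT' x
  rw [Pi.add_apply, covDeriv_of_mem hq, covDeriv_of_mem hq, covDeriv_of_mem hq,
    contraction_add_right hg hr hX hT hT' (hr Y Z hY hZ q), h1,
    dirDeriv_add (contMDiff_lowerDeriv hg hY hZ hT) (contMDiff_lowerDeriv hg hY hZ hT')]
  ring

theorem covDeriv_smul_right (hh : ContMDiff I 𝓘(ℝ, ℝ) ∞ h) (hX : IsSmoothField X)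
    (hY : IsSmoothField Y) (hZ : IsSmoothField Z) (hT : IsSmoothField T) :
    covDeriv g J X (lowerDeriv g J Y Z) (h • T) =
      h * covDeriv g J X (lowerDeriv g J Y Z) T := by
  refine Continuous.ext_on (dense_regularSet hg)
    (contMDiff_covDeriv hg hr hs hX hY hZ (.smul hh hT)).continuous
    (hh.mul (contMDiff_covDeriv hg hr hs hX hY hZ hT)).continuous fun q hq => ?_
  have h1 : lowerDeriv g J Y Z (h • T) = h * lowerDeriv g J Y Z T :=
    funext fun x => apKoszul_smul_right hg hh hY hZ hT x
  rw [Pi.mul_apply, covDeriv_of_mem hq, covDeriv_of_mem hq,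
    contraction_smul_right hg hr hh hX hT (hr Y Z hY hZ q), h1,
    dirDeriv_mul hh (contMDiff_lowerDeriv hg hY hZ hT)]
  ring

theorem covDeriv_lowerDeriv_add_left (hX : IsSmoothField X) (hY : IsSmoothField Y)
    (hY' : IsSmoothField Y') (hZ : IsSmoothField Z) (hT : IsSmoothField T) :
    covDeriv g J X (lowerDeriv g J (Y + Y') Z) T =
      covDeriv g J X (lowerDeriv g J Y Z) T + covDeriv g J X (lowerDeriv g J Y' Z) T := by
  refine Continuous.ext_on (dense_regularSet hg)
    (contMDiff_covDeriv hg hr hs hX (hY.add hY') hZ hT).continuous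
    ((contMDiff_covDeriv hg hr hs hX hY hZ hT).add
      (contMDiff_covDeriv hg hr hs hX hY' hZ hT)).continuous fun q hq => ?_
  have h1 : lowerDeriv g J (Y + Y') Z T = lowerDeriv g J Y Z T + lowerDeriv g J Y' Z T :=
    funext fun x => apKoszul_add_left hg hY hY' hZ hT x
  have h2 := contraction_add_left hg hr hY hY' hZ (hr X T hX hT q)
  rw [Pi.add_apply, covDeriv_of_mem hq, covDeriv_of_mem hq, covDeriv_of_mem hq,
    contraction_comm hg, h2, h1, contraction_comm hg _ (lowerDeriv g J X T),
    contraction_comm hg _ (lowerDeriv g J X T),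
    dirDeriv_add (contMDiff_lowerDeriv hg hY hZ hT) (contMDiff_lowerDeriv hg hY' hZ hT)]
  ring

theorem covDeriv_lowerDeriv_smul_left (hh : ContMDiff I 𝓘(ℝ, ℝ) ∞ h) (hX : IsSmoothField X)
    (hY : IsSmoothField Y) (hZ : IsSmoothField Z) (hT : IsSmoothField T) :
    covDeriv g J X (lowerDeriv g J (h • Y) Z) T =
      h * covDeriv g J X (lowerDeriv g J Y Z) T + dirDeriv X h * lowerDeriv g J Y Z T := by
  have h0 : ContMDiff I 𝓘(ℝ, ℝ) ∞ (lowerDeriv g J Y Z T) := contMDiff_lowerDeriv hg hY hZ hT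
  refine Continuous.ext_on (dense_regularSet hg)
    (contMDiff_covDeriv hg hr hs hX (.smul hh hY) hZ hT).continuous
    ((hh.mul (contMDiff_covDeriv hg hr hs hX hY hZ hT)).add
      ((hX.contMDiff_dirDeriv hh).mul h0)).continuous fun q hq => ?_
  have h1 : lowerDeriv g J (h • Y) Z T = h * lowerDeriv g J Y Z T :=
    funext fun x => apKoszul_smul_left hg hh hY hZ hT x
  have h2 := contraction_smul_left hg hr hh hY hZ (hr X T hX hT q)
  rw [Pi.add_apply, Pi.mul_apply, Pi.mul_apply, covDeriv_of_mem hq, covDeriv_of_mem hq,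
    contraction_comm hg, h2, h1, contraction_comm hg _ (lowerDeriv g J X T), dirDeriv_mul hh h0]
  ring

theorem covDeriv_lowerDeriv_add_right (hX : IsSmoothField X) (hY : IsSmoothField Y)
    (hZ : IsSmoothField Z) (hZ' : IsSmoothField Z') (hT : IsSmoothField T) :
    covDeriv g J X (lowerDeriv g J Y (Z + Z')) T =
      covDeriv g J X (lowerDeriv g J Y Z) T + covDeriv g J X (lowerDeriv g J Y Z') T := by
  refine Continuous.ext_on (dense_regularSet hg)
    (contMDiff_covDeriv hg hr hs hX hY (hZ.add hZ') hT).continuous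
    ((contMDiff_covDeriv hg hr hs hX hY hZ hT).add
      (contMDiff_covDeriv hg hr hs hX hY hZ' hT)).continuous fun q hq => ?_
  have h1 : lowerDeriv g J Y (Z + Z') T = lowerDeriv g J Y Z T + lowerDeriv g J Y Z' T :=
    funext fun x => apKoszul_add_middle hg hY hZ hZ' hT x
  have h2 := contraction_add_right hg hr hY hZ hZ' (hr X T hX hT q)
  rw [Pi.add_apply, covDeriv_of_mem hq, covDeriv_of_mem hq, covDeriv_of_mem hq,
    contraction_comm hg, h2, h1, contraction_comm hg _ (lowerDeriv g J X T),
    contraction_comm hg _ (lowerDeriv g J X T),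
    dirDeriv_add (contMDiff_lowerDeriv hg hY hZ hT) (contMDiff_lowerDeriv hg hY hZ' hT)]
  ring

theorem covDeriv_lowerDeriv_smul_right (hh : ContMDiff I 𝓘(ℝ, ℝ) ∞ h) (hX : IsSmoothField X)
    (hY : IsSmoothField Y) (hZ : IsSmoothField Z) (hT : IsSmoothField T) :
    covDeriv g J X (lowerDeriv g J Y (h • Z)) T =
      h * covDeriv g J X (lowerDeriv g J Y Z) T + dirDeriv X h * lowerDeriv g J Y Z T
        + dirDeriv X (dirDeriv Y h) * pairing g Z T + dirDeriv Y h * lowerDeriv g J X Z T := by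
  have h0 : ContMDiff I 𝓘(ℝ, ℝ) ∞ (lowerDeriv g J Y Z T) := contMDiff_lowerDeriv hg hY hZ hT
  have h0' : ContMDiff I 𝓘(ℝ, ℝ) ∞ (lowerDeriv g J X Z T) := contMDiff_lowerDeriv hg hX hZ hT
  have hYh := hY.contMDiff_dirDeriv hh
  have hZT := hg.contMDiff_pairing hZ hT
  refine Continuous.ext_on (dense_regularSet hg)
    (contMDiff_covDeriv hg hr hs hX hY (.smul hh hZ) hT).continuous
    ((((hh.mul (contMDiff_covDeriv hg hr hs hX hY hZ hT)).add
      ((hX.contMDiff_dirDeriv hh).mul h0)).add ((hX.contMDiff_dirDeriv hYh).mul hZT)).add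
        (hYh.mul h0')).continuous fun q hq => ?_
  have h1 : lowerDeriv g J Y (h • Z) T = h * lowerDeriv g J Y Z T + dirDeriv Y h * pairing g Z T :=
    funext fun x => apKoszul_smul_middle hg hh hY hZ hT x
  have h2 := contraction_smul_right hg hr hh hY hZ (hr X T hX hT q)
  have h3 : lowerDeriv g J X Z T q + lowerDeriv g J X T Z q = dirDeriv X (pairing g Z T) q :=
    apKoszul_add_apKoszul_swap hg X Z T q
  simp only [Pi.add_apply, Pi.mul_apply]
  rw [covDeriv_of_mem hq, covDeriv_of_mem hq, contraction_comm hg, h2, h1,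
    contraction_comm hg _ (lowerDeriv g J X T), dirDeriv_add (hh.mul h0) (hYh.mul hZT),
    dirDeriv_mul hh h0, dirDeriv_mul hYh hZT]
  linear_combination -dirDeriv Y h q * h3

theorem covDeriv_congr (hX' : IsSmoothField X') (hY' : IsSmoothField Y')
    (hZ' : IsSmoothField Z') (hT' : IsSmoothField T') (hXX : X =ᶠ[𝓝 p] X') (hYY : Y =ᶠ[𝓝 p] Y')
    (hZZ : Z =ᶠ[𝓝 p] Z') (hTT : T =ᶠ[𝓝 p] T') :
    covDeriv g J X (lowerDeriv g J Y Z) T p = covDeriv g J X' (lowerDeriv g J Y' Z') T' p := by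
  refine covDeriv_eq_of_eventually hg
    (contMDiff_covDeriv hg hr hs hX' hY' hZ' hT').continuous.continuousAt ?_
  filter_upwards [hXX.eventually_nhds, hYY.eventually_nhds, hZZ.eventually_nhds,
    hTT.eventually_nhds] with q h1 h2 h3 h4 hq
  have h5 : lowerDeriv g J Y Z T =ᶠ[𝓝 q] lowerDeriv g J Y' Z' T' := by
    filter_upwards [h2.eventually_nhds, h3.eventually_nhds, h4.eventually_nhds] with r g1 g2 g3
    exact apKoszul_congr g1 g2 g3
  rw [covDeriv_of_mem hq, dirDeriv_congr h1.self_of_nhds h5, contraction_congr hg h1 h4,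
    contraction_comm hg, contraction_congr hg h2 h3, contraction_comm hg]

end

end CovariantDerivative

section Lifts

variable {E : Type*} [NormedAddCommGroup E] [NormedSpace ℝ E] [FiniteDimensional ℝ E]
  {H : Type*} [TopologicalSpace H] {I : ModelWithCorners ℝ E H}
  {B : Type*} [TopologicalSpace B] [ChartedSpace H B] [IsManifold I ∞ B] [T2Space B]
  {E' : Type*} [NormedAddCommGroup E'] [NormedSpace ℝ E'] [FiniteDimensional ℝ E']
  {H' : Type*} [TopologicalSpace H'] {I' : ModelWithCorners ℝ E' H'}
  {F : Type*} [TopologicalSpace F] [ChartedSpace H' F] [IsManifold I' ∞ F] [T2Space F]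
  {X Y Z : (x : B) → TangentSpace I x} {U V W : (y : F) → TangentSpace I' y}
  {gB : (x : B) → TangentSpace I x →L[ℝ] TangentSpace I x →L[ℝ] ℝ}
  {J₁ : (x : B) → TangentSpace I x →L[ℝ] TangentSpace I x}
  {gF : (y : F) → TangentSpace I' y →L[ℝ] TangentSpace I' y →L[ℝ] ℝ}
  {J₂ : (y : F) → TangentSpace I' y →L[ℝ] TangentSpace I' y}
  {f : B → ℝ}

theorem _root_.ContMDiff.comp_fst {k : B → ℝ} (hk : ContMDiff I 𝓘(ℝ, ℝ) ∞ k) :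
    ContMDiff (I.prod I') 𝓘(ℝ, ℝ) ∞ (k ∘ Prod.fst : B × F → ℝ) :=
  hk.comp contMDiff_fst

theorem _root_.ContMDiff.comp_snd {k : F → ℝ} (hk : ContMDiff I' 𝓘(ℝ, ℝ) ∞ k) :
    ContMDiff (I.prod I') 𝓘(ℝ, ℝ) ∞ (k ∘ Prod.snd : B × F → ℝ) :=
  hk.comp contMDiff_snd

theorem mvfderiv_comp_fst {k : B → ℝ} (hk : ContMDiff I 𝓘(ℝ, ℝ) ∞ k) (p : B × F)
    (v : TangentSpace (I.prod I') p) :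
    mvfderiv (I.prod I') (k ∘ Prod.fst) p v = mvfderiv I k p.1 v.1 := by
  have h := mvfderiv_comp_apply (f := (Prod.fst : B × F → B)) p (hk.mdiffAt p.1)
    (mdifferentiableAt_fst (I := I) (I' := I')) v
  rw [mfderiv_fst] at h
  exact h

theorem mvfderiv_comp_snd {k : F → ℝ} (hk : ContMDiff I' 𝓘(ℝ, ℝ) ∞ k) (p : B × F)
    (v : TangentSpace (I.prod I') p) :
    mvfderiv (I.prod I') (k ∘ Prod.snd) p v = mvfderiv I' k p.2 v.2 := by
  have h := mvfderiv_comp_apply (f := (Prod.snd : B × F → F)) p (hk.mdiffAt p.2)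
    (mdifferentiableAt_snd (I := I) (I' := I')) v
  rw [mfderiv_snd] at h
  exact h

theorem dirDeriv_liftBase_comp_fst {k : B → ℝ} (hk : ContMDiff I 𝓘(ℝ, ℝ) ∞ k) :
    dirDeriv (liftBase I' F X) (k ∘ Prod.fst) = dirDeriv X k ∘ Prod.fst :=
  funext fun p => mvfderiv_comp_fst hk p _

theorem dirDeriv_liftBase_comp_snd {k : F → ℝ} (hk : ContMDiff I' 𝓘(ℝ, ℝ) ∞ k) :
    dirDeriv (liftBase I' F X) (k ∘ Prod.snd) = 0 :=
  funext fun p => (mvfderiv_comp_snd hk p _).trans (map_zero _)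

theorem dirDeriv_liftFiber_comp_fst {k : B → ℝ} (hk : ContMDiff I 𝓘(ℝ, ℝ) ∞ k) :
    dirDeriv (liftFiber I B V) (k ∘ Prod.fst) = 0 :=
  funext fun p => (mvfderiv_comp_fst hk p _).trans (map_zero _)

theorem dirDeriv_liftFiber_comp_snd {k : F → ℝ} (hk : ContMDiff I' 𝓘(ℝ, ℝ) ∞ k) :
    dirDeriv (liftFiber I B V) (k ∘ Prod.snd) = dirDeriv V k ∘ Prod.snd :=
  funext fun p => mvfderiv_comp_snd hk p _

theorem prod_tangent_ext {p : B × F} {v w : TangentSpace (I.prod I') p}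
    (h1 : ∀ k : B → ℝ, ContMDiff I 𝓘(ℝ, ℝ) ∞ k →
      mvfderiv (I.prod I') (k ∘ Prod.fst) p v = mvfderiv (I.prod I') (k ∘ Prod.fst) p w)
    (h2 : ∀ k : F → ℝ, ContMDiff I' 𝓘(ℝ, ℝ) ∞ k →
      mvfderiv (I.prod I') (k ∘ Prod.snd) p v = mvfderiv (I.prod I') (k ∘ Prod.snd) p w) :
    v = w := by
  have e1 : (v.1 : TangentSpace I p.1) = w.1 := eq_of_forall_mvfderiv_eq fun k hk => by
    rw [← mvfderiv_comp_fst hk p v, ← mvfderiv_comp_fst hk p w, h1 k hk]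
  have e2 : (v.2 : TangentSpace I' p.2) = w.2 := eq_of_forall_mvfderiv_eq fun k hk => by
    rw [← mvfderiv_comp_snd hk p v, ← mvfderiv_comp_snd hk p w, h2 k hk]
  exact Prod.ext e1 e2

theorem field_ext {A A' : (p : B × F) → TangentSpace (I.prod I') p}
    (h1 : ∀ k : B → ℝ, ContMDiff I 𝓘(ℝ, ℝ) ∞ k →
      ∀ p, dirDeriv A (k ∘ Prod.fst) p = dirDeriv A' (k ∘ Prod.fst) p)
    (h2 : ∀ k : F → ℝ, ContMDiff I' 𝓘(ℝ, ℝ) ∞ k →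
      ∀ p, dirDeriv A (k ∘ Prod.snd) p = dirDeriv A' (k ∘ Prod.snd) p) : A = A' :=
  funext fun p => prod_tangent_ext (fun k hk => h1 k hk p) fun k hk => h2 k hk p

section Bracket

variable [I.Boundaryless] [I'.Boundaryless]

theorem mlieBracket_liftBase_liftBase (hX : IsSmoothField X) (hY : IsSmoothField Y) :
    VectorField.mlieBracket (I.prod I') (liftBase I' F X) (liftBase I' F Y) =
      liftBase I' F (VectorField.mlieBracket I X Y) := by
  refine field_ext (fun k hk p => ?_) fun k hk p => ?_
  · rw [dirDeriv_mlieBracket hX.liftBase hY.liftBase hk.comp_fst,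
      dirDeriv_liftBase_comp_fst hk, dirDeriv_liftBase_comp_fst hk, dirDeriv_liftBase_comp_fst hk,
      dirDeriv_liftBase_comp_fst (hX.contMDiff_dirDeriv hk),
      dirDeriv_liftBase_comp_fst (hY.contMDiff_dirDeriv hk)]
    exact (dirDeriv_mlieBracket hX hY hk p.1).symm
  · rw [dirDeriv_mlieBracket hX.liftBase hY.liftBase hk.comp_snd,
      dirDeriv_liftBase_comp_snd hk, dirDeriv_liftBase_comp_snd hk, dirDeriv_liftBase_comp_snd hk,
      dirDeriv_zero, dirDeriv_zero]
    simp

theorem mlieBracket_liftFiber_liftFiber (hV : IsSmoothField V) (hW : IsSmoothField W) :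
    VectorField.mlieBracket (I.prod I') (liftFiber I B V) (liftFiber I B W) =
      liftFiber I B (VectorField.mlieBracket I' V W) := by
  refine field_ext (fun k hk p => ?_) fun k hk p => ?_
  · rw [dirDeriv_mlieBracket hV.liftFiber hW.liftFiber hk.comp_fst,
      dirDeriv_liftFiber_comp_fst hk, dirDeriv_liftFiber_comp_fst hk,
      dirDeriv_liftFiber_comp_fst hk, dirDeriv_zero, dirDeriv_zero]
    simp
  · rw [dirDeriv_mlieBracket hV.liftFiber hW.liftFiber hk.comp_snd,
      dirDeriv_liftFiber_comp_snd hk, dirDeriv_liftFiber_comp_snd hk,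
      dirDeriv_liftFiber_comp_snd hk,
      dirDeriv_liftFiber_comp_snd (hV.contMDiff_dirDeriv hk),
      dirDeriv_liftFiber_comp_snd (hW.contMDiff_dirDeriv hk)]
    exact (dirDeriv_mlieBracket hV hW hk p.2).symm

theorem mlieBracket_liftBase_liftFiber (hX : IsSmoothField X) (hV : IsSmoothField V) :
    VectorField.mlieBracket (I.prod I') (liftBase I' F X) (liftFiber I B V) = 0 := by
  refine field_ext (fun k hk p => ?_) fun k hk p => ?_
  · rw [dirDeriv_mlieBracket hX.liftBase hV.liftFiber hk.comp_fst,
      dirDeriv_liftFiber_comp_fst hk, dirDeriv_liftBase_comp_fst hk,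
      dirDeriv_liftFiber_comp_fst (hX.contMDiff_dirDeriv hk), dirDeriv_zero]
    simp [dirDeriv]
  · rw [dirDeriv_mlieBracket hX.liftBase hV.liftFiber hk.comp_snd,
      dirDeriv_liftFiber_comp_snd hk, dirDeriv_liftBase_comp_snd hk,
      dirDeriv_liftBase_comp_snd (hV.contMDiff_dirDeriv hk), dirDeriv_zero]
    simp [dirDeriv]

theorem mlieBracket_liftFiber_liftBase (hX : IsSmoothField X) (hV : IsSmoothField V) :
    VectorField.mlieBracket (I.prod I') (liftFiber I B V) (liftBase I' F X) = 0 := by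
  rw [VectorField.mlieBracket_swap, mlieBracket_liftBase_liftFiber hX hV, neg_zero]

end Bracket

theorem warpedMetric_apply (p : B × F) (v w : TangentSpace (I.prod I') p) :
    warpedMetric gB gF f p v w =
      gB p.1 v.1 w.1 + f p.1 ^ 2 * gF p.2 v.2 w.2 := by
  unfold warpedMetric
  rw [mfderiv_fst, mfderiv_snd]
  rfl

theorem applyField_liftBase :
    applyField (productStructure J₁ J₂) (liftBase I' F X) = liftBase I' F (applyField J₁ X) :=
  funext fun p => Prod.ext rfl (map_zero (J₂ p.2))

theorem applyField_liftFiber :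
    applyField (productStructure J₁ J₂) (liftFiber I B V) = liftFiber I B (applyField J₂ V) :=
  funext fun p => Prod.ext (map_zero (J₁ p.1)) rfl

theorem pairing_liftBase_liftBase :
    pairing (warpedMetric gB gF f) (liftBase I' F X) (liftBase I' F Y) =
      pairing gB X Y ∘ Prod.fst := by
  funext p
  rw [pairing, warpedMetric_apply]
  change gB p.1 (X p.1) (Y p.1) + f p.1 ^ 2 * gF p.2 0 0 = _
  simp [pairing]

theorem pairing_liftBase_liftFiber :
    pairing (warpedMetric gB gF f) (liftBase I' F X) (liftFiber I B V) = 0 := by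
  funext p
  rw [pairing, warpedMetric_apply]
  change gB p.1 (X p.1) 0 + f p.1 ^ 2 * gF p.2 0 (V p.2) = _
  simp

theorem pairing_liftFiber_liftBase :
    pairing (warpedMetric gB gF f) (liftFiber I B V) (liftBase I' F X) = 0 := by
  funext p
  rw [pairing, warpedMetric_apply]
  change gB p.1 0 (X p.1) + f p.1 ^ 2 * gF p.2 (V p.2) 0 = _
  simp

theorem pairing_liftFiber_liftFiber :
    pairing (warpedMetric gB gF f) (liftFiber I B V) (liftFiber I B W) =
      ((f * f) ∘ Prod.fst) * (pairing gF V W ∘ Prod.snd) := by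
  funext p
  rw [pairing, warpedMetric_apply]
  change gB p.1 0 0 + f p.1 ^ 2 * gF p.2 (V p.2) (W p.2) = _
  simp [pairing, sq]

theorem isAlmostProduct_warped (hB : IsAlmostProduct gB J₁) (hF : IsAlmostProduct gF J₂)
    (hf : ContMDiff I 𝓘(ℝ, ℝ) ∞ f) :
    IsAlmostProduct (warpedMetric gB gF f) (productStructure J₁ J₂) where
  symm p v w := by
    rw [warpedMetric_apply, warpedMetric_apply]
    exact congrArg₂ (fun a c => a + f p.1 ^ 2 * c) (hB.symm p.1 v.1 w.1) (hF.symm p.2 v.2 w.2)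
  involutive p v := Prod.ext (hB.involutive p.1 v.1) (hF.involutive p.2 v.2)
  isometry p v w := by
    rw [warpedMetric_apply, warpedMetric_apply]
    exact congrArg₂ (fun a c => a + f p.1 ^ 2 * c) (hB.isometry p.1 v.1 w.1)
      (hF.isometry p.2 v.2 w.2)
  contMDiff_structure := by
    refine contMDiff_hom_section_of_apply fun A hA p => ?_
    refine productField_induction (p := p)
      (P := fun A => ContMDiffAt (I.prod I') (I.prod I').tangent ∞
        (fun x => (⟨x, applyField (productStructure J₁ J₂) A x⟩ :
          TangentBundle (I.prod I') (B × F))) p) ?_ ?_ ?_ ?_ ?_ hA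
    · intro A A' _ _ hAA h
      refine h.congr_of_eventuallyEq ?_
      filter_upwards [hAA] with x hx
      simp only [applyField, hx]
    · intro A A' _ _ h h'
      simp only [applyField_add]
      exact ContMDiffAt.add_section h h'
    · intro k A hk _ h
      simp only [applyField_smul]
      exact ContMDiffAt.smul_section hk.contMDiffAt h
    · intro X hX
      simp only [applyField_liftBase]
      exact (hB.isSmoothField_applyField hX).liftBase p
    · intro V hV
      simp only [applyField_liftFiber]
      exact (hF.isSmoothField_applyField hV).liftFiber p
  contMDiff_metric := by
    refine contMDiff_hom_section_of_apply fun A hA =>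
      contMDiff_hom_section_of_apply (E₂ := Bundle.Trivial (B × F) ℝ) fun A' hA' p => ?_
    rw [contMDiffAt_section]
    change ContMDiffAt (I.prod I') 𝓘(ℝ, ℝ) ∞ (pairing (warpedMetric gB gF f) A A') p
    refine productField_induction (p := p)
      (P := fun A => ContMDiffAt (I.prod I') 𝓘(ℝ, ℝ) ∞ (pairing (warpedMetric gB gF f) A A') p)
        ?_ ?_ ?_ ?_ ?_ hA
    · intro A A'' _ _ hAA h
      refine h.congr_of_eventuallyEq ?_
      filter_upwards [hAA] with x hx
      simp only [pairing, hx]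
    · intro A A'' _ _ h h'
      simp only [pairing_add_left]
      exact h.add h'
    · intro k A hk _ h
      simp only [pairing_smul_left]
      exact hk.contMDiffAt.mul h
    · intro X hX
      refine productField_induction (p := p)
        (P := fun A' => ContMDiffAt (I.prod I') 𝓘(ℝ, ℝ) ∞
          (pairing (warpedMetric gB gF f) (liftBase I' F X) A') p) ?_ ?_ ?_ ?_ ?_ hA'
      · intro A A'' _ _ hAA h
        refine h.congr_of_eventuallyEq ?_
        filter_upwards [hAA] with x hx
        simp only [pairing, hx]
      · intro A A'' _ _ h h'
        simp only [pairing_add_right]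
        exact h.add h'
      · intro k A hk _ h
        simp only [pairing_smul_right]
        exact hk.contMDiffAt.mul h
      · intro Y hY
        simp only [pairing_liftBase_liftBase]
        exact (hB.contMDiff_pairing hX hY).comp_fst p
      · intro V hV
        simp only [pairing_liftBase_liftFiber]
        exact contMDiffAt_const
    · intro V hV
      refine productField_induction (p := p)
        (P := fun A' => ContMDiffAt (I.prod I') 𝓘(ℝ, ℝ) ∞
          (pairing (warpedMetric gB gF f) (liftFiber I B V) A') p) ?_ ?_ ?_ ?_ ?_ hA'
      · intro A A'' _ _ hAA h
        refine h.congr_of_eventuallyEq ?_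
        filter_upwards [hAA] with x hx
        simp only [pairing, hx]
      · intro A A'' _ _ h h'
        simp only [pairing_add_right]
        exact h.add h'
      · intro k A hk _ h
        simp only [pairing_smul_right]
        exact hk.contMDiffAt.mul h
      · intro X hX
        simp only [pairing_liftFiber_liftBase]
        exact contMDiffAt_const
      · intro W hW
        simp only [pairing_liftFiber_liftFiber]
        exact ((hf.mul hf).comp_fst.mul (hF.contMDiff_pairing hV hW).comp_snd) p

end Lifts

section WarpedKoszul

variable {E : Type*} [NormedAddCommGroup E] [NormedSpace ℝ E] [FiniteDimensional ℝ E]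
  {H : Type*} [TopologicalSpace H] {I : ModelWithCorners ℝ E H} [I.Boundaryless]
  {B : Type*} [TopologicalSpace B] [ChartedSpace H B] [IsManifold I ∞ B] [T2Space B]
  {E' : Type*} [NormedAddCommGroup E'] [NormedSpace ℝ E'] [FiniteDimensional ℝ E']
  {H' : Type*} [TopologicalSpace H'] {I' : ModelWithCorners ℝ E' H'} [I'.Boundaryless]
  {F : Type*} [TopologicalSpace F] [ChartedSpace H' F] [IsManifold I' ∞ F] [T2Space F]
  {X Y Z : (x : B) → TangentSpace I x} {U V W : (y : F) → TangentSpace I' y}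
  {gB : (x : B) → TangentSpace I x →L[ℝ] TangentSpace I x →L[ℝ] ℝ}
  {J₁ : (x : B) → TangentSpace I x →L[ℝ] TangentSpace I x}
  {gF : (y : F) → TangentSpace I' y →L[ℝ] TangentSpace I' y →L[ℝ] ℝ}
  {J₂ : (y : F) → TangentSpace I' y →L[ℝ] TangentSpace I' y}
  {f : B → ℝ} (hB : IsAlmostProduct gB J₁) (hF : IsAlmostProduct gF J₂)
  (hf : ContMDiff I 𝓘(ℝ, ℝ) ∞ f)

include hf in
theorem dirDeriv_liftBase_warp {k : F → ℝ} (hk : ContMDiff I' 𝓘(ℝ, ℝ) ∞ k) (p : B × F) :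
    dirDeriv (liftBase I' F X) (((f * f) ∘ Prod.fst) * (k ∘ Prod.snd)) p =
      2 * f p.1 * dirDeriv X f p.1 * k p.2 := by
  rw [dirDeriv_mul (hf.mul hf).comp_fst hk.comp_snd, dirDeriv_liftBase_comp_fst (hf.mul hf),
    dirDeriv_liftBase_comp_snd hk, Function.comp_apply, Function.comp_apply, Function.comp_apply,
    dirDeriv_mul hf hf, Pi.zero_apply]
  ring

include hf in
theorem dirDeriv_liftFiber_warp {k : F → ℝ} (hk : ContMDiff I' 𝓘(ℝ, ℝ) ∞ k) (p : B × F) :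
    dirDeriv (liftFiber I B V) (((f * f) ∘ Prod.fst) * (k ∘ Prod.snd)) p =
      f p.1 ^ 2 * dirDeriv V k p.2 := by
  rw [dirDeriv_mul (hf.mul hf).comp_fst hk.comp_snd, dirDeriv_liftFiber_comp_fst (hf.mul hf),
    dirDeriv_liftFiber_comp_snd hk, Function.comp_apply, Function.comp_apply, Function.comp_apply,
    Pi.zero_apply, Pi.mul_apply]
  ring

theorem pairing_zero_right {M : Type*} [TopologicalSpace M] [ChartedSpace H M]
    {g : (x : M) → TangentSpace I x →L[ℝ] TangentSpace I x →L[ℝ] ℝ}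
    {X : (x : M) → TangentSpace I x} : pairing g X 0 = 0 := by
  ext x; simp [pairing]

include hB hF hf

theorem koszul_base_base_base (hX : IsSmoothField X) (hY : IsSmoothField Y)
    (hZ : IsSmoothField Z) (p : B × F) :
    koszul (warpedMetric gB gF f) (liftBase I' F X) (liftBase I' F Y) (liftBase I' F Z) p =
      koszul gB X Y Z p.1 := by
  unfold koszul
  simp only [mlieBracket_liftBase_liftBase hX hY, mlieBracket_liftBase_liftBase hY hZ,
    mlieBracket_liftBase_liftBase hZ hX, pairing_liftBase_liftBase,
    dirDeriv_liftBase_comp_fst (hB.contMDiff_pairing hY hZ),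
    dirDeriv_liftBase_comp_fst (hB.contMDiff_pairing hZ hX),
    dirDeriv_liftBase_comp_fst (hB.contMDiff_pairing hX hY), Function.comp_apply]

theorem koszul_base_base_fiber (hX : IsSmoothField X) (hY : IsSmoothField Y)
    (hW : IsSmoothField W) (p : B × F) :
    koszul (warpedMetric gB gF f) (liftBase I' F X) (liftBase I' F Y) (liftFiber I B W) p = 0 := by
  unfold koszul
  simp only [mlieBracket_liftBase_liftBase hX hY, mlieBracket_liftBase_liftFiber hY hW,
    mlieBracket_liftFiber_liftBase hX hW, pairing_liftBase_liftBase, pairing_liftBase_liftFiber,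
    pairing_liftFiber_liftBase, dirDeriv_zero, pairing_zero_right,
    dirDeriv_liftFiber_comp_fst (hB.contMDiff_pairing hX hY), Pi.zero_apply]
  norm_num

theorem koszul_base_fiber_fiber (hX : IsSmoothField X) (hV : IsSmoothField V)
    (hW : IsSmoothField W) (p : B × F) :
    koszul (warpedMetric gB gF f) (liftBase I' F X) (liftFiber I B V) (liftFiber I B W) p =
      f p.1 * dirDeriv X f p.1 * pairing gF V W p.2 := by
  unfold koszul
  simp only [mlieBracket_liftFiber_liftFiber hV hW, mlieBracket_liftBase_liftFiber hX hV,
    mlieBracket_liftFiber_liftBase hX hW, pairing_liftFiber_liftFiber, pairing_liftBase_liftFiber,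
    pairing_liftFiber_liftBase, dirDeriv_zero, pairing_zero_right,
    dirDeriv_liftBase_warp hf (hF.contMDiff_pairing hV hW), Pi.zero_apply]
  ring

theorem koszul_fiber_fiber_fiber (hU : IsSmoothField U) (hV : IsSmoothField V)
    (hW : IsSmoothField W) (p : B × F) :
    koszul (warpedMetric gB gF f) (liftFiber I B U) (liftFiber I B V) (liftFiber I B W) p =
      f p.1 ^ 2 * koszul gF U V W p.2 := by
  unfold koszul
  simp only [mlieBracket_liftFiber_liftFiber hU hV, mlieBracket_liftFiber_liftFiber hV hW,
    mlieBracket_liftFiber_liftFiber hW hU, pairing_liftFiber_liftFiber,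
    dirDeriv_liftFiber_warp hf (hF.contMDiff_pairing hV hW),
    dirDeriv_liftFiber_warp hf (hF.contMDiff_pairing hW hU),
    dirDeriv_liftFiber_warp hf (hF.contMDiff_pairing hU hV), Pi.mul_apply, Function.comp_apply]
  ring

theorem koszul_base_fiber_base (hX : IsSmoothField X) (hY : IsSmoothField Y)
    (hW : IsSmoothField W) (p : B × F) :
    koszul (warpedMetric gB gF f) (liftBase I' F X) (liftFiber I B W) (liftBase I' F Y) p = 0 := by
  have h := koszul_add_koszul_swap (isAlmostProduct_warped hB hF hf) (liftBase I' F X)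
    (liftBase I' F Y) (liftFiber I B W) p
  rw [koszul_base_base_fiber hB hF hf hX hY hW, pairing_liftBase_liftFiber, dirDeriv_zero] at h
  linarith

theorem koszul_fiber_base_base (hX : IsSmoothField X) (hY : IsSmoothField Y)
    (hW : IsSmoothField W) (p : B × F) :
    koszul (warpedMetric gB gF f) (liftFiber I B W) (liftBase I' F X) (liftBase I' F Y) p = 0 := by
  have h := koszul_sub_koszul_swap (isAlmostProduct_warped hB hF hf) (liftBase I' F X)
    (liftFiber I B W) (liftBase I' F Y) p
  rw [koszul_base_fiber_base hB hF hf hX hY hW, mlieBracket_liftBase_liftFiber hX hW,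
    pairing_comm (isAlmostProduct_warped hB hF hf), pairing_zero_right, Pi.zero_apply] at h
  linarith

theorem koszul_fiber_base_fiber (hX : IsSmoothField X) (hV : IsSmoothField V)
    (hW : IsSmoothField W) (p : B × F) :
    koszul (warpedMetric gB gF f) (liftFiber I B V) (liftBase I' F X) (liftFiber I B W) p =
      f p.1 * dirDeriv X f p.1 * pairing gF V W p.2 := by
  have h := koszul_sub_koszul_swap (isAlmostProduct_warped hB hF hf) (liftBase I' F X)
    (liftFiber I B V) (liftFiber I B W) p
  rw [koszul_base_fiber_fiber hB hF hf hX hV hW, mlieBracket_liftBase_liftFiber hX hV,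
    pairing_comm (isAlmostProduct_warped hB hF hf), pairing_zero_right, Pi.zero_apply] at h
  linarith

theorem koszul_fiber_fiber_base (hX : IsSmoothField X) (hV : IsSmoothField V)
    (hW : IsSmoothField W) (p : B × F) :
    koszul (warpedMetric gB gF f) (liftFiber I B V) (liftFiber I B W) (liftBase I' F X) p =
      -(f p.1 * dirDeriv X f p.1 * pairing gF V W p.2) := by
  have h := koszul_add_koszul_swap (isAlmostProduct_warped hB hF hf) (liftFiber I B V)
    (liftFiber I B W) (liftBase I' F X) p
  rw [koszul_fiber_base_fiber hB hF hf hX hV hW, pairing_liftFiber_liftBase, dirDeriv_zero] at h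
  linarith

end WarpedKoszul

section Nondegenerate

variable {E : Type*} [NormedAddCommGroup E] [NormedSpace ℝ E] [FiniteDimensional ℝ E]
  {H : Type*} [TopologicalSpace H] {I : ModelWithCorners ℝ E H}
  {M : Type*} [TopologicalSpace M] [ChartedSpace H M] [IsManifold I ∞ M] [T2Space M]
  {X Y Z T : (x : M) → TangentSpace I x} {h : M → ℝ}
  {g : (x : M) → TangentSpace I x →L[ℝ] TangentSpace I x →L[ℝ] ℝ}
  {J : (x : M) → TangentSpace I x →L[ℝ] TangentSpace I x}
  {α τ : ((x : M) → TangentSpace I x) → M → ℝ} {p : M}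

theorem exists_eventuallyEq_sum_frame {A : (x : M) → TangentSpace I x} (hA : IsSmoothField A)
    (p : M) : ∃ (e : FrameIndex E → (x : M) → TangentSpace I x) (a : FrameIndex E → M → ℝ),
      (∀ i, IsSmoothField (e i)) ∧ (∀ i, ContMDiff I 𝓘(ℝ, ℝ) ∞ (a i)) ∧
      (∀ i, a i p = frameCoord p i ⟨p, A p⟩) ∧ A =ᶠ[𝓝 p] ∑ i, a i • e i := by
  obtain ⟨e, he, hev⟩ := exists_smooth_frame (I := I) p
  set t := trivializationAt E (TangentSpace I) p
  have hpt : p ∈ t.baseSet := FiberBundle.mem_baseSet_trivializationAt E (TangentSpace I) p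
  have h1 : ∀ i, ∃ a : M → ℝ, ContMDiff I 𝓘(ℝ, ℝ) ∞ a ∧
      a =ᶠ[𝓝 p] fun q => frameCoord p i ⟨q, A q⟩ := fun i => by
    refine exists_contMDiff_eventuallyEq t.open_baseSet hpt ?_
    refine (contMDiffOn_frameCoord p i).comp (ContMDiff.contMDiffOn hA) fun q hq => ?_
    rw [mem_preimage, t.mem_source]
    exact hq
  choose a ha ha' using h1
  refine ⟨e, a, he, ha, fun i => (ha' i).self_of_nhds, ?_⟩
  filter_upwards [hev, eventually_all.2 ha'] with q hq hq'
  refine (hq.2 (A q)).trans (Eq.trans (Finset.sum_congr rfl fun i _ => ?_)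
    (Finset.sum_apply q Finset.univ fun i => a i • e i).symm)
  rw [Pi.smul_apply', hq' i]

theorem frameCoord_zero (p : M) (i : FrameIndex E) :
    frameCoord (I := I) p i ⟨p, 0⟩ = 0 := by
  have h := FiberBundle.mem_baseSet_trivializationAt E (TangentSpace I) p
  have h1 := (trivializationAt E (TangentSpace I) p).coe_linearMapAt_of_mem (R := ℝ) h
  have h2 : (trivializationAt E (TangentSpace I) p ⟨p, 0⟩).2 = 0 := by
    rw [← congrFun h1 0, map_zero]
  rw [frameCoord, h2]
  simp

/-- The functional `Φ` on smooth vector fields only depends on germs at `p`, and is linear over the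
smooth functions. -/
structure IsTensorialAt (p : M) (Φ : ((x : M) → TangentSpace I x) → ℝ) : Prop where
  congr : ∀ A A', IsSmoothField A → IsSmoothField A' → A =ᶠ[𝓝 p] A' → Φ A = Φ A'
  add : ∀ A A', IsSmoothField A → IsSmoothField A' → Φ (A + A') = Φ A + Φ A'
  smul : ∀ (h : M → ℝ) A, ContMDiff I 𝓘(ℝ, ℝ) ∞ h → IsSmoothField A → Φ (h • A) = h p * Φ A

/-- A functional on smooth vector fields that is tensorial at `p` is given by a linear form on the
tangent space. -/
theorem IsTensorialAt.exists_linearMap {Φ : ((x : M) → TangentSpace I x) → ℝ}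
    (hΦ : IsTensorialAt p Φ) :
    ∃ l : TangentSpace I p →ₗ[ℝ] ℝ, ∀ Z, IsSmoothField Z → Φ Z = l (Z p) := by
  obtain ⟨congr, add, smul⟩ := hΦ
  have zero : Φ 0 = 0 := by
    have := smul 0 0 contMDiff_const .zero
    simpa using this
  have sum : ∀ (s : Finset (FrameIndex E)) (A : FrameIndex E → (x : M) → TangentSpace I x),
      (∀ i, IsSmoothField (A i)) → (∀ i, Φ (A i) = 0) → Φ (∑ i ∈ s, A i) = 0 := by
    intro s A hA hP
    induction s using Finset.induction_on with
    | empty => simpa using zero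
    | insert i s hi ih =>
      rw [Finset.sum_insert hi, add _ _ (hA i) (.finsetSum fun i _ => hA i), hP i, ih, add_zero]
  have vanish : ∀ A, IsSmoothField A → A p = 0 → Φ A = 0 := by
    intro A hA hA0
    obtain ⟨e, a, he, ha, hap, hev⟩ := exists_eventuallyEq_sum_frame hA p
    rw [congr _ _ hA (.finsetSum fun i _ => .smul (ha i) (he i)) hev]
    refine sum _ _ (fun i => .smul (ha i) (he i)) fun i => ?_
    rw [smul _ _ (ha i) (he i), hap i, hA0, frameCoord_zero, zero_mul]
  have const_smul : ∀ (c : ℝ) A, IsSmoothField A → Φ ((fun _ => c : M → ℝ) • A) = c * Φ A :=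
    fun c A hA => smul _ _ contMDiff_const hA
  have pointwise : ∀ A A', IsSmoothField A → IsSmoothField A' → A p = A' p → Φ A = Φ A' := by
    intro A A' hA hA' hAA
    have h1 : IsSmoothField ((fun _ => -1 : M → ℝ) • A') := .smul contMDiff_const hA'
    have h2 := vanish (A + (fun _ => -1 : M → ℝ) • A') (hA.add h1) (by
      simp [hAA])
    rw [add _ _ hA h1, const_smul _ _ hA'] at h2
    linarith
  choose ext hext hextp using exists_isSmoothField_apply_eq (I := I) p
  refine ⟨⟨⟨fun v => Φ (ext v), fun v w => ?_⟩, fun c v => ?_⟩, fun Z hZ => ?_⟩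
  · rw [← add _ _ (hext v) (hext w)]
    exact pointwise _ _ (hext _) ((hext v).add (hext w)) (by simp [hextp])
  · simp only [RingHom.id_apply, smul_eq_mul]
    rw [← const_smul c _ (hext v)]
    exact pointwise _ _ (hext _) (.smul contMDiff_const (hext v)) (by simp [hextp])
  · exact pointwise _ _ hZ (hext _) (hextp _).symm

theorem IsNondegenerate.exists_eq (hg' : IsNondegenerate g) (p : M)
    (l : TangentSpace I p →ₗ[ℝ] ℝ) : ∃ u : TangentSpace I p, ∀ w, l w = g p u w := by
  have fin : FiniteDimensional ℝ (TangentSpace I p) := inferInstanceAs (FiniteDimensional ℝ E)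
  let G : TangentSpace I p →ₗ[ℝ] Module.Dual ℝ (TangentSpace I p) := (g p).toLinearMap₁₂
  have hinj : Function.Injective G := by
    rw [← LinearMap.ker_eq_bot, LinearMap.ker_eq_bot']
    exact fun v hv => hg' p v fun w => LinearMap.congr_fun hv w
  have hsurj := (LinearMap.injective_iff_surjective_of_finrank_eq_finrank
    (Subspace.dual_finrank_eq (K := ℝ) (V := TangentSpace I p)).symm).1 hinj
  obtain ⟨u, hu⟩ := hsurj l
  exact ⟨u, fun w => (LinearMap.congr_fun hu w).symm⟩

theorem isTensorialAt_lowerDeriv (hg : IsAlmostProduct g J) (hX : IsSmoothField X)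
    (hY : IsSmoothField Y) (p : M) : IsTensorialAt p fun Z => lowerDeriv g J X Y Z p where
  congr _ _ _ _ h := apKoszul_congr (.refl _ _) (.refl _ _) h
  add _ _ hA hA' := apKoszul_add_right hg hX hY hA hA' p
  smul _ _ hh hA := apKoszul_smul_right hg hh hX hY hA p

theorem isTensorialAt_covDeriv (hg : IsAlmostProduct g J) (hr : IsRepresentable g J)
    (hs : HasSmoothContractions g J) (hX : IsSmoothField X) (hY : IsSmoothField Y)
    (hZ : IsSmoothField Z) (p : M) :
    IsTensorialAt p fun T => covDeriv g J X (lowerDeriv g J Y Z) T p where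
  congr _ _ _ hA' h := covDeriv_congr hg hr hs hX hY hZ hA' (.refl _ _) (.refl _ _) (.refl _ _) h
  add _ _ hA hA' := congrFun (covDeriv_add_right hg hr hs hX hY hZ hA hA') p
  smul _ _ hh hA := congrFun (covDeriv_smul_right hg hr hs hh hX hY hZ hA) p

theorem isRepresentable_of_isNondegenerate (hg : IsAlmostProduct g J) (hg' : IsNondegenerate g) :
    IsRepresentable g J := by
  intro X Y hX hY p
  obtain ⟨l, hl⟩ := (isTensorialAt_lowerDeriv hg hX hY p).exists_linearMap
  obtain ⟨u, hu⟩ := hg'.exists_eq p l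
  exact ⟨u, fun Z hZ => (hl Z hZ).trans (hu _)⟩

theorem isAnnihilatorForm_lowerDeriv (hg : IsAlmostProduct g J) (hr : IsRepresentable g J)
    (hX : IsSmoothField X) (hY : IsSmoothField Y) :
    IsAnnihilatorForm g (lowerDeriv g J X Y) :=
  ⟨fun _ hZ => contMDiff_lowerDeriv hg hX hY hZ, hr X Y hX hY⟩

theorem isAnnihilatorForm_differential (hg' : IsNondegenerate g)
    (hh : ContMDiff I 𝓘(ℝ, ℝ) ∞ h) : IsAnnihilatorForm g (differential I h) :=
  ⟨fun _ hZ => hZ.contMDiff_dirDeriv hh, fun p => by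
    obtain ⟨u, hu⟩ := hg'.exists_eq p (mvfderiv I h p).toLinearMap
    exact ⟨u, fun Z _ => hu (Z p)⟩⟩

theorem Represents.formComp (hg : IsAlmostProduct g J) {u : TangentSpace I p}
    (hu : Represents g α p u) : Represents g (formComp α J) p (J p u) := fun Z hZ => by
  have h1 := hu _ (hg.isSmoothField_applyField hZ)
  rw [SingularGeometry.formComp, h1, ← hg.isometry, applyField, hg.involutive]

theorem IsAnnihilatorForm.formComp (hg : IsAlmostProduct g J) (hα : IsAnnihilatorForm g α) :
    IsAnnihilatorForm g (formComp α J) :=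
  ⟨fun _ hZ => hα.1 _ (hg.isSmoothField_applyField hZ), fun p => by
    obtain ⟨u, hu⟩ := hα.2 p
    exact ⟨_, hu.formComp hg⟩⟩

theorem contMDiff_det {n : ℕ} {A : M → Matrix (Fin n) (Fin n) ℝ}
    (hA : ∀ i j, ContMDiff I 𝓘(ℝ, ℝ) ∞ fun x => A x i j) :
    ContMDiff I 𝓘(ℝ, ℝ) ∞ fun x => (A x).det := by
  simp only [Matrix.det_apply']
  refine ContMDiff.sum fun σ _ => contMDiff_const.mul ?_
  exact ContMDiff.prod fun i _ => hA _ _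

theorem contMDiff_cramer {n : ℕ} {A : M → Matrix (Fin n) (Fin n) ℝ} {b : M → Fin n → ℝ}
    (hA : ∀ i j, ContMDiff I 𝓘(ℝ, ℝ) ∞ fun x => A x i j)
    (hb : ∀ i, ContMDiff I 𝓘(ℝ, ℝ) ∞ fun x => b x i) (i : Fin n) :
    ContMDiff I 𝓘(ℝ, ℝ) ∞ fun x => (A x).cramer (b x) i := by
  simp only [Matrix.cramer_apply]
  refine contMDiff_det fun k l => ?_
  simp only [Matrix.updateCol_apply]
  split_ifs
  exacts [hb k, hA k l]

/-- For a non-degenerate form, a smooth 1-form is dual to a smooth vector field. -/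
theorem exists_smooth_sharp (hg : IsAlmostProduct g J) (hg' : IsNondegenerate g)
    (hα : IsAnnihilatorForm g α) (p : M) :
    ∃ S : (x : M) → TangentSpace I x, IsSmoothField S ∧
      ∀ᶠ x in 𝓝 p, Represents g α x (S x) := by
  obtain ⟨e, he, hev⟩ := exists_smooth_frame (I := I) p
  let A : M → Matrix (FrameIndex E) (FrameIndex E) ℝ :=
    fun x => Matrix.of fun j i => pairing g (e i) (e j) x
  let b : M → FrameIndex E → ℝ := fun x j => α (e j) x
  have hA : ∀ i j, ContMDiff I 𝓘(ℝ, ℝ) ∞ fun x => A x i j :=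
    fun i j => hg.contMDiff_pairing (he j) (he i)
  have hb : ∀ i, ContMDiff I 𝓘(ℝ, ℝ) ∞ fun x => b x i := fun i => hα.1 _ (he i)
  have hdet := contMDiff_det hA
  have ext : ∀ x, (∀ v, v = ∑ i, frameCoord p i ⟨x, v⟩ • e i x) → ∀ u u' : TangentSpace I x,
      (∀ j, g x u (e j x) = g x u' (e j x)) → ∀ w, g x u w = g x u' w := by
    intro x hx u u' huu w
    rw [hx w, map_sum, map_sum]
    refine Finset.sum_congr rfl fun j _ => ?_
    rw [map_smul, map_smul, huu j]
  have mulVec : ∀ x (c : FrameIndex E → ℝ) j,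
      (A x).mulVec c j = g x (∑ i, c i • e i x) (e j x) := by
    intro x c j
    rw [map_sum, sum_apply, Matrix.mulVec, dotProduct]
    refine Finset.sum_congr rfl fun i _ => ?_
    rw [map_smul, smul_apply, smul_eq_mul, mul_comm]
    rfl
  have hdetp : (A p).det ≠ 0 := by
    intro h0
    obtain ⟨c, hc, hc0⟩ := Matrix.exists_mulVec_eq_zero_iff.2 h0
    have hsum : ∑ i, c i • e i p = 0 := by
      refine hg' p _ fun w => ?_
      rw [ext p hev.self_of_nhds.2 _ 0 (fun j => ?_) w, map_zero, zero_apply]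
      rw [← mulVec, hc0, map_zero, zero_apply]
      rfl
    have fin : FiniteDimensional ℝ (TangentSpace I p) := inferInstanceAs (FiniteDimensional ℝ E)
    have hli : LinearIndependent ℝ fun i => e i p := by
      refine linearIndependent_of_top_le_span_of_card_eq_finrank (fun v _ => ?_) ?_
      · rw [hev.self_of_nhds.2 v]
        exact Submodule.sum_mem _ fun i _ =>
          Submodule.smul_mem _ _ (Submodule.subset_span ⟨i, rfl⟩)
      · exact Fintype.card_fin _
    exact hc (funext fun i => Fintype.linearIndependent_iff.1 hli c hsum i)
  have hopen : IsOpen {x | (A x).det ≠ 0} := isOpen_ne_fun hdet.continuous continuous_const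
  have hcoef : ∀ i, ∃ a : M → ℝ, ContMDiff I 𝓘(ℝ, ℝ) ∞ a ∧
      a =ᶠ[𝓝 p] fun x => (A x).cramer (b x) i / (A x).det := fun i =>
    exists_contMDiff_eventuallyEq hopen hdetp
      ((contMDiff_cramer hA hb i).contMDiffOn.div₀ hdet.contMDiffOn fun _ hx => hx)
  choose a ha ha' using hcoef
  refine ⟨∑ i, a i • e i, .finsetSum fun i _ => .smul (ha i) (he i), ?_⟩
  filter_upwards [hev, eventually_all.2 ha', hopen.mem_nhds hdetp] with x hx hax hdx Z hZ
  obtain ⟨u, hu⟩ := hα.2 x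
  rw [hu Z hZ]
  refine ext x hx.2 _ _ (fun j => ?_) _
  have h1 : (∑ i, a i • e i) x = ∑ i, ((A x).det⁻¹ • (A x).cramer (b x)) i • e i x := by
    refine (Finset.sum_apply x Finset.univ fun i => a i • e i).trans
      (Finset.sum_congr rfl fun i _ => ?_)
    rw [Pi.smul_apply', hax i, Pi.smul_apply, smul_eq_mul, div_eq_inv_mul]
  rw [h1, ← mulVec, Matrix.mulVec_smul, Matrix.mulVec_cramer, smul_smul, inv_mul_cancel₀ hdx,
    one_smul, ← hu _ (he j)]

theorem contMDiff_contraction (hg : IsAlmostProduct g J) (hg' : IsNondegenerate g)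
    (hα : IsAnnihilatorForm g α) (hτ : IsAnnihilatorForm g τ) :
    ContMDiff I 𝓘(ℝ, ℝ) ∞ (contraction g α τ) := by
  intro p
  obtain ⟨S, hS, hev⟩ := exists_smooth_sharp hg hg' hα p
  refine (hτ.1 S hS).contMDiffAt.congr_of_eventuallyEq ?_
  filter_upwards [hev] with x hx
  obtain ⟨v, hv⟩ := hτ.2 x
  rw [contraction_eq hg hx hv, hv S hS, hg.symm]

end Nondegenerate

section WarpedLowerDeriv

variable {E : Type*} [NormedAddCommGroup E] [NormedSpace ℝ E] [FiniteDimensional ℝ E]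
  {H : Type*} [TopologicalSpace H] {I : ModelWithCorners ℝ E H} [I.Boundaryless]
  {B : Type*} [TopologicalSpace B] [ChartedSpace H B] [IsManifold I ∞ B] [T2Space B]
  {E' : Type*} [NormedAddCommGroup E'] [NormedSpace ℝ E'] [FiniteDimensional ℝ E']
  {H' : Type*} [TopologicalSpace H'] {I' : ModelWithCorners ℝ E' H'} [I'.Boundaryless]
  {F : Type*} [TopologicalSpace F] [ChartedSpace H' F] [IsManifold I' ∞ F] [T2Space F]
  {X Y Z : (x : B) → TangentSpace I x} {U V W : (y : F) → TangentSpace I' y}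
  {gB : (x : B) → TangentSpace I x →L[ℝ] TangentSpace I x →L[ℝ] ℝ}
  {J₁ : (x : B) → TangentSpace I x →L[ℝ] TangentSpace I x}
  {gF : (y : F) → TangentSpace I' y →L[ℝ] TangentSpace I' y →L[ℝ] ℝ}
  {J₂ : (y : F) → TangentSpace I' y →L[ℝ] TangentSpace I' y}
  {f : B → ℝ}

/-- The function `(x, y) ↦ k(x) l(y)`. -/
def sepFun (k : B → ℝ) (l : F → ℝ) : B × F → ℝ := fun p => k p.1 * l p.2

theorem contMDiff_sepFun {k : B → ℝ} {l : F → ℝ} (hk : ContMDiff I 𝓘(ℝ, ℝ) ∞ k)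
    (hl : ContMDiff I' 𝓘(ℝ, ℝ) ∞ l) : ContMDiff (I.prod I') 𝓘(ℝ, ℝ) ∞ (sepFun k l) :=
  hk.comp_fst.mul hl.comp_snd

theorem dirDeriv_liftBase_sepFun {k : B → ℝ} {l : F → ℝ} (hk : ContMDiff I 𝓘(ℝ, ℝ) ∞ k)
    (hl : ContMDiff I' 𝓘(ℝ, ℝ) ∞ l) (p : B × F) :
    dirDeriv (liftBase I' F X) (sepFun k l) p = dirDeriv X k p.1 * l p.2 := by
  refine (dirDeriv_mul hk.comp_fst hl.comp_snd p).trans ?_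
  rw [dirDeriv_liftBase_comp_fst hk, dirDeriv_liftBase_comp_snd hl]
  simp

theorem dirDeriv_liftFiber_sepFun {k : B → ℝ} {l : F → ℝ} (hk : ContMDiff I 𝓘(ℝ, ℝ) ∞ k)
    (hl : ContMDiff I' 𝓘(ℝ, ℝ) ∞ l) (p : B × F) :
    dirDeriv (liftFiber I B V) (sepFun k l) p = k p.1 * dirDeriv V l p.2 := by
  refine (dirDeriv_mul hk.comp_fst hl.comp_snd p).trans ?_
  rw [dirDeriv_liftFiber_comp_fst hk, dirDeriv_liftFiber_comp_snd hl]
  simp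

/-- The function `c f X(f)`. -/
def warpDeriv (c : ℝ) (f : B → ℝ) (X : (x : B) → TangentSpace I x) : B → ℝ :=
  fun b => c * (f * dirDeriv X f) b

theorem contMDiff_warpDeriv (c : ℝ) (hf : ContMDiff I 𝓘(ℝ, ℝ) ∞ f) (hX : IsSmoothField X) :
    ContMDiff I 𝓘(ℝ, ℝ) ∞ (warpDeriv c f X) :=
  contMDiff_const.mul (hf.mul (hX.contMDiff_dirDeriv hf))

theorem dirDeriv_warpDeriv (c : ℝ) (hf : ContMDiff I 𝓘(ℝ, ℝ) ∞ f) (hX : IsSmoothField X) (b : B) :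
    dirDeriv Y (warpDeriv c f X) b =
      c * (dirDeriv Y f b * dirDeriv X f b + f b * dirDeriv Y (dirDeriv X f) b) := by
  have hX' := hX.contMDiff_dirDeriv hf
  unfold warpDeriv
  rw [dirDeriv_const_mul c (hf.mul hX'), dirDeriv_mul hf hX']
  ring

section

variable (hB : IsAlmostProduct gB J₁) (hF : IsAlmostProduct gF J₂)
  (hf : ContMDiff I 𝓘(ℝ, ℝ) ∞ f)
include hB hF hf

theorem lowerDeriv_base_base_base (hX : IsSmoothField X) (hY : IsSmoothField Y)
    (hZ : IsSmoothField Z) :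
    lowerDeriv (warpedMetric gB gF f) (productStructure J₁ J₂) (liftBase I' F X) (liftBase I' F Y)
      (liftBase I' F Z) = lowerDeriv gB J₁ X Y Z ∘ Prod.fst := by
  funext p
  unfold lowerDeriv apKoszul
  rw [applyField_liftBase, applyField_liftBase, koszul_base_base_base hB hF hf hX hY hZ,
    koszul_base_base_base hB hF hf hX (hB.isSmoothField_applyField hY)
      (hB.isSmoothField_applyField hZ)]
  rfl

theorem lowerDeriv_base_base_fiber (hX : IsSmoothField X) (hY : IsSmoothField Y)
    (hW : IsSmoothField W) :
    lowerDeriv (warpedMetric gB gF f) (productStructure J₁ J₂) (liftBase I' F X) (liftBase I' F Y)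
      (liftFiber I B W) = 0 := by
  funext p
  unfold lowerDeriv apKoszul
  rw [applyField_liftBase, applyField_liftFiber, koszul_base_base_fiber hB hF hf hX hY hW,
    koszul_base_base_fiber hB hF hf hX (hB.isSmoothField_applyField hY)
      (hF.isSmoothField_applyField hW)]
  simp

theorem lowerDeriv_base_fiber_base (hX : IsSmoothField X) (hY : IsSmoothField Y)
    (hW : IsSmoothField W) :
    lowerDeriv (warpedMetric gB gF f) (productStructure J₁ J₂) (liftBase I' F X) (liftFiber I B W)
      (liftBase I' F Y) = 0 := by
  funext p
  unfold lowerDeriv apKoszul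
  rw [applyField_liftBase, applyField_liftFiber, koszul_base_fiber_base hB hF hf hX hY hW,
    koszul_base_fiber_base hB hF hf hX (hB.isSmoothField_applyField hY)
      (hF.isSmoothField_applyField hW)]
  simp

theorem lowerDeriv_fiber_base_base (hX : IsSmoothField X) (hY : IsSmoothField Y)
    (hW : IsSmoothField W) :
    lowerDeriv (warpedMetric gB gF f) (productStructure J₁ J₂) (liftFiber I B W) (liftBase I' F X)
      (liftBase I' F Y) = 0 := by
  funext p
  unfold lowerDeriv apKoszul
  rw [applyField_liftBase, applyField_liftBase, koszul_fiber_base_base hB hF hf hX hY hW,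
    koszul_fiber_base_base hB hF hf (hB.isSmoothField_applyField hX)
      (hB.isSmoothField_applyField hY) hW]
  simp

theorem lowerDeriv_base_fiber_fiber (hX : IsSmoothField X) (hV : IsSmoothField V)
    (hW : IsSmoothField W) :
    lowerDeriv (warpedMetric gB gF f) (productStructure J₁ J₂) (liftBase I' F X) (liftFiber I B V)
      (liftFiber I B W) = sepFun (warpDeriv 1 f X) (pairing gF V W) := by
  funext p
  unfold lowerDeriv apKoszul
  rw [applyField_liftFiber, applyField_liftFiber, koszul_base_fiber_fiber hB hF hf hX hV hW,
    koszul_base_fiber_fiber hB hF hf hX (hF.isSmoothField_applyField hV)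
      (hF.isSmoothField_applyField hW), pairing_apply_apply hF]
  simp only [sepFun, warpDeriv, Pi.mul_apply]
  ring

theorem lowerDeriv_fiber_base_fiber (hX : IsSmoothField X) (hV : IsSmoothField V)
    (hW : IsSmoothField W) :
    lowerDeriv (warpedMetric gB gF f) (productStructure J₁ J₂) (liftFiber I B V) (liftBase I' F X)
      (liftFiber I B W) = sepFun (warpDeriv (1 / 2) f X) (pairing gF V W) +
        sepFun (warpDeriv (1 / 2) f (applyField J₁ X)) (pairing gF V (applyField J₂ W)) := by
  funext p
  unfold lowerDeriv apKoszul
  rw [applyField_liftFiber, applyField_liftBase, koszul_fiber_base_fiber hB hF hf hX hV hW,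
    koszul_fiber_base_fiber hB hF hf (hB.isSmoothField_applyField hX) hV
      (hF.isSmoothField_applyField hW)]
  simp only [sepFun, warpDeriv, Pi.mul_apply, Pi.add_apply]
  ring

theorem lowerDeriv_fiber_fiber_base (hX : IsSmoothField X) (hV : IsSmoothField V)
    (hW : IsSmoothField W) :
    lowerDeriv (warpedMetric gB gF f) (productStructure J₁ J₂) (liftFiber I B V) (liftFiber I B W)
      (liftBase I' F X) = sepFun (warpDeriv (-(1 / 2)) f X) (pairing gF V W) +
        sepFun (warpDeriv (-(1 / 2)) f (applyField J₁ X)) (pairing gF V (applyField J₂ W)) := by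
  funext p
  unfold lowerDeriv apKoszul
  rw [applyField_liftFiber, applyField_liftBase, koszul_fiber_fiber_base hB hF hf hX hV hW,
    koszul_fiber_fiber_base hB hF hf (hB.isSmoothField_applyField hX) hV
      (hF.isSmoothField_applyField hW)]
  simp only [sepFun, warpDeriv, Pi.mul_apply, Pi.add_apply]
  ring

theorem lowerDeriv_fiber_fiber_fiber (hU : IsSmoothField U) (hV : IsSmoothField V)
    (hW : IsSmoothField W) :
    lowerDeriv (warpedMetric gB gF f) (productStructure J₁ J₂) (liftFiber I B U) (liftFiber I B V)
      (liftFiber I B W) = sepFun (f * f) (lowerDeriv gF J₂ U V W) := by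
  funext p
  unfold lowerDeriv apKoszul
  rw [applyField_liftFiber, applyField_liftFiber, koszul_fiber_fiber_fiber hB hF hf hU hV hW,
    koszul_fiber_fiber_fiber hB hF hf hU (hF.isSmoothField_applyField hV)
      (hF.isSmoothField_applyField hW)]
  simp only [sepFun, Pi.mul_apply]
  ring

end

section RegularSet

variable (hB : IsAlmostProduct gB J₁) (hB' : IsNondegenerate gB) (hF : IsAlmostProduct gF J₂)
  (hf : ContMDiff I 𝓘(ℝ, ℝ) ∞ f) {p : B × F}
include hB hB' hF hf

theorem mem_radical_warped (v : TangentSpace (I.prod I') p) :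
    v ∈ (quadForm (warpedMetric gB gF f) p).radical ↔
      v.1 = 0 ∧ (f p.1 = 0 ∨ ∀ w, gF p.2 v.2 w = 0) := by
  rw [mem_radical_quadForm (isAlmostProduct_warped hB hF hf)]
  simp only [warpedMetric_apply]
  constructor
  · intro h
    refine ⟨hB' p.1 v.1 fun w => ?_, or_iff_not_imp_left.2 fun h0 w => ?_⟩
    · have h1 : gB p.1 v.1 w + f p.1 ^ 2 * gF p.2 v.2 0 = 0 := h ((w, 0) : E × E')
      rwa [map_zero, mul_zero, add_zero] at h1
    · have h1 : gB p.1 v.1 0 + f p.1 ^ 2 * gF p.2 v.2 w = 0 := h ((0, w) : E × E')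
      rw [map_zero, zero_add] at h1
      exact (mul_eq_zero.1 h1).resolve_left (pow_ne_zero 2 h0)
  · rintro ⟨h1, h2⟩ w
    have h3 : ∀ a c : TangentSpace I p.1, a = 0 → gB p.1 a c = 0 := by
      rintro a c rfl
      rw [map_zero, zero_apply]
    rw [show gB p.1 v.1 w.1 = 0 from h3 _ _ h1, zero_add]
    rcases h2 with h2 | h2
    · rw [h2]
      ring
    · rw [show gF p.2 v.2 w.2 = 0 from h2 _, mul_zero]

theorem finrank_radical_warped_of_ne (h : f p.1 ≠ 0) :
    Module.finrank ℝ (quadForm (warpedMetric gB gF f) p).radical =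
      Module.finrank ℝ (quadForm gF p.2).radical := by
  have h1 : (quadForm (warpedMetric gB gF f) p).radical =
      Submodule.map (LinearMap.inr ℝ (TangentSpace I p.1) (TangentSpace I' p.2))
        (quadForm gF p.2).radical := by
    ext v
    refine (mem_radical_warped hB hB' hF hf v).trans ?_
    constructor
    · rintro ⟨h1, h2⟩
      exact ⟨v.2, (mem_radical_quadForm hF _ _).2 (h2.resolve_left h), Prod.ext h1.symm rfl⟩
    · rintro ⟨w, hw, rfl⟩
      exact ⟨rfl, .inr ((mem_radical_quadForm hF _ _).1 hw)⟩
  have h2 := (Submodule.equivMapOfInjective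
    (LinearMap.inr ℝ (TangentSpace I p.1) (TangentSpace I' p.2)) LinearMap.inr_injective
    (quadForm gF p.2).radical).finrank_eq
  rw [h2]
  exact congrArg (fun S : Submodule ℝ (TangentSpace (I.prod I') p) => Module.finrank ℝ S) h1

theorem finrank_radical_warped_of_eq (h : f p.1 = 0) :
    Module.finrank ℝ (quadForm (warpedMetric gB gF f) p).radical = Module.finrank ℝ E' := by
  have h1 : (quadForm (warpedMetric gB gF f) p).radical =
      LinearMap.range (LinearMap.inr ℝ (TangentSpace I p.1) (TangentSpace I' p.2)) := by
    ext v
    refine (mem_radical_warped hB hB' hF hf v).trans ?_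
    constructor
    · rintro ⟨h1, h2⟩
      exact ⟨v.2, Prod.ext h1.symm rfl⟩
    · rintro ⟨w, rfl⟩
      exact ⟨rfl, .inl h⟩
  refine Eq.trans ?_ (LinearMap.finrank_range_of_inj
    (LinearMap.inr_injective (R := ℝ) (M := TangentSpace I p.1) (M₂ := TangentSpace I' p.2)))
  exact congrArg (fun S : Submodule ℝ (TangentSpace (I.prod I') p) => Module.finrank ℝ S) h1

theorem snd_mem_regularSet (hp : p ∈ regularSet (warpedMetric gB gF f)) (h : f p.1 ≠ 0) :
    p.2 ∈ regularSet gF := by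
  rw [mem_regularSet_iff (isAlmostProduct_warped hB hF hf),
    finrank_radical_warped_of_ne hB hB' hF hf h] at hp
  rw [mem_regularSet_iff hF]
  have h1 : ContinuousAt (fun y : F => (p.1, y)) p.2 := by fun_prop
  filter_upwards [h1.eventually hp] with y hy
  rwa [finrank_radical_warped_of_ne hB hB' hF hf (p := (p.1, y)) h] at hy

/-- At a regular point where the warping function vanishes, either it vanishes to first order or
the fiber metric vanishes. -/
theorem dirDeriv_eq_zero_or_of_mem_regularSet (hp : p ∈ regularSet (warpedMetric gB gF f))
    (h : f p.1 = 0) :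
    (∀ X : (x : B) → TangentSpace I x, dirDeriv X f p.1 = 0) ∨ ∀ v w, gF p.2 v w = 0 := by
  rw [mem_regularSet_iff (isAlmostProduct_warped hB hF hf),
    finrank_radical_warped_of_eq hB hB' hF hf h] at hp
  refine or_iff_not_imp_right.2 fun h0 X => ?_
  have h1 : ContinuousAt (fun x : B => (x, p.2)) p.1 := by fun_prop
  have h2 : f =ᶠ[𝓝 p.1] 0 := by
    filter_upwards [h1.eventually hp] with x hx
    by_contra hfx
    rw [finrank_radical_warped_of_ne hB hB' hF hf (p := (x, p.2)) hfx] at hx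
    have fin : FiniteDimensional ℝ (TangentSpace I' p.2) :=
      inferInstanceAs (FiniteDimensional ℝ E')
    have h3 := Submodule.eq_top_of_finrank_eq (K := ℝ) (V := TangentSpace I' p.2)
      (S := (quadForm gF p.2).radical) hx
    exact h0 fun v => (mem_radical_quadForm hF _ _).1 (h3 ▸ Submodule.mem_top)
  rw [dirDeriv_congr rfl h2, dirDeriv_zero]

end RegularSet

end WarpedLowerDeriv

theorem IsAlmostProduct.apply_left {E : Type*} [NormedAddCommGroup E] [NormedSpace ℝ E]
    {H : Type*} [TopologicalSpace H] {I : ModelWithCorners ℝ E H}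
    {M : Type*} [TopologicalSpace M] [ChartedSpace H M] [IsManifold I ∞ M]
    {g : (x : M) → TangentSpace I x →L[ℝ] TangentSpace I x →L[ℝ] ℝ}
    {J : (x : M) → TangentSpace I x →L[ℝ] TangentSpace I x} (hg : IsAlmostProduct g J) (x : M)
    (v w : TangentSpace I x) : g x (J x v) w = g x v (J x w) := by
  rw [← hg.isometry, hg.involutive]

section WarpedContraction

variable {E : Type*} [NormedAddCommGroup E] [NormedSpace ℝ E] [FiniteDimensional ℝ E]
  {H : Type*} [TopologicalSpace H] {I : ModelWithCorners ℝ E H} [I.Boundaryless]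
  {B : Type*} [TopologicalSpace B] [ChartedSpace H B] [IsManifold I ∞ B] [T2Space B]
  {E' : Type*} [NormedAddCommGroup E'] [NormedSpace ℝ E'] [FiniteDimensional ℝ E']
  {H' : Type*} [TopologicalSpace H'] {I' : ModelWithCorners ℝ E' H'} [I'.Boundaryless]
  {F : Type*} [TopologicalSpace F] [ChartedSpace H' F] [IsManifold I' ∞ F] [T2Space F]
  {X Y Z T : (x : B) → TangentSpace I x} {U V W Q : (y : F) → TangentSpace I' y}
  {gB : (x : B) → TangentSpace I x →L[ℝ] TangentSpace I x →L[ℝ] ℝ}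
  {J₁ : (x : B) → TangentSpace I x →L[ℝ] TangentSpace I x}
  {gF : (y : F) → TangentSpace I' y →L[ℝ] TangentSpace I' y →L[ℝ] ℝ}
  {J₂ : (y : F) → TangentSpace I' y →L[ℝ] TangentSpace I' y}
  {f : B → ℝ} {p : B × F}
  {α τ : ((p : B × F) → TangentSpace (I.prod I') p) → B × F → ℝ}

/-- The value of `α` at `p` is the covector `g((u₁, u₂), ·)` of the warped product metric. -/
def WarpedRepresents (gB : (x : B) → TangentSpace I x →L[ℝ] TangentSpace I x →L[ℝ] ℝ)
    (gF : (y : F) → TangentSpace I' y →L[ℝ] TangentSpace I' y →L[ℝ] ℝ) (f : B → ℝ)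
    (α : ((p : B × F) → TangentSpace (I.prod I') p) → B × F → ℝ) (p : B × F)
    (u₁ : TangentSpace I p.1) (u₂ : TangentSpace I' p.2) : Prop :=
  Represents (warpedMetric gB gF f) α p ((u₁, u₂) : TangentSpace I p.1 × TangentSpace I' p.2)

theorem IsTensorialAt.warpedRepresents (hα : IsTensorialAt p fun A => α A p)
    {u₁ : TangentSpace I p.1} {u₂ : TangentSpace I' p.2}
    (base : ∀ X : (x : B) → TangentSpace I x, IsSmoothField X →
      α (liftBase I' F X) p = gB p.1 u₁ (X p.1))
    (fiber : ∀ W : (y : F) → TangentSpace I' y, IsSmoothField W →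
      α (liftFiber I B W) p = f p.1 ^ 2 * gF p.2 u₂ (W p.2)) :
    WarpedRepresents gB gF f α p u₁ u₂ := by
  intro A hA
  refine productField_induction (p := p) (P := fun A => α A p = warpedMetric gB gF f p
    ((u₁, u₂) : TangentSpace I p.1 × TangentSpace I' p.2) (A p)) ?_ ?_ ?_ ?_ ?_ hA
  · intro A A' hA hA' h h1
    rw [← hα.congr A A' hA hA' h, ← h.self_of_nhds, h1]
  · intro A A' hA hA' h h'
    rw [hα.add A A' hA hA', h, h', Pi.add_apply, map_add]
  · intro h A hh hA h1
    rw [hα.smul h A hh hA, h1, Pi.smul_apply', map_smul, smul_eq_mul]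
  · intro X hX
    refine (base X hX).trans (Eq.trans ?_ (warpedMetric_apply p _ _).symm)
    change _ = gB p.1 u₁ (X p.1) + f p.1 ^ 2 * gF p.2 u₂ 0
    rw [map_zero, mul_zero, add_zero]
  · intro W hW
    refine (fiber W hW).trans (Eq.trans ?_ (warpedMetric_apply p _ _).symm)
    change _ = gB p.1 u₁ 0 + f p.1 ^ 2 * gF p.2 u₂ (W p.2)
    rw [map_zero, zero_add]

/-- If the fiber component of a tensorial form on a warped product is `f g_F(w, ·)`, the form lies
in the image of the warped product metric. -/
theorem IsTensorialAt.exists_represents_warped (hB' : IsNondegenerate gB)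
    (hα : IsTensorialAt p fun A => α A p) {w : TangentSpace I' p.2}
    (fiber : ∀ W : (y : F) → TangentSpace I' y, IsSmoothField W →
      α (liftFiber I B W) p = f p.1 * gF p.2 w (W p.2)) :
    ∃ u, Represents (warpedMetric gB gF f) α p u := by
  have h1 : IsTensorialAt p.1 fun X => α (liftBase I' F X) p := by
    refine ⟨fun A A' hA hA' h => hα.congr _ _ hA.liftBase hA'.liftBase ?_, fun A A' hA hA' => ?_,
      fun h A hh hA => ?_⟩
    · filter_upwards [continuous_fst.continuousAt.eventually h] with q hq
      exact Prod.ext hq rfl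
    · rw [← hα.add _ _ hA.liftBase hA'.liftBase]
      congr 1
      funext q
      exact Prod.ext rfl (add_zero (0 : E')).symm
    · rw [← Function.comp_apply (f := h) (g := Prod.fst), ← hα.smul _ _ hh.comp_fst hA.liftBase]
      congr 1
      funext q
      exact Prod.ext rfl (smul_zero (A := E') (h q.1)).symm
  obtain ⟨l, hl⟩ := h1.exists_linearMap
  obtain ⟨u₁, hu₁⟩ := hB'.exists_eq p.1 l
  refine ⟨_, hα.warpedRepresents (u₁ := u₁) (u₂ := (f p.1)⁻¹ • w)
    (fun X hX => (hl X hX).trans (hu₁ _)) fun W hW => ?_⟩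
  rw [fiber W hW, map_smul, smul_apply, smul_eq_mul]
  by_cases h0 : f p.1 = 0
  · simp [h0]
  · field_simp

section

variable (hB : IsAlmostProduct gB J₁) (hF : IsAlmostProduct gF J₂)
  (hf : ContMDiff I 𝓘(ℝ, ℝ) ∞ f)
include hB hF hf

theorem contraction_warped {u₁ v₁ : TangentSpace I p.1} {u₂ v₂ : TangentSpace I' p.2}
    (hu : WarpedRepresents gB gF f α p u₁ u₂) (hv : WarpedRepresents gB gF f τ p v₁ v₂) :
    contraction (warpedMetric gB gF f) α τ p = gB p.1 u₁ v₁ + f p.1 ^ 2 * gF p.2 u₂ v₂ :=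
  (contraction_eq (isAlmostProduct_warped hB hF hf) hu hv).trans (warpedMetric_apply p _ _)

theorem warpedRepresents_base_base (hX : IsSmoothField X) (hY : IsSmoothField Y)
    {u : TangentSpace I p.1} (hu : Represents gB (lowerDeriv gB J₁ X Y) p.1 u) :
    WarpedRepresents gB gF f (lowerDeriv (warpedMetric gB gF f) (productStructure J₁ J₂)
      (liftBase I' F X) (liftBase I' F Y)) p u 0 := by
  refine (isTensorialAt_lowerDeriv (isAlmostProduct_warped hB hF hf) hX.liftBase hY.liftBase
    p).warpedRepresents (fun Z hZ => ?_) fun W hW => ?_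
  · rw [lowerDeriv_base_base_base hB hF hf hX hY hZ, Function.comp_apply, hu Z hZ]
  · rw [lowerDeriv_base_base_fiber hB hF hf hX hY hW]
    simp

theorem warpedRepresents_base_fiber (hX : IsSmoothField X) (hV : IsSmoothField V) (p : B × F) :
    WarpedRepresents gB gF f (lowerDeriv (warpedMetric gB gF f) (productStructure J₁ J₂)
      (liftBase I' F X) (liftFiber I B V)) p 0 ((f p.1)⁻¹ • dirDeriv X f p.1 • V p.2) := by
  refine (isTensorialAt_lowerDeriv (isAlmostProduct_warped hB hF hf) hX.liftBase hV.liftFiber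
    p).warpedRepresents (fun Z hZ => ?_) fun W hW => ?_
  · rw [lowerDeriv_base_fiber_base hB hF hf hX hZ hV]
    simp
  · rw [lowerDeriv_base_fiber_fiber hB hF hf hX hV hW]
    simp only [sepFun, warpDeriv, pairing, Pi.mul_apply, map_smul, smul_apply, smul_eq_mul]
    by_cases h0 : f p.1 = 0
    · simp [h0]
    · field_simp

theorem warpedRepresents_fiber_base (hX : IsSmoothField X) (hV : IsSmoothField V) (p : B × F) :
    WarpedRepresents gB gF f (lowerDeriv (warpedMetric gB gF f) (productStructure J₁ J₂)
      (liftFiber I B V) (liftBase I' F X)) p 0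
        ((f p.1)⁻¹ • (1 / 2 : ℝ) • (dirDeriv X f p.1 • V p.2 +
          dirDeriv (applyField J₁ X) f p.1 • J₂ p.2 (V p.2))) := by
  refine (isTensorialAt_lowerDeriv (isAlmostProduct_warped hB hF hf) hV.liftFiber hX.liftBase
    p).warpedRepresents (fun Z hZ => ?_) fun W hW => ?_
  · rw [lowerDeriv_fiber_base_base hB hF hf hX hZ hV]
    simp
  · rw [lowerDeriv_fiber_base_fiber hB hF hf hX hV hW]
    simp only [sepFun, warpDeriv, pairing, applyField, Pi.mul_apply, Pi.add_apply, map_smul,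
      smul_apply, smul_eq_mul, map_add, add_apply, hF.apply_left]
    by_cases h0 : f p.1 = 0
    · simp [h0]
    · field_simp

theorem warpedRepresents_fiber_fiber (hU : IsSmoothField U) (hV : IsSmoothField V)
    {s : TangentSpace I p.1} {u : TangentSpace I' p.2}
    (hs : Represents gB (differential I f) p.1 s)
    (hu : Represents gF (lowerDeriv gF J₂ U V) p.2 u) :
    WarpedRepresents gB gF f (lowerDeriv (warpedMetric gB gF f) (productStructure J₁ J₂)
      (liftFiber I B U) (liftFiber I B V)) p
        ((-(1 / 2) * f p.1) • (pairing gF U V p.2 • s +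
          pairing gF U (applyField J₂ V) p.2 • J₁ p.1 s)) u := by
  refine (isTensorialAt_lowerDeriv (isAlmostProduct_warped hB hF hf) hU.liftFiber hV.liftFiber
    p).warpedRepresents (fun Z hZ => ?_) fun W hW => ?_
  · have h1 : dirDeriv Z f p.1 = gB p.1 s (Z p.1) := hs Z hZ
    have h2 : dirDeriv (applyField J₁ Z) f p.1 = gB p.1 s (J₁ p.1 (Z p.1)) :=
      hs _ (hB.isSmoothField_applyField hZ)
    rw [lowerDeriv_fiber_fiber_base hB hF hf hZ hU hV]
    simp only [sepFun, warpDeriv, Pi.mul_apply, Pi.add_apply, map_smul, smul_apply, smul_eq_mul,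
      map_add, add_apply, hB.apply_left, h1, h2]
    ring
  · rw [lowerDeriv_fiber_fiber_fiber hB hF hf hU hV hW, ← hu W hW]
    simp only [sepFun, Pi.mul_apply]
    ring

end

section Contraction

variable (hB : IsAlmostProduct gB J₁) (hB' : IsNondegenerate gB) (hF : IsAlmostProduct gF J₂)
  (hf : ContMDiff I 𝓘(ℝ, ℝ) ∞ f)
include hB hB' hF hf

theorem contraction_base_base_base_base (hX : IsSmoothField X) (hY : IsSmoothField Y)
    (hZ : IsSmoothField Z) (hT : IsSmoothField T) (p : B × F) :
    contraction (warpedMetric gB gF f)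
      (lowerDeriv (warpedMetric gB gF f) (productStructure J₁ J₂) (liftBase I' F X)
        (liftBase I' F Y))
      (lowerDeriv (warpedMetric gB gF f) (productStructure J₁ J₂) (liftBase I' F Z)
        (liftBase I' F T)) p =
      (contraction gB (lowerDeriv gB J₁ X Y) (lowerDeriv gB J₁ Z T) ∘ Prod.fst) p := by
  obtain ⟨u, hu⟩ := isRepresentable_of_isNondegenerate hB hB' X Y hX hY p.1
  obtain ⟨v, hv⟩ := isRepresentable_of_isNondegenerate hB hB' Z T hZ hT p.1
  rw [contraction_warped hB hF hf (warpedRepresents_base_base hB hF hf hX hY hu)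
    (warpedRepresents_base_base hB hF hf hZ hT hv), Function.comp_apply, contraction_eq hB hu hv]
  simp

theorem contraction_base_base_base_fiber (hX : IsSmoothField X) (hY : IsSmoothField Y)
    (hZ : IsSmoothField Z) (hV : IsSmoothField V) (p : B × F) :
    contraction (warpedMetric gB gF f)
      (lowerDeriv (warpedMetric gB gF f) (productStructure J₁ J₂) (liftBase I' F X)
        (liftBase I' F Y))
      (lowerDeriv (warpedMetric gB gF f) (productStructure J₁ J₂) (liftBase I' F Z)
        (liftFiber I B V)) p = 0 := by
  obtain ⟨u, hu⟩ := isRepresentable_of_isNondegenerate hB hB' X Y hX hY p.1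
  rw [contraction_warped hB hF hf (warpedRepresents_base_base hB hF hf hX hY hu)
    (warpedRepresents_base_fiber hB hF hf hZ hV p)]
  simp

theorem contraction_base_base_fiber_base (hX : IsSmoothField X) (hY : IsSmoothField Y)
    (hZ : IsSmoothField Z) (hV : IsSmoothField V) (p : B × F) :
    contraction (warpedMetric gB gF f)
      (lowerDeriv (warpedMetric gB gF f) (productStructure J₁ J₂) (liftBase I' F X)
        (liftBase I' F Y))
      (lowerDeriv (warpedMetric gB gF f) (productStructure J₁ J₂) (liftFiber I B V)
        (liftBase I' F Z)) p = 0 := by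
  obtain ⟨u, hu⟩ := isRepresentable_of_isNondegenerate hB hB' X Y hX hY p.1
  rw [contraction_warped hB hF hf (warpedRepresents_base_base hB hF hf hX hY hu)
    (warpedRepresents_fiber_base hB hF hf hZ hV p)]
  simp

omit hB hB' hF hf in
theorem smul_inv_apply {w w' : TangentSpace I' p.2}
    (h : f p.1 = 0 → gF p.2 w w' = 0) :
    f p.1 ^ 2 * gF p.2 ((f p.1)⁻¹ • w) ((f p.1)⁻¹ • w') = gF p.2 w w' := by
  simp only [map_smul, smul_apply, smul_eq_mul]
  by_cases h0 : f p.1 = 0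
  · simp [h0, h h0]
  · field_simp

theorem contraction_base_fiber_base_fiber (hX : IsSmoothField X) (hY : IsSmoothField Y)
    (hV : IsSmoothField V) (hW : IsSmoothField W) {p : B × F}
    (hp : p ∈ regularSet (warpedMetric gB gF f)) :
    contraction (warpedMetric gB gF f)
      (lowerDeriv (warpedMetric gB gF f) (productStructure J₁ J₂) (liftBase I' F X)
        (liftFiber I B V))
      (lowerDeriv (warpedMetric gB gF f) (productStructure J₁ J₂) (liftBase I' F Y)
        (liftFiber I B W)) p =
      sepFun (dirDeriv X f * dirDeriv Y f) (pairing gF V W) p := by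
  rw [contraction_warped hB hF hf (warpedRepresents_base_fiber hB hF hf hX hV p)
    (warpedRepresents_base_fiber hB hF hf hY hW p), smul_inv_apply]
  · simp only [sepFun, pairing, Pi.mul_apply, map_zero, map_smul, smul_apply, smul_eq_mul]
    ring
  · intro h0
    rcases dirDeriv_eq_zero_or_of_mem_regularSet hB hB' hF hf hp h0 with h | h
    · simp [h]
    · exact h _ _

theorem contraction_base_fiber_fiber_base (hX : IsSmoothField X) (hY : IsSmoothField Y)
    (hV : IsSmoothField V) (hW : IsSmoothField W) {p : B × F}
    (hp : p ∈ regularSet (warpedMetric gB gF f)) :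
    contraction (warpedMetric gB gF f)
      (lowerDeriv (warpedMetric gB gF f) (productStructure J₁ J₂) (liftBase I' F X)
        (liftFiber I B V))
      (lowerDeriv (warpedMetric gB gF f) (productStructure J₁ J₂) (liftFiber I B W)
        (liftBase I' F Y)) p =
      (sepFun (fun b => 1 / 2 * (dirDeriv X f * dirDeriv Y f) b) (pairing gF V W) +
        sepFun (fun b => 1 / 2 * (dirDeriv X f * dirDeriv (applyField J₁ Y) f) b)
          (pairing gF V (applyField J₂ W))) p := by
  rw [contraction_warped hB hF hf (warpedRepresents_base_fiber hB hF hf hX hV p)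
    (warpedRepresents_fiber_base hB hF hf hY hW p), smul_inv_apply]
  · simp only [sepFun, pairing, applyField, Pi.mul_apply, Pi.add_apply, map_zero, map_smul,
      smul_apply, smul_eq_mul, map_add]
    ring
  · intro h0
    rcases dirDeriv_eq_zero_or_of_mem_regularSet hB hB' hF hf hp h0 with h | h
    · simp [h]
    · exact h _ _

theorem contraction_fiber_base_fiber_base (hX : IsSmoothField X) (hY : IsSmoothField Y)
    (hV : IsSmoothField V) (hW : IsSmoothField W) {p : B × F}
    (hp : p ∈ regularSet (warpedMetric gB gF f)) :
    contraction (warpedMetric gB gF f)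
      (lowerDeriv (warpedMetric gB gF f) (productStructure J₁ J₂) (liftFiber I B V)
        (liftBase I' F X))
      (lowerDeriv (warpedMetric gB gF f) (productStructure J₁ J₂) (liftFiber I B W)
        (liftBase I' F Y)) p =
      (sepFun (fun b => 1 / 4 * (dirDeriv X f * dirDeriv Y f +
          dirDeriv (applyField J₁ X) f * dirDeriv (applyField J₁ Y) f) b) (pairing gF V W) +
        sepFun (fun b => 1 / 4 * (dirDeriv X f * dirDeriv (applyField J₁ Y) f +
          dirDeriv (applyField J₁ X) f * dirDeriv Y f) b) (pairing gF V (applyField J₂ W))) p := by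
  rw [contraction_warped hB hF hf (warpedRepresents_fiber_base hB hF hf hX hV p)
    (warpedRepresents_fiber_base hB hF hf hY hW p), smul_inv_apply]
  · simp only [sepFun, pairing, applyField, Pi.mul_apply, Pi.add_apply, map_zero, map_smul,
      smul_apply, smul_eq_mul, map_add, add_apply, hF.apply_left, hF.involutive]
    ring
  · intro h0
    rcases dirDeriv_eq_zero_or_of_mem_regularSet hB hB' hF hf hp h0 with h | h
    · simp [h]
    · exact h _ _

theorem contraction_base_base_fiber_fiber (hr : IsRepresentable gF J₂) (hX : IsSmoothField X)
    (hY : IsSmoothField Y) (hU : IsSmoothField U) (hV : IsSmoothField V) (p : B × F) :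
    contraction (warpedMetric gB gF f)
      (lowerDeriv (warpedMetric gB gF f) (productStructure J₁ J₂) (liftBase I' F X)
        (liftBase I' F Y))
      (lowerDeriv (warpedMetric gB gF f) (productStructure J₁ J₂) (liftFiber I B U)
        (liftFiber I B V)) p =
      (sepFun (fun b => -(1 / 2) *
          (f * contraction gB (lowerDeriv gB J₁ X Y) (differential I f)) b) (pairing gF U V) +
        sepFun (fun b => -(1 / 2) *
          (f * contraction gB (lowerDeriv gB J₁ X Y) (formComp (differential I f) J₁)) b)
          (pairing gF U (applyField J₂ V))) p := by
  obtain ⟨u, hu⟩ := isRepresentable_of_isNondegenerate hB hB' X Y hX hY p.1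
  obtain ⟨s, hs⟩ := (isAnnihilatorForm_differential hB' hf).2 p.1
  obtain ⟨v, hv⟩ := hr U V hU hV p.2
  rw [contraction_warped hB hF hf (warpedRepresents_base_base hB hF hf hX hY hu)
    (warpedRepresents_fiber_fiber hB hF hf hU hV hs hv)]
  simp only [sepFun, Pi.mul_apply, Pi.add_apply, map_zero, map_smul, smul_eq_mul, map_add,
    zero_apply, contraction_eq hB hu hs, contraction_eq hB hu (hs.formComp hB)]
  ring

theorem contraction_base_fiber_fiber_fiber (hr : IsRepresentable gF J₂) (hX : IsSmoothField X)
    (hV : IsSmoothField V) (hU : IsSmoothField U) (hW : IsSmoothField W) (p : B × F) :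
    contraction (warpedMetric gB gF f)
      (lowerDeriv (warpedMetric gB gF f) (productStructure J₁ J₂) (liftBase I' F X)
        (liftFiber I B V))
      (lowerDeriv (warpedMetric gB gF f) (productStructure J₁ J₂) (liftFiber I B U)
        (liftFiber I B W)) p =
      sepFun (warpDeriv 1 f X) (lowerDeriv gF J₂ U W V) p := by
  obtain ⟨s, hs⟩ := (isAnnihilatorForm_differential hB' hf).2 p.1
  obtain ⟨v, hv⟩ := hr U W hU hW p.2
  rw [contraction_warped hB hF hf (warpedRepresents_base_fiber hB hF hf hX hV p)
    (warpedRepresents_fiber_fiber hB hF hf hU hW hs hv)]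
  simp only [sepFun, warpDeriv, Pi.mul_apply, map_zero, map_smul, smul_apply, smul_eq_mul,
    zero_apply, hv V hV, hF.symm p.2 v]
  by_cases h0 : f p.1 = 0
  · simp [h0]
  · field_simp
    ring

theorem contraction_fiber_base_fiber_fiber (hr : IsRepresentable gF J₂) (hX : IsSmoothField X)
    (hV : IsSmoothField V) (hU : IsSmoothField U) (hW : IsSmoothField W) (p : B × F) :
    contraction (warpedMetric gB gF f)
      (lowerDeriv (warpedMetric gB gF f) (productStructure J₁ J₂) (liftFiber I B V)
        (liftBase I' F X))
      (lowerDeriv (warpedMetric gB gF f) (productStructure J₁ J₂) (liftFiber I B U)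
        (liftFiber I B W)) p =
      (sepFun (warpDeriv (1 / 2) f X) (lowerDeriv gF J₂ U W V) +
        sepFun (warpDeriv (1 / 2) f (applyField J₁ X))
          (lowerDeriv gF J₂ U W (applyField J₂ V))) p := by
  obtain ⟨s, hs⟩ := (isAnnihilatorForm_differential hB' hf).2 p.1
  obtain ⟨v, hv⟩ := hr U W hU hW p.2
  rw [contraction_warped hB hF hf (warpedRepresents_fiber_base hB hF hf hX hV p)
    (warpedRepresents_fiber_fiber hB hF hf hU hW hs hv)]
  have h1 : lowerDeriv gF J₂ U W (applyField J₂ V) p.2 = gF p.2 v (J₂ p.2 (V p.2)) :=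
    hv _ (hF.isSmoothField_applyField hV)
  simp only [sepFun, warpDeriv, Pi.mul_apply, Pi.add_apply, map_zero, map_smul, smul_apply,
    smul_eq_mul, map_add, add_apply, zero_apply, hv V hV, h1, hF.symm p.2 v]
  by_cases h0 : f p.1 = 0
  · simp [h0]
  · field_simp
    ring

theorem contraction_fiber_fiber_fiber_fiber (hr : IsRepresentable gF J₂) (hU : IsSmoothField U)
    (hV : IsSmoothField V) (hW : IsSmoothField W) (hQ : IsSmoothField Q) {p : B × F}
    (hp : p ∈ regularSet (warpedMetric gB gF f)) :
    contraction (warpedMetric gB gF f)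
      (lowerDeriv (warpedMetric gB gF f) (productStructure J₁ J₂) (liftFiber I B U)
        (liftFiber I B V))
      (lowerDeriv (warpedMetric gB gF f) (productStructure J₁ J₂) (liftFiber I B W)
        (liftFiber I B Q)) p =
      (sepFun (fun b => 1 / 4 * (f * f * contraction gB (differential I f) (differential I f)) b)
          (pairing gF U V * pairing gF W Q) +
        sepFun (fun b => 1 / 4 *
            (f * f * contraction gB (formComp (differential I f) J₁) (differential I f)) b)
          (pairing gF U (applyField J₂ V) * pairing gF W Q +
            pairing gF U V * pairing gF W (applyField J₂ Q)) +
        sepFun (fun b => 1 / 4 * (f * f * contraction gB (formComp (differential I f) J₁)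
            (formComp (differential I f) J₁)) b)
          (pairing gF U (applyField J₂ V) * pairing gF W (applyField J₂ Q)) +
        sepFun (f * f) (dirDeriv U (lowerDeriv gF J₂ W Q V) -
          covDeriv gF J₂ U (lowerDeriv gF J₂ W Q) V)) p := by
  obtain ⟨s, hs⟩ := (isAnnihilatorForm_differential hB' hf).2 p.1
  obtain ⟨u, hu⟩ := hr U V hU hV p.2
  obtain ⟨v, hv⟩ := hr W Q hW hQ p.2
  rw [contraction_warped hB hF hf (warpedRepresents_fiber_fiber hB hF hf hU hV hs hu)
    (warpedRepresents_fiber_fiber hB hF hf hW hQ hs hv)]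
  have h1 : f p.1 ^ 2 * gF p.2 u v = f p.1 ^ 2 * (dirDeriv U (lowerDeriv gF J₂ W Q V) p.2 -
      covDeriv gF J₂ U (lowerDeriv gF J₂ W Q) V p.2) := by
    by_cases h0 : f p.1 = 0
    · simp [h0]
    · rw [covDeriv_of_mem (snd_mem_regularSet hB hB' hF hf hp h0), contraction_eq hF hu hv]
      ring
  simp only [sepFun, Pi.mul_apply, Pi.add_apply, Pi.sub_apply, map_smul, smul_apply, smul_eq_mul,
    map_add, add_apply, contraction_eq hB hs hs, contraction_eq hB (hs.formComp hB) hs,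
    contraction_eq hB (hs.formComp hB) (hs.formComp hB), hB.symm p.1 s (J₁ p.1 s)]
  linear_combination h1

end Contraction

end WarpedContraction

section WarpedSmoothContraction

variable {E : Type*} [NormedAddCommGroup E] [NormedSpace ℝ E] [FiniteDimensional ℝ E]
  {H : Type*} [TopologicalSpace H] {I : ModelWithCorners ℝ E H} [I.Boundaryless]
  {B : Type*} [TopologicalSpace B] [ChartedSpace H B] [IsManifold I ∞ B] [T2Space B]
  {E' : Type*} [NormedAddCommGroup E'] [NormedSpace ℝ E'] [FiniteDimensional ℝ E']
  {H' : Type*} [TopologicalSpace H'] {I' : ModelWithCorners ℝ E' H'} [I'.Boundaryless]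
  {F : Type*} [TopologicalSpace F] [ChartedSpace H' F] [IsManifold I' ∞ F] [T2Space F]
  {X Y Z T : (x : B) → TangentSpace I x} {U V W Q : (y : F) → TangentSpace I' y}
  {gB : (x : B) → TangentSpace I x →L[ℝ] TangentSpace I x →L[ℝ] ℝ}
  {J₁ : (x : B) → TangentSpace I x →L[ℝ] TangentSpace I x}
  {gF : (y : F) → TangentSpace I' y →L[ℝ] TangentSpace I' y →L[ℝ] ℝ}
  {J₂ : (y : F) → TangentSpace I' y →L[ℝ] TangentSpace I' y}
  {f : B → ℝ} {p : B × F}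
  {g : (p : B × F) → TangentSpace (I.prod I') p →L[ℝ] TangentSpace (I.prod I') p →L[ℝ] ℝ}
  {J : (p : B × F) → TangentSpace (I.prod I') p →L[ℝ] TangentSpace (I.prod I') p}
  {α : ((p : B × F) → TangentSpace (I.prod I') p) → B × F → ℝ}

/-- An induction principle for relations between two smooth vector fields on a product. -/
theorem productField_induction₂ {p : B × F}
    {P : ((p : B × F) → TangentSpace (I.prod I') p) →
      ((p : B × F) → TangentSpace (I.prod I') p) → Prop}
    (congr : ∀ A A' C C', IsSmoothField A → IsSmoothField A' → IsSmoothField C →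
      IsSmoothField C' → A =ᶠ[𝓝 p] A' → C =ᶠ[𝓝 p] C' → P A C → P A' C')
    (add_left : ∀ A A' C, IsSmoothField A → IsSmoothField A' → IsSmoothField C → P A C → P A' C →
      P (A + A') C)
    (smul_left : ∀ (h : B × F → ℝ) A C, ContMDiff (I.prod I') 𝓘(ℝ, ℝ) ∞ h → IsSmoothField A →
      IsSmoothField C → P A C → P (h • A) C)
    (add_right : ∀ A C C', IsSmoothField A → IsSmoothField C → IsSmoothField C' → P A C → P A C' →
      P A (C + C'))
    (smul_right : ∀ (h : B × F → ℝ) A C, ContMDiff (I.prod I') 𝓘(ℝ, ℝ) ∞ h → IsSmoothField A →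
      IsSmoothField C → P A C → P A (h • C))
    (base_base : ∀ X Y : (x : B) → TangentSpace I x, IsSmoothField X → IsSmoothField Y →
      P (liftBase I' F X) (liftBase I' F Y))
    (base_fiber : ∀ (X : (x : B) → TangentSpace I x) (V : (y : F) → TangentSpace I' y),
      IsSmoothField X → IsSmoothField V → P (liftBase I' F X) (liftFiber I B V))
    (fiber_base : ∀ (X : (x : B) → TangentSpace I x) (V : (y : F) → TangentSpace I' y),
      IsSmoothField X → IsSmoothField V → P (liftFiber I B V) (liftBase I' F X))
    (fiber_fiber : ∀ U V : (y : F) → TangentSpace I' y, IsSmoothField U → IsSmoothField V →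
      P (liftFiber I B U) (liftFiber I B V))
    {A C : (p : B × F) → TangentSpace (I.prod I') p} (hA : IsSmoothField A)
    (hC : IsSmoothField C) : P A C := by
  refine productField_induction (p := p) (P := fun A => P A C)
    (fun A A' hA hA' h => congr _ _ _ _ hA hA' hC hC h (.refl _ _))
    (fun A A' hA hA' => add_left _ _ _ hA hA' hC)
    (fun h A hh hA => smul_left _ _ _ hh hA hC) (fun X hX => ?_) (fun V hV => ?_) hA
  · exact productField_induction (p := p) (P := fun C => P (liftBase I' F X) C)
      (fun C C' hC hC' h => congr _ _ _ _ hX.liftBase hX.liftBase hC hC' (.refl _ _) h)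
      (fun C C' hC hC' => add_right _ _ _ hX.liftBase hC hC')
      (fun h C hh hC => smul_right _ _ _ hh hX.liftBase hC) (fun Y hY => base_base X Y hX hY)
      (fun V hV => base_fiber X V hX hV) hC
  · exact productField_induction (p := p) (P := fun C => P (liftFiber I B V) C)
      (fun C C' hC hC' h => congr _ _ _ _ hV.liftFiber hV.liftFiber hC hC' (.refl _ _) h)
      (fun C C' hC hC' => add_right _ _ _ hV.liftFiber hC hC')
      (fun h C hh hC => smul_right _ _ _ hh hV.liftFiber hC) (fun X hX => fiber_base X V hX hV)
      (fun W hW => fiber_fiber V W hV hW) hC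

theorem isRepresentable_warped (hB : IsAlmostProduct gB J₁) (hB' : IsNondegenerate gB)
    (hF : IsAlmostProduct gF J₂) (hr : IsRepresentable gF J₂) (hf : ContMDiff I 𝓘(ℝ, ℝ) ∞ f) :
    IsRepresentable (warpedMetric gB gF f) (productStructure J₁ J₂) := by
  intro A C hA hC p
  have hg := isAlmostProduct_warped hB hF hf
  refine productField_induction₂ (p := p)
    (P := fun A C => ∃ u, Represents (warpedMetric gB gF f)
      (lowerDeriv (warpedMetric gB gF f) (productStructure J₁ J₂) A C) p u)
    ?_ ?_ ?_ ?_ ?_ ?_ ?_ ?_ ?_ hA hC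
  · rintro A A' C C' hA hA' hC hC' hAA hCC ⟨u, hu⟩
    exact ⟨u, hu.lowerDeriv_congr hAA hCC⟩
  · rintro A A' C hA hA' hC ⟨u, hu⟩ ⟨u', hu'⟩
    exact ⟨_, hu.lowerDeriv_add_left hg hA hA' hC hu'⟩
  · rintro h A C hh hA hC ⟨u, hu⟩
    exact ⟨_, hu.lowerDeriv_smul_left hg hh hA hC⟩
  · rintro A C C' hA hC hC' ⟨u, hu⟩ ⟨u', hu'⟩
    exact ⟨_, hu.lowerDeriv_add_right hg hA hC hC' hu'⟩
  · rintro h A C hh hA hC ⟨u, hu⟩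
    exact ⟨_, hu.lowerDeriv_smul_right hg hh hA hC⟩
  · intro X Y hX hY
    obtain ⟨u, hu⟩ := isRepresentable_of_isNondegenerate hB hB' X Y hX hY p.1
    exact ⟨_, warpedRepresents_base_base hB hF hf hX hY hu⟩
  · intro X V hX hV
    exact ⟨_, warpedRepresents_base_fiber hB hF hf hX hV p⟩
  · intro X V hX hV
    exact ⟨_, warpedRepresents_fiber_base hB hF hf hX hV p⟩
  · intro U V hU hV
    obtain ⟨s, hs⟩ := (isAnnihilatorForm_differential hB' hf).2 p.1
    obtain ⟨u, hu⟩ := hr U V hU hV p.2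
    exact ⟨_, warpedRepresents_fiber_fiber hB hF hf hU hV hs hu⟩

/-- It suffices to check on lifts that the contractions with a given form extend smoothly. -/
theorem hasSmoothExtension_contraction_of_lifts (hg : IsAlmostProduct g J)
    (hr : IsRepresentable g J) (hα : IsAnnihilatorForm g α)
    (base_base : ∀ X Y : (x : B) → TangentSpace I x, IsSmoothField X → IsSmoothField Y →
      HasSmoothExtension g
        (contraction g (lowerDeriv g J (liftBase I' F X) (liftBase I' F Y)) α) p)
    (base_fiber : ∀ (X : (x : B) → TangentSpace I x) (V : (y : F) → TangentSpace I' y),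
      IsSmoothField X → IsSmoothField V → HasSmoothExtension g
        (contraction g (lowerDeriv g J (liftBase I' F X) (liftFiber I B V)) α) p)
    (fiber_base : ∀ (X : (x : B) → TangentSpace I x) (V : (y : F) → TangentSpace I' y),
      IsSmoothField X → IsSmoothField V → HasSmoothExtension g
        (contraction g (lowerDeriv g J (liftFiber I B V) (liftBase I' F X)) α) p)
    (fiber_fiber : ∀ U V : (y : F) → TangentSpace I' y, IsSmoothField U → IsSmoothField V →
      HasSmoothExtension g
        (contraction g (lowerDeriv g J (liftFiber I B U) (liftFiber I B V)) α) p)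
    {A C : (p : B × F) → TangentSpace (I.prod I') p} (hA : IsSmoothField A)
    (hC : IsSmoothField C) :
    HasSmoothExtension g (contraction g (lowerDeriv g J A C) α) p := by
  refine productField_induction₂ (p := p)
    (P := fun A C => HasSmoothExtension g (contraction g (lowerDeriv g J A C) α) p)
    ?_ ?_ ?_ ?_ ?_ base_base base_fiber fiber_base fiber_fiber hA hC
  · intro A A' C C' hA hA' hC hC' hAA hCC h
    refine h.of_eventually ?_
    filter_upwards [hAA.eventually_nhds, hCC.eventually_nhds] with q h1 h2
    exact (contraction_congr hg h1 h2).symm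
  · intro A A' C hA hA' hC h h'
    exact (h.add h').of_eventually (.of_forall fun q =>
      contraction_add_left hg hr hA hA' hC (hα.2 q))
  · intro h A C hh hA hC h1
    exact ((HasSmoothExtension.of_contMDiff hh).mul h1).of_eventually (.of_forall fun q =>
      contraction_smul_left hg hr hh hA hC (hα.2 q))
  · intro A C C' hA hC hC' h h'
    exact (h.add h').of_eventually (.of_forall fun q =>
      contraction_add_right hg hr hA hC hC' (hα.2 q))
  · intro h A C hh hA hC h1
    exact (((HasSmoothExtension.of_contMDiff hh).mul h1).add (.of_contMDiff
      ((hA.contMDiff_dirDeriv hh).mul (hα.1 C hC)))).of_eventually (.of_forall fun q =>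
        contraction_smul_right hg hr hh hA hC (hα.2 q))

theorem IsSemiRegular.isRepresentable (hF : IsSemiRegular gF J₂) : IsRepresentable gF J₂ :=
  fun U V hU hV => (hF.lowerDeriv_mem U V hU hV).2

section Smooth

variable (hB : IsAlmostProduct gB J₁) (hB' : IsNondegenerate gB) (hF : IsSemiRegular gF J₂)
  (hf : ContMDiff I 𝓘(ℝ, ℝ) ∞ f)
include hB hB' hF hf

theorem contMDiff_contraction_lowerDeriv (hX : IsSmoothField X) (hY : IsSmoothField Y)
    (hZ : IsSmoothField Z) (hT : IsSmoothField T) :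
    ContMDiff I 𝓘(ℝ, ℝ) ∞ (contraction gB (lowerDeriv gB J₁ X Y) (lowerDeriv gB J₁ Z T)) :=
  have hr := isRepresentable_of_isNondegenerate hB hB'
  contMDiff_contraction hB hB' (isAnnihilatorForm_lowerDeriv hB hr hX hY)
    (isAnnihilatorForm_lowerDeriv hB hr hZ hT)

theorem contMDiff_contraction_base_base_fiber_fiber (hX : IsSmoothField X) (hY : IsSmoothField Y)
    (hU : IsSmoothField U) (hV : IsSmoothField V) :
    ContMDiff (I.prod I') 𝓘(ℝ, ℝ) ∞ (sepFun (fun b => -(1 / 2) *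
          (f * contraction gB (lowerDeriv gB J₁ X Y) (differential I f)) b) (pairing gF U V) +
        sepFun (fun b => -(1 / 2) *
          (f * contraction gB (lowerDeriv gB J₁ X Y) (formComp (differential I f) J₁)) b)
          (pairing gF U (applyField J₂ V))) := by
  have hF₀ := hF.isAlmostProduct
  have h1 := isAnnihilatorForm_lowerDeriv hB (isRepresentable_of_isNondegenerate hB hB') hX hY
  have h2 := isAnnihilatorForm_differential hB' hf
  exact (contMDiff_sepFun (contMDiff_const.mul (hf.mul (contMDiff_contraction hB hB' h1 h2)))
      (hF₀.contMDiff_pairing hU hV)).add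
    (contMDiff_sepFun (contMDiff_const.mul (hf.mul
      (contMDiff_contraction hB hB' h1 (h2.formComp hB))))
      (hF₀.contMDiff_pairing hU (hF₀.isSmoothField_applyField hV)))

theorem contMDiff_contraction_base_fiber_base_fiber (hX : IsSmoothField X)
    (hY : IsSmoothField Y) (hV : IsSmoothField V) (hW : IsSmoothField W) :
    ContMDiff (I.prod I') 𝓘(ℝ, ℝ) ∞
      (sepFun (dirDeriv X f * dirDeriv Y f) (pairing gF V W)) :=
  contMDiff_sepFun ((hX.contMDiff_dirDeriv hf).mul (hY.contMDiff_dirDeriv hf))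
    (hF.isAlmostProduct.contMDiff_pairing hV hW)

theorem contMDiff_contraction_base_fiber_fiber_base (hX : IsSmoothField X)
    (hY : IsSmoothField Y) (hV : IsSmoothField V) (hW : IsSmoothField W) :
    ContMDiff (I.prod I') 𝓘(ℝ, ℝ) ∞
      (sepFun (fun b => 1 / 2 * (dirDeriv X f * dirDeriv Y f) b) (pairing gF V W) +
        sepFun (fun b => 1 / 2 * (dirDeriv X f * dirDeriv (applyField J₁ Y) f) b)
          (pairing gF V (applyField J₂ W))) := by
  have hF₀ := hF.isAlmostProduct
  exact (contMDiff_sepFun (contMDiff_const.mul ((hX.contMDiff_dirDeriv hf).mul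
      (hY.contMDiff_dirDeriv hf))) (hF₀.contMDiff_pairing hV hW)).add
    (contMDiff_sepFun (contMDiff_const.mul ((hX.contMDiff_dirDeriv hf).mul
      ((hB.isSmoothField_applyField hY).contMDiff_dirDeriv hf)))
      (hF₀.contMDiff_pairing hV (hF₀.isSmoothField_applyField hW)))

theorem contMDiff_contraction_fiber_base_fiber_base (hX : IsSmoothField X)
    (hY : IsSmoothField Y) (hV : IsSmoothField V) (hW : IsSmoothField W) :
    ContMDiff (I.prod I') 𝓘(ℝ, ℝ) ∞ (sepFun (fun b => 1 / 4 * (dirDeriv X f * dirDeriv Y f +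
          dirDeriv (applyField J₁ X) f * dirDeriv (applyField J₁ Y) f) b) (pairing gF V W) +
        sepFun (fun b => 1 / 4 * (dirDeriv X f * dirDeriv (applyField J₁ Y) f +
          dirDeriv (applyField J₁ X) f * dirDeriv Y f) b) (pairing gF V (applyField J₂ W))) := by
  have hF₀ := hF.isAlmostProduct
  have h1 := hX.contMDiff_dirDeriv hf
  have h2 := hY.contMDiff_dirDeriv hf
  have h3 := (hB.isSmoothField_applyField hX).contMDiff_dirDeriv hf
  have h4 := (hB.isSmoothField_applyField hY).contMDiff_dirDeriv hf
  exact (contMDiff_sepFun (contMDiff_const.mul ((h1.mul h2).add (h3.mul h4)))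
      (hF₀.contMDiff_pairing hV hW)).add
    (contMDiff_sepFun (contMDiff_const.mul ((h1.mul h4).add (h3.mul h2)))
      (hF₀.contMDiff_pairing hV (hF₀.isSmoothField_applyField hW)))

theorem contMDiff_contraction_base_fiber_fiber_fiber (hX : IsSmoothField X)
    (hV : IsSmoothField V) (hU : IsSmoothField U) (hW : IsSmoothField W) :
    ContMDiff (I.prod I') 𝓘(ℝ, ℝ) ∞
      (sepFun (warpDeriv 1 f X) (lowerDeriv gF J₂ U W V)) :=
  contMDiff_sepFun (contMDiff_warpDeriv _ hf hX)
    (contMDiff_lowerDeriv hF.isAlmostProduct hU hW hV)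

theorem contMDiff_contraction_fiber_base_fiber_fiber (hX : IsSmoothField X)
    (hV : IsSmoothField V) (hU : IsSmoothField U) (hW : IsSmoothField W) :
    ContMDiff (I.prod I') 𝓘(ℝ, ℝ) ∞
      (sepFun (warpDeriv (1 / 2) f X) (lowerDeriv gF J₂ U W V) +
        sepFun (warpDeriv (1 / 2) f (applyField J₁ X))
          (lowerDeriv gF J₂ U W (applyField J₂ V))) := by
  have hF₀ := hF.isAlmostProduct
  exact (contMDiff_sepFun (contMDiff_warpDeriv _ hf hX) (contMDiff_lowerDeriv hF₀ hU hW hV)).add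
    (contMDiff_sepFun (contMDiff_warpDeriv _ hf (hB.isSmoothField_applyField hX))
      (contMDiff_lowerDeriv hF₀ hU hW (hF₀.isSmoothField_applyField hV)))

theorem contMDiff_contraction_fiber_fiber_fiber_fiber (hU : IsSmoothField U)
    (hV : IsSmoothField V) (hW : IsSmoothField W) (hQ : IsSmoothField Q) :
    ContMDiff (I.prod I') 𝓘(ℝ, ℝ) ∞
      (sepFun (fun b => 1 / 4 * (f * f * contraction gB (differential I f) (differential I f)) b)
          (pairing gF U V * pairing gF W Q) +
        sepFun (fun b => 1 / 4 *
            (f * f * contraction gB (formComp (differential I f) J₁) (differential I f)) b)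
          (pairing gF U (applyField J₂ V) * pairing gF W Q +
            pairing gF U V * pairing gF W (applyField J₂ Q)) +
        sepFun (fun b => 1 / 4 * (f * f * contraction gB (formComp (differential I f) J₁)
            (formComp (differential I f) J₁)) b)
          (pairing gF U (applyField J₂ V) * pairing gF W (applyField J₂ Q)) +
        sepFun (f * f) (dirDeriv U (lowerDeriv gF J₂ W Q V) -
          covDeriv gF J₂ U (lowerDeriv gF J₂ W Q) V)) := by
  have hF₀ := hF.isAlmostProduct
  have h1 := isAnnihilatorForm_differential hB' hf
  have h2 := h1.formComp hB
  have hff := hf.mul hf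
  have k1 := hF₀.contMDiff_pairing hU hV
  have k2 := hF₀.contMDiff_pairing hW hQ
  have k3 := hF₀.contMDiff_pairing hU (hF₀.isSmoothField_applyField hV)
  have k4 := hF₀.contMDiff_pairing hW (hF₀.isSmoothField_applyField hQ)
  have k5 : ContMDiff I' 𝓘(ℝ, ℝ) ∞ (lowerDeriv gF J₂ W Q V) := contMDiff_lowerDeriv hF₀ hW hQ hV
  have k6 := (hF.covDeriv_mem W Q U hW hQ hU).1 V hV
  exact (((contMDiff_sepFun (contMDiff_const.mul (hff.mul (contMDiff_contraction hB hB' h1 h1)))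
        (k1.mul k2)).add
      (contMDiff_sepFun (contMDiff_const.mul (hff.mul (contMDiff_contraction hB hB' h2 h1)))
        ((k3.mul k2).add (k1.mul k4)))).add
      (contMDiff_sepFun (contMDiff_const.mul (hff.mul (contMDiff_contraction hB hB' h2 h2)))
        (k3.mul k4))).add
      (contMDiff_sepFun hff ((hU.contMDiff_dirDeriv k5).sub k6))

theorem hasSmoothContractions_warped :
    HasSmoothContractions (warpedMetric gB gF f) (productStructure J₁ J₂) := by
  intro A T C D hA hT hC hD p
  have hF₀ := hF.isAlmostProduct
  have hr := hF.isRepresentable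
  have hg := isAlmostProduct_warped hB hF₀ hf
  have hrg := isRepresentable_warped hB hB' hF₀ hr hf
  have comm : ∀ {α τ : ((p : B × F) → TangentSpace (I.prod I') p) → B × F → ℝ},
      HasSmoothExtension (warpedMetric gB gF f) (contraction (warpedMetric gB gF f) α τ) p →
      HasSmoothExtension (warpedMetric gB gF f) (contraction (warpedMetric gB gF f) τ α) p :=
    fun {α τ} h => h.of_eventually (.of_forall fun q => contraction_comm hg τ α q)
  have mk : ∀ {c G : B × F → ℝ}, ContMDiff (I.prod I') 𝓘(ℝ, ℝ) ∞ G →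
      (∀ q ∈ regularSet (warpedMetric gB gF f), c q = G q) →
      HasSmoothExtension (warpedMetric gB gF f) c p := fun hG h => ⟨_, hG, .of_forall h⟩
  refine hasSmoothExtension_contraction_of_lifts hg hrg
    (isAnnihilatorForm_lowerDeriv hg hrg hC hD) ?_ ?_ ?_ ?_ hA hT
  · intro X Y hX hY
    refine comm (hasSmoothExtension_contraction_of_lifts hg hrg
      (isAnnihilatorForm_lowerDeriv hg hrg hX.liftBase hY.liftBase) ?_ ?_ ?_ ?_ hC hD)
    · intro Z T hZ hT
      exact mk (contMDiff_contraction_lowerDeriv hB hB' hF hf hZ hT hX hY).comp_fst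
        fun q _ => contraction_base_base_base_base hB hB' hF₀ hf hZ hT hX hY q
    · intro Z V hZ hV
      exact comm (mk (G := 0) contMDiff_const
        fun q _ => contraction_base_base_base_fiber hB hB' hF₀ hf hX hY hZ hV q)
    · intro Z V hZ hV
      exact comm (mk (G := 0) contMDiff_const
        fun q _ => contraction_base_base_fiber_base hB hB' hF₀ hf hX hY hZ hV q)
    · intro U V hU hV
      exact comm (mk (contMDiff_contraction_base_base_fiber_fiber hB hB' hF hf hX hY hU hV)
        fun q _ => contraction_base_base_fiber_fiber hB hB' hF₀ hf hr hX hY hU hV q)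
  · intro X V hX hV
    refine comm (hasSmoothExtension_contraction_of_lifts hg hrg
      (isAnnihilatorForm_lowerDeriv hg hrg hX.liftBase hV.liftFiber) ?_ ?_ ?_ ?_ hC hD)
    · intro Z T hZ hT
      exact mk (G := 0) contMDiff_const
        fun q _ => contraction_base_base_base_fiber hB hB' hF₀ hf hZ hT hX hV q
    · intro Y W hY hW
      exact mk (contMDiff_contraction_base_fiber_base_fiber hB hB' hF hf hY hX hW hV)
        fun q hq => contraction_base_fiber_base_fiber hB hB' hF₀ hf hY hX hW hV hq
    · intro Y W hY hW
      exact comm (mk (contMDiff_contraction_base_fiber_fiber_base hB hB' hF hf hX hY hV hW)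
        fun q hq => contraction_base_fiber_fiber_base hB hB' hF₀ hf hX hY hV hW hq)
    · intro U W hU hW
      exact comm (mk (contMDiff_contraction_base_fiber_fiber_fiber hB hB' hF hf hX hV hU hW)
        fun q _ => contraction_base_fiber_fiber_fiber hB hB' hF₀ hf hr hX hV hU hW q)
  · intro X V hX hV
    refine comm (hasSmoothExtension_contraction_of_lifts hg hrg
      (isAnnihilatorForm_lowerDeriv hg hrg hV.liftFiber hX.liftBase) ?_ ?_ ?_ ?_ hC hD)
    · intro Z T hZ hT
      exact mk (G := 0) contMDiff_const
        fun q _ => contraction_base_base_fiber_base hB hB' hF₀ hf hZ hT hX hV q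
    · intro Y W hY hW
      exact mk (contMDiff_contraction_base_fiber_fiber_base hB hB' hF hf hY hX hW hV)
        fun q hq => contraction_base_fiber_fiber_base hB hB' hF₀ hf hY hX hW hV hq
    · intro Y W hY hW
      exact mk (contMDiff_contraction_fiber_base_fiber_base hB hB' hF hf hY hX hW hV)
        fun q hq => contraction_fiber_base_fiber_base hB hB' hF₀ hf hY hX hW hV hq
    · intro U W hU hW
      exact comm (mk (contMDiff_contraction_fiber_base_fiber_fiber hB hB' hF hf hX hV hU hW)
        fun q _ => contraction_fiber_base_fiber_fiber hB hB' hF₀ hf hr hX hV hU hW q)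
  · intro U V hU hV
    refine comm (hasSmoothExtension_contraction_of_lifts hg hrg
      (isAnnihilatorForm_lowerDeriv hg hrg hU.liftFiber hV.liftFiber) ?_ ?_ ?_ ?_ hC hD)
    · intro X Y hX hY
      exact mk (contMDiff_contraction_base_base_fiber_fiber hB hB' hF hf hX hY hU hV)
        fun q _ => contraction_base_base_fiber_fiber hB hB' hF₀ hf hr hX hY hU hV q
    · intro X W hX hW
      exact mk (contMDiff_contraction_base_fiber_fiber_fiber hB hB' hF hf hX hW hU hV)
        fun q _ => contraction_base_fiber_fiber_fiber hB hB' hF₀ hf hr hX hW hU hV q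
    · intro X W hX hW
      exact mk (contMDiff_contraction_fiber_base_fiber_fiber hB hB' hF hf hX hW hU hV)
        fun q _ => contraction_fiber_base_fiber_fiber hB hB' hF₀ hf hr hX hW hU hV q
    · intro W Q hW hQ
      exact mk (contMDiff_contraction_fiber_fiber_fiber_fiber hB hB' hF hf hW hQ hU hV)
        fun q hq => contraction_fiber_fiber_fiber_fiber hB hB' hF₀ hf hr hW hQ hU hV hq

end Smooth

end WarpedSmoothContraction

section WarpedCovDeriv

variable {E : Type*} [NormedAddCommGroup E] [NormedSpace ℝ E] [FiniteDimensional ℝ E]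
  {H : Type*} [TopologicalSpace H] {I : ModelWithCorners ℝ E H} [I.Boundaryless]
  {B : Type*} [TopologicalSpace B] [ChartedSpace H B] [IsManifold I ∞ B] [T2Space B]
  {E' : Type*} [NormedAddCommGroup E'] [NormedSpace ℝ E'] [FiniteDimensional ℝ E']
  {H' : Type*} [TopologicalSpace H'] {I' : ModelWithCorners ℝ E' H'} [I'.Boundaryless]
  {F : Type*} [TopologicalSpace F] [ChartedSpace H' F] [IsManifold I' ∞ F] [T2Space F]
  {X Y Z T : (x : B) → TangentSpace I x} {U V W Q : (y : F) → TangentSpace I' y}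
  {gB : (x : B) → TangentSpace I x →L[ℝ] TangentSpace I x →L[ℝ] ℝ}
  {J₁ : (x : B) → TangentSpace I x →L[ℝ] TangentSpace I x}
  {gF : (y : F) → TangentSpace I' y →L[ℝ] TangentSpace I' y →L[ℝ] ℝ}
  {J₂ : (y : F) → TangentSpace I' y →L[ℝ] TangentSpace I' y}
  {f : B → ℝ} (hB : IsAlmostProduct gB J₁) (hB' : IsNondegenerate gB) (hF : IsSemiRegular gF J₂)
  (hf : ContMDiff I 𝓘(ℝ, ℝ) ∞ f)
include hB hB' hF hf

theorem covDeriv_base_base_base_base (hX : IsSmoothField X) (hY : IsSmoothField Y)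
    (hZ : IsSmoothField Z) (hT : IsSmoothField T) (p : B × F) :
    covDeriv (warpedMetric gB gF f) (productStructure J₁ J₂) (liftBase I' F X)
      (lowerDeriv (warpedMetric gB gF f) (productStructure J₁ J₂) (liftBase I' F Y)
        (liftBase I' F Z)) (liftBase I' F T) p =
      covDeriv gB J₁ X (lowerDeriv gB J₁ Y Z) T p.1 := by
  have hF₀ := hF.isAlmostProduct
  have hg := isAlmostProduct_warped hB hF₀ hf
  have h1 : ContMDiff I 𝓘(ℝ, ℝ) ∞ (lowerDeriv gB J₁ Y Z T) := contMDiff_lowerDeriv hB hY hZ hT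
  have h2 : p.1 ∈ regularSet gB := regularSet_eq_univ hB hB' ▸ mem_univ _
  rw [covDeriv_eq_sub hg hX.liftBase
    (contMDiff_lowerDeriv hg hY.liftBase hZ.liftBase hT.liftBase)
    ((contMDiff_contraction_lowerDeriv hB hB' hF hf hX hT hY hZ).continuous.comp continuous_fst)
    (fun q _ => contraction_base_base_base_base hB hB' hF₀ hf hX hT hY hZ q),
    lowerDeriv_base_base_base hB hF₀ hf hY hZ hT, dirDeriv_liftBase_comp_fst h1,
    covDeriv_of_mem h2]
  rfl

theorem covDeriv_base_base_base_fiber (hX : IsSmoothField X) (hY : IsSmoothField Y)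
    (hZ : IsSmoothField Z) (hQ : IsSmoothField Q) (p : B × F) :
    covDeriv (warpedMetric gB gF f) (productStructure J₁ J₂) (liftBase I' F X)
      (lowerDeriv (warpedMetric gB gF f) (productStructure J₁ J₂) (liftBase I' F Y)
        (liftBase I' F Z)) (liftFiber I B Q) p = 0 := by
  have hF₀ := hF.isAlmostProduct
  have hg := isAlmostProduct_warped hB hF₀ hf
  rw [covDeriv_eq_sub (G := 0) hg hX.liftBase
    (contMDiff_lowerDeriv hg hY.liftBase hZ.liftBase hQ.liftFiber) continuous_const
    (fun q _ => (contraction_comm hg _ _ q).trans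
      (contraction_base_base_base_fiber hB hB' hF₀ hf hY hZ hX hQ q)),
    lowerDeriv_base_base_fiber hB hF₀ hf hY hZ hQ, dirDeriv_zero]
  simp

theorem covDeriv_base_base_fiber_fiber (hX : IsSmoothField X) (hY : IsSmoothField Y)
    (hV : IsSmoothField V) (hQ : IsSmoothField Q) (p : B × F) :
    covDeriv (warpedMetric gB gF f) (productStructure J₁ J₂) (liftBase I' F X)
      (lowerDeriv (warpedMetric gB gF f) (productStructure J₁ J₂) (liftBase I' F Y)
        (liftFiber I B V)) (liftFiber I B Q) p =
      f p.1 * dirDeriv X (dirDeriv Y f) p.1 * pairing gF V Q p.2 := by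
  have hF₀ := hF.isAlmostProduct
  have hg := isAlmostProduct_warped hB hF₀ hf
  rw [covDeriv_eq_sub hg hX.liftBase
    (contMDiff_lowerDeriv hg hY.liftBase hV.liftFiber hQ.liftFiber)
    (contMDiff_contraction_base_fiber_base_fiber hB hB' hF hf hX hY hQ hV).continuous
    (fun q hq => contraction_base_fiber_base_fiber hB hB' hF₀ hf hX hY hQ hV hq),
    lowerDeriv_base_fiber_fiber hB hF₀ hf hY hV hQ,
    dirDeriv_liftBase_sepFun (contMDiff_warpDeriv _ hf hY) (hF₀.contMDiff_pairing hV hQ),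
    dirDeriv_warpDeriv _ hf hY, pairing_comm hF₀ Q V]
  simp only [sepFun, Pi.mul_apply]
  ring

theorem covDeriv_base_fiber_base_fiber (hX : IsSmoothField X) (hY : IsSmoothField Y)
    (hV : IsSmoothField V) (hQ : IsSmoothField Q) (p : B × F) :
    covDeriv (warpedMetric gB gF f) (productStructure J₁ J₂) (liftBase I' F X)
      (lowerDeriv (warpedMetric gB gF f) (productStructure J₁ J₂) (liftFiber I B V)
        (liftBase I' F Y)) (liftFiber I B Q) p =
      1 / 2 * f p.1 * (dirDeriv X (dirDeriv Y f) p.1 * pairing gF V Q p.2 +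
        dirDeriv X (dirDeriv (applyField J₁ Y) f) p.1 * pairing gF V (applyField J₂ Q) p.2) := by
  have hF₀ := hF.isAlmostProduct
  have hg := isAlmostProduct_warped hB hF₀ hf
  have hJY := hB.isSmoothField_applyField hY
  have hVQ := hF₀.contMDiff_pairing hV hQ
  have hVJQ := hF₀.contMDiff_pairing hV (hF₀.isSmoothField_applyField hQ)
  have hw := contMDiff_warpDeriv (1 / 2) hf hY
  have hw' := contMDiff_warpDeriv (1 / 2) hf hJY
  rw [covDeriv_eq_sub hg hX.liftBase
    (contMDiff_lowerDeriv hg hV.liftFiber hY.liftBase hQ.liftFiber)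
    (contMDiff_contraction_base_fiber_fiber_base hB hB' hF hf hX hY hQ hV).continuous
    (fun q hq => contraction_base_fiber_fiber_base hB hB' hF₀ hf hX hY hQ hV hq),
    lowerDeriv_fiber_base_fiber hB hF₀ hf hY hV hQ,
    dirDeriv_add (contMDiff_sepFun hw hVQ) (contMDiff_sepFun hw' hVJQ),
    dirDeriv_liftBase_sepFun hw hVQ, dirDeriv_liftBase_sepFun hw' hVJQ,
    dirDeriv_warpDeriv _ hf hY, dirDeriv_warpDeriv _ hf hJY, pairing_comm hF₀ Q V,
    pairing_applyField_right hF₀ Q V, pairing_comm hF₀ (applyField J₂ Q) V]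
  simp only [sepFun, Pi.mul_apply, Pi.add_apply]
  ring

theorem covDeriv_base_fiber_fiber_fiber (hX : IsSmoothField X) (hV : IsSmoothField V)
    (hW : IsSmoothField W) (hQ : IsSmoothField Q) (p : B × F) :
    covDeriv (warpedMetric gB gF f) (productStructure J₁ J₂) (liftBase I' F X)
      (lowerDeriv (warpedMetric gB gF f) (productStructure J₁ J₂) (liftFiber I B V)
        (liftFiber I B W)) (liftFiber I B Q) p =
      f p.1 * dirDeriv X f p.1 * lowerDeriv gF J₂ V W Q p.2 := by
  have hF₀ := hF.isAlmostProduct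
  have hg := isAlmostProduct_warped hB hF₀ hf
  rw [covDeriv_eq_sub hg hX.liftBase
    (contMDiff_lowerDeriv hg hV.liftFiber hW.liftFiber hQ.liftFiber)
    (contMDiff_contraction_base_fiber_fiber_fiber hB hB' hF hf hX hQ hV hW).continuous
    (fun q _ => contraction_base_fiber_fiber_fiber hB hB' hF₀ hf hF.isRepresentable hX hQ hV hW q),
    lowerDeriv_fiber_fiber_fiber hB hF₀ hf hV hW hQ,
    dirDeriv_liftBase_sepFun (hf.mul hf) (contMDiff_lowerDeriv hF₀ hV hW hQ),
    dirDeriv_mul hf hf]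
  simp only [sepFun, warpDeriv, Pi.mul_apply]
  ring

theorem covDeriv_fiber_base_base_fiber (hX : IsSmoothField X) (hY : IsSmoothField Y)
    (hU : IsSmoothField U) (hQ : IsSmoothField Q) (p : B × F) :
    covDeriv (warpedMetric gB gF f) (productStructure J₁ J₂) (liftFiber I B U)
      (lowerDeriv (warpedMetric gB gF f) (productStructure J₁ J₂) (liftBase I' F X)
        (liftBase I' F Y)) (liftFiber I B Q) p =
      1 / 2 * f p.1 * (contraction gB (lowerDeriv gB J₁ X Y) (differential I f) p.1 *
          pairing gF U Q p.2 +
        contraction gB (lowerDeriv gB J₁ X Y) (formComp (differential I f) J₁) p.1 *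
          pairing gF U (applyField J₂ Q) p.2) := by
  have hF₀ := hF.isAlmostProduct
  have hg := isAlmostProduct_warped hB hF₀ hf
  rw [covDeriv_eq_sub hg hU.liftFiber
    (contMDiff_lowerDeriv hg hX.liftBase hY.liftBase hQ.liftFiber)
    (contMDiff_contraction_base_base_fiber_fiber hB hB' hF hf hX hY hU hQ).continuous
    (fun q _ => (contraction_comm hg _ _ q).trans
      (contraction_base_base_fiber_fiber hB hB' hF₀ hf hF.isRepresentable hX hY hU hQ q)),
    lowerDeriv_base_base_fiber hB hF₀ hf hX hY hQ, dirDeriv_zero]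
  simp only [sepFun, Pi.mul_apply, Pi.add_apply]
  ring

theorem covDeriv_fiber_base_fiber_fiber (hX : IsSmoothField X) (hU : IsSmoothField U)
    (hV : IsSmoothField V) (hQ : IsSmoothField Q) (p : B × F) :
    covDeriv (warpedMetric gB gF f) (productStructure J₁ J₂) (liftFiber I B U)
      (lowerDeriv (warpedMetric gB gF f) (productStructure J₁ J₂) (liftBase I' F X)
        (liftFiber I B V)) (liftFiber I B Q) p =
      f p.1 * dirDeriv X f p.1 * lowerDeriv gF J₂ U V Q p.2 := by
  have hF₀ := hF.isAlmostProduct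
  have hg := isAlmostProduct_warped hB hF₀ hf
  have h1 : lowerDeriv gF J₂ U V Q p.2 + lowerDeriv gF J₂ U Q V p.2 =
      dirDeriv U (pairing gF V Q) p.2 := apKoszul_add_apKoszul_swap hF₀ U V Q p.2
  rw [covDeriv_eq_sub hg hU.liftFiber
    (contMDiff_lowerDeriv hg hX.liftBase hV.liftFiber hQ.liftFiber)
    (contMDiff_contraction_base_fiber_fiber_fiber hB hB' hF hf hX hV hU hQ).continuous
    (fun q _ => (contraction_comm hg _ _ q).trans
      (contraction_base_fiber_fiber_fiber hB hB' hF₀ hf hF.isRepresentable hX hV hU hQ q)),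
    lowerDeriv_base_fiber_fiber hB hF₀ hf hX hV hQ,
    dirDeriv_liftFiber_sepFun (contMDiff_warpDeriv _ hf hX) (hF₀.contMDiff_pairing hV hQ), ← h1]
  simp only [sepFun, warpDeriv, Pi.mul_apply]
  ring

theorem covDeriv_fiber_fiber_base_fiber (hX : IsSmoothField X) (hU : IsSmoothField U)
    (hV : IsSmoothField V) (hQ : IsSmoothField Q) (p : B × F) :
    covDeriv (warpedMetric gB gF f) (productStructure J₁ J₂) (liftFiber I B U)
      (lowerDeriv (warpedMetric gB gF f) (productStructure J₁ J₂) (liftFiber I B V)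
        (liftBase I' F X)) (liftFiber I B Q) p =
      1 / 2 * f p.1 * (dirDeriv X f p.1 * lowerDeriv gF J₂ U V Q p.2 +
        dirDeriv (applyField J₁ X) f p.1 * lowerDeriv gF J₂ U (applyField J₂ V) Q p.2) := by
  have hF₀ := hF.isAlmostProduct
  have hg := isAlmostProduct_warped hB hF₀ hf
  have hJV := hF₀.isSmoothField_applyField hV
  have h1 : lowerDeriv gF J₂ U V Q p.2 + lowerDeriv gF J₂ U Q V p.2 =
      dirDeriv U (pairing gF V Q) p.2 := apKoszul_add_apKoszul_swap hF₀ U V Q p.2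
  have h2 : lowerDeriv gF J₂ U (applyField J₂ V) Q p.2 + lowerDeriv gF J₂ U Q (applyField J₂ V) p.2 =
      dirDeriv U (pairing gF (applyField J₂ V) Q) p.2 := apKoszul_add_apKoszul_swap hF₀ U _ Q p.2
  have hw := contMDiff_warpDeriv (1 / 2) hf hX
  have hw' := contMDiff_warpDeriv (1 / 2) hf (hB.isSmoothField_applyField hX)
  have hVQ := hF₀.contMDiff_pairing hV hQ
  have hJVQ := hF₀.contMDiff_pairing hJV hQ
  rw [covDeriv_eq_sub hg hU.liftFiber
    (contMDiff_lowerDeriv hg hV.liftFiber hX.liftBase hQ.liftFiber)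
    (contMDiff_contraction_fiber_base_fiber_fiber hB hB' hF hf hX hV hU hQ).continuous
    (fun q _ => (contraction_comm hg _ _ q).trans
      (contraction_fiber_base_fiber_fiber hB hB' hF₀ hf hF.isRepresentable hX hV hU hQ q)),
    lowerDeriv_fiber_base_fiber hB hF₀ hf hX hV hQ, pairing_applyField_right hF₀ V Q,
    dirDeriv_add (contMDiff_sepFun hw hVQ) (contMDiff_sepFun hw' hJVQ),
    dirDeriv_liftFiber_sepFun hw hVQ, dirDeriv_liftFiber_sepFun hw' hJVQ, ← h1, ← h2]
  simp only [sepFun, warpDeriv, Pi.mul_apply, Pi.add_apply]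
  ring

theorem covDeriv_fiber_fiber_fiber_fiber (hU : IsSmoothField U) (hV : IsSmoothField V)
    (hW : IsSmoothField W) (hQ : IsSmoothField Q) (p : B × F) :
    covDeriv (warpedMetric gB gF f) (productStructure J₁ J₂) (liftFiber I B U)
      (lowerDeriv (warpedMetric gB gF f) (productStructure J₁ J₂) (liftFiber I B V)
        (liftFiber I B W)) (liftFiber I B Q) p =
      f p.1 ^ 2 * covDeriv gF J₂ U (lowerDeriv gF J₂ V W) Q p.2 -
        f p.1 ^ 2 / 4 *
        (contraction gB (differential I f) (differential I f) p.1 *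
          (pairing gF U Q p.2 * pairing gF V W p.2) +
        contraction gB (formComp (differential I f) J₁) (differential I f) p.1 *
          (pairing gF U (applyField J₂ Q) p.2 * pairing gF V W p.2 +
            pairing gF U Q p.2 * pairing gF V (applyField J₂ W) p.2) +
        contraction gB (formComp (differential I f) J₁) (formComp (differential I f) J₁) p.1 *
          (pairing gF U (applyField J₂ Q) p.2 * pairing gF V (applyField J₂ W) p.2)) := by
  have hF₀ := hF.isAlmostProduct
  have hg := isAlmostProduct_warped hB hF₀ hf
  rw [covDeriv_eq_sub hg hU.liftFiber
    (contMDiff_lowerDeriv hg hV.liftFiber hW.liftFiber hQ.liftFiber)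
    (contMDiff_contraction_fiber_fiber_fiber_fiber hB hB' hF hf hU hQ hV hW).continuous
    (fun q hq =>
      contraction_fiber_fiber_fiber_fiber hB hB' hF₀ hf hF.isRepresentable hU hQ hV hW hq),
    lowerDeriv_fiber_fiber_fiber hB hF₀ hf hV hW hQ,
    dirDeriv_liftFiber_sepFun (hf.mul hf) (contMDiff_lowerDeriv hF₀ hV hW hQ)]
  simp only [sepFun, Pi.mul_apply, Pi.add_apply, Pi.sub_apply]
  ring

theorem covDeriv_fiber_fiber_base_base (hX : IsSmoothField X) (hY : IsSmoothField Y)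
    (hW : IsSmoothField W) (hQ : IsSmoothField Q) (p : B × F) :
    covDeriv (warpedMetric gB gF f) (productStructure J₁ J₂) (liftFiber I B W)
      (lowerDeriv (warpedMetric gB gF f) (productStructure J₁ J₂) (liftFiber I B Q)
        (liftBase I' F X)) (liftBase I' F Y) p =
      -(1 / 4 * ((dirDeriv X f p.1 * dirDeriv Y f p.1 +
          dirDeriv (applyField J₁ X) f p.1 * dirDeriv (applyField J₁ Y) f p.1) *
            pairing gF W Q p.2 +
        (dirDeriv X f p.1 * dirDeriv (applyField J₁ Y) f p.1 +
          dirDeriv (applyField J₁ X) f p.1 * dirDeriv Y f p.1) *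
            pairing gF W (applyField J₂ Q) p.2)) := by
  have hF₀ := hF.isAlmostProduct
  have hg := isAlmostProduct_warped hB hF₀ hf
  rw [covDeriv_eq_sub hg hW.liftFiber
    (contMDiff_lowerDeriv hg hQ.liftFiber hX.liftBase hY.liftBase)
    (contMDiff_contraction_fiber_base_fiber_base hB hB' hF hf hY hX hW hQ).continuous
    (fun q hq => contraction_fiber_base_fiber_base hB hB' hF₀ hf hY hX hW hQ hq),
    lowerDeriv_fiber_base_base hB hF₀ hf hX hY hQ, dirDeriv_zero]
  simp only [sepFun, Pi.mul_apply, Pi.add_apply]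
  ring

theorem covDeriv_base_fiber_fiber_base (hX : IsSmoothField X) (hT : IsSmoothField T)
    (hV : IsSmoothField V) (hW : IsSmoothField W) (p : B × F) :
    covDeriv (warpedMetric gB gF f) (productStructure J₁ J₂) (liftBase I' F X)
      (lowerDeriv (warpedMetric gB gF f) (productStructure J₁ J₂) (liftFiber I B V)
        (liftFiber I B W)) (liftBase I' F T) p =
      -(1 / 2) * (dirDeriv X f p.1 * dirDeriv T f p.1 + f p.1 * (dirDeriv X (dirDeriv T f) p.1 -
          contraction gB (lowerDeriv gB J₁ X T) (differential I f) p.1)) * pairing gF V W p.2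
      - 1 / 2 * (dirDeriv X f p.1 * dirDeriv (applyField J₁ T) f p.1 +
          f p.1 * (dirDeriv X (dirDeriv (applyField J₁ T) f) p.1 -
            contraction gB (lowerDeriv gB J₁ X T) (formComp (differential I f) J₁) p.1)) *
          pairing gF V (applyField J₂ W) p.2 := by
  have hF₀ := hF.isAlmostProduct
  have hg := isAlmostProduct_warped hB hF₀ hf
  have hJT := hB.isSmoothField_applyField hT
  have hw := contMDiff_warpDeriv (-(1 / 2)) hf hT
  have hw' := contMDiff_warpDeriv (-(1 / 2)) hf hJT
  have hVW := hF₀.contMDiff_pairing hV hW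
  have hVJW := hF₀.contMDiff_pairing hV (hF₀.isSmoothField_applyField hW)
  rw [covDeriv_eq_sub hg hX.liftBase
    (contMDiff_lowerDeriv hg hV.liftFiber hW.liftFiber hT.liftBase)
    (contMDiff_contraction_base_base_fiber_fiber hB hB' hF hf hX hT hV hW).continuous
    (fun q _ => contraction_base_base_fiber_fiber hB hB' hF₀ hf hF.isRepresentable hX hT hV hW q),
    lowerDeriv_fiber_fiber_base hB hF₀ hf hT hV hW,
    dirDeriv_add (contMDiff_sepFun hw hVW) (contMDiff_sepFun hw' hVJW),
    dirDeriv_liftBase_sepFun hw hVW, dirDeriv_liftBase_sepFun hw' hVJW,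
    dirDeriv_warpDeriv _ hf hT, dirDeriv_warpDeriv _ hf hJT]
  simp only [sepFun, Pi.mul_apply, Pi.add_apply]
  ring

theorem covDeriv_fiber_base_fiber_base (hX : IsSmoothField X) (hT : IsSmoothField T)
    (hV : IsSmoothField V) (hW : IsSmoothField W) (p : B × F) :
    covDeriv (warpedMetric gB gF f) (productStructure J₁ J₂) (liftFiber I B V)
      (lowerDeriv (warpedMetric gB gF f) (productStructure J₁ J₂) (liftBase I' F X)
        (liftFiber I B W)) (liftBase I' F T) p =
      -(1 / 2) * dirDeriv X f p.1 * (dirDeriv T f p.1 * pairing gF V W p.2 +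
        dirDeriv (applyField J₁ T) f p.1 * pairing gF V (applyField J₂ W) p.2) := by
  have hF₀ := hF.isAlmostProduct
  have hg := isAlmostProduct_warped hB hF₀ hf
  rw [covDeriv_eq_sub hg hV.liftFiber
    (contMDiff_lowerDeriv hg hX.liftBase hW.liftFiber hT.liftBase)
    (contMDiff_contraction_base_fiber_fiber_base hB hB' hF hf hX hT hW hV).continuous
    (fun q hq => (contraction_comm hg _ _ q).trans
      (contraction_base_fiber_fiber_base hB hB' hF₀ hf hX hT hW hV hq)),
    lowerDeriv_base_fiber_base hB hF₀ hf hX hT hW, dirDeriv_zero, pairing_comm hF₀ W V,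
    pairing_applyField_right hF₀ W V, pairing_comm hF₀ (applyField J₂ W) V]
  simp only [sepFun, Pi.mul_apply, Pi.add_apply]
  ring

theorem covDeriv_base_fiber_base_base (hX : IsSmoothField X) (hY : IsSmoothField Y)
    (hZ : IsSmoothField Z) (hQ : IsSmoothField Q) (p : B × F) :
    covDeriv (warpedMetric gB gF f) (productStructure J₁ J₂) (liftBase I' F Z)
      (lowerDeriv (warpedMetric gB gF f) (productStructure J₁ J₂) (liftFiber I B Q)
        (liftBase I' F X)) (liftBase I' F Y) p = 0 := by
  have hF₀ := hF.isAlmostProduct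
  have hg := isAlmostProduct_warped hB hF₀ hf
  rw [covDeriv_eq_sub (G := 0) hg hZ.liftBase
    (contMDiff_lowerDeriv hg hQ.liftFiber hX.liftBase hY.liftBase) continuous_const
    (fun q _ => contraction_base_base_fiber_base hB hB' hF₀ hf hZ hY hX hQ q),
    lowerDeriv_fiber_base_base hB hF₀ hf hX hY hQ, dirDeriv_zero]
  simp

theorem covDeriv_fiber_base_base_base (hX : IsSmoothField X) (hY : IsSmoothField Y)
    (hZ : IsSmoothField Z) (hQ : IsSmoothField Q) (p : B × F) :
    covDeriv (warpedMetric gB gF f) (productStructure J₁ J₂) (liftFiber I B Q)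
      (lowerDeriv (warpedMetric gB gF f) (productStructure J₁ J₂) (liftBase I' F Z)
        (liftBase I' F X)) (liftBase I' F Y) p = 0 := by
  have hF₀ := hF.isAlmostProduct
  have hg := isAlmostProduct_warped hB hF₀ hf
  rw [covDeriv_eq_sub (G := 0) hg hQ.liftFiber
    (contMDiff_lowerDeriv hg hZ.liftBase hX.liftBase hY.liftBase) continuous_const
    (fun q _ => (contraction_comm hg _ _ q).trans
      (contraction_base_base_fiber_base hB hB' hF₀ hf hZ hX hY hQ q)),
    lowerDeriv_base_base_base hB hF₀ hf hZ hX hY,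
    dirDeriv_liftFiber_comp_fst (contMDiff_lowerDeriv hB hZ hX hY)]
  simp

end WarpedCovDeriv

section WarpedSemiRegular

variable {E : Type*} [NormedAddCommGroup E] [NormedSpace ℝ E] [FiniteDimensional ℝ E]
  {H : Type*} [TopologicalSpace H] {I : ModelWithCorners ℝ E H} [I.Boundaryless]
  {B : Type*} [TopologicalSpace B] [ChartedSpace H B] [IsManifold I ∞ B] [T2Space B]
  {E' : Type*} [NormedAddCommGroup E'] [NormedSpace ℝ E'] [FiniteDimensional ℝ E']
  {H' : Type*} [TopologicalSpace H'] {I' : ModelWithCorners ℝ E' H'} [I'.Boundaryless]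
  {F : Type*} [TopologicalSpace F] [ChartedSpace H' F] [IsManifold I' ∞ F] [T2Space F]
  {gB : (x : B) → TangentSpace I x →L[ℝ] TangentSpace I x →L[ℝ] ℝ}
  {J₁ : (x : B) → TangentSpace I x →L[ℝ] TangentSpace I x}
  {gF : (y : F) → TangentSpace I' y →L[ℝ] TangentSpace I' y →L[ℝ] ℝ}
  {J₂ : (y : F) → TangentSpace I' y →L[ℝ] TangentSpace I' y}
  {f : B → ℝ} {p : B × F}
  {g : (p : B × F) → TangentSpace (I.prod I') p →L[ℝ] TangentSpace (I.prod I') p →L[ℝ] ℝ}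
  {J : (p : B × F) → TangentSpace (I.prod I') p →L[ℝ] TangentSpace (I.prod I') p}

/-- For a fixed direction, it suffices to check on lifts that the derivatives `∇̃_D ∇̃♭_A C` have
values in the image of the metric. -/
theorem exists_represents_covDeriv_of_lifts (hg : IsAlmostProduct g J) (hr : IsRepresentable g J)
    (hs : HasSmoothContractions g J) {D : (p : B × F) → TangentSpace (I.prod I') p}
    (hD : IsSmoothField D)
    (base_base : ∀ X Y : (x : B) → TangentSpace I x, IsSmoothField X → IsSmoothField Y →
      ∃ u, Represents g
        (covDeriv g J D (lowerDeriv g J (liftBase I' F X) (liftBase I' F Y))) p u)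
    (base_fiber : ∀ (X : (x : B) → TangentSpace I x) (V : (y : F) → TangentSpace I' y),
      IsSmoothField X → IsSmoothField V → ∃ u, Represents g
        (covDeriv g J D (lowerDeriv g J (liftBase I' F X) (liftFiber I B V))) p u)
    (fiber_base : ∀ (X : (x : B) → TangentSpace I x) (V : (y : F) → TangentSpace I' y),
      IsSmoothField X → IsSmoothField V → ∃ u, Represents g
        (covDeriv g J D (lowerDeriv g J (liftFiber I B V) (liftBase I' F X))) p u)
    (fiber_fiber : ∀ U V : (y : F) → TangentSpace I' y, IsSmoothField U → IsSmoothField V →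
      ∃ u, Represents g
        (covDeriv g J D (lowerDeriv g J (liftFiber I B U) (liftFiber I B V))) p u)
    {A C : (p : B × F) → TangentSpace (I.prod I') p} (hA : IsSmoothField A)
    (hC : IsSmoothField C) :
    ∃ u, Represents g (covDeriv g J D (lowerDeriv g J A C)) p u := by
  refine productField_induction₂ (p := p)
    (P := fun A C => ∃ u, Represents g (covDeriv g J D (lowerDeriv g J A C)) p u)
    ?_ ?_ ?_ ?_ ?_ base_base base_fiber fiber_base fiber_fiber hA hC
  · rintro A A' C C' hA hA' hC hC' hAA hCC ⟨u, hu⟩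
    refine ⟨u, fun T hT => ?_⟩
    rw [← hu T hT]
    exact covDeriv_congr hg hr hs hD hA hC hT (.refl _ _) hAA.symm hCC.symm (.refl _ _)
  · rintro A A' C hA hA' hC ⟨u, hu⟩ ⟨u', hu'⟩
    refine ⟨u + u', fun T hT => ?_⟩
    rw [covDeriv_lowerDeriv_add_left hg hr hs hD hA hA' hC hT, Pi.add_apply, hu T hT, hu' T hT,
      map_add, add_apply]
  · rintro h A C hh hA hC ⟨u, hu⟩
    obtain ⟨v, hv⟩ := hr A C hA hC p
    refine ⟨h p • u + dirDeriv D h p • v, fun T hT => ?_⟩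
    rw [covDeriv_lowerDeriv_smul_left hg hr hs hh hD hA hC hT, Pi.add_apply, Pi.mul_apply,
      Pi.mul_apply, hu T hT, hv T hT]
    simp only [map_add, add_apply, map_smul, smul_apply, smul_eq_mul]
  · rintro A C C' hA hC hC' ⟨u, hu⟩ ⟨u', hu'⟩
    refine ⟨u + u', fun T hT => ?_⟩
    rw [covDeriv_lowerDeriv_add_right hg hr hs hD hA hC hC' hT, Pi.add_apply, hu T hT, hu' T hT,
      map_add, add_apply]
  · rintro h A C hh hA hC ⟨u, hu⟩
    obtain ⟨v, hv⟩ := hr A C hA hC p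
    obtain ⟨v', hv'⟩ := hr D C hD hC p
    refine ⟨h p • u + dirDeriv D h p • v + dirDeriv D (dirDeriv A h) p • C p +
      dirDeriv A h p • v', fun T hT => ?_⟩
    rw [covDeriv_lowerDeriv_smul_right hg hr hs hh hD hA hC hT]
    simp only [Pi.add_apply, Pi.mul_apply, hu T hT, hv T hT, hv' T hT, map_add, add_apply,
      map_smul, smul_apply, smul_eq_mul, pairing]

/-- The warped product of a non-degenerate manifold and a semi-regular one is semi-regular. -/
theorem isSemiRegular_warped (hB : IsAlmostProduct gB J₁) (hB' : IsNondegenerate gB)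
    (hF : IsSemiRegular gF J₂) (hf : ContMDiff I 𝓘(ℝ, ℝ) ∞ f) :
    IsSemiRegular (warpedMetric gB gF f) (productStructure J₁ J₂) := by
  have hF₀ := hF.isAlmostProduct
  have hg := isAlmostProduct_warped hB hF₀ hf
  have hr := isRepresentable_warped hB hB' hF₀ hF.isRepresentable hf
  have hs := hasSmoothContractions_warped hB hB' hF hf
  refine ⟨hg, fun A C hA hC => isAnnihilatorForm_lowerDeriv hg hr hA hC,
    fun A C D hA hC hD => ⟨fun T hT => contMDiff_covDeriv hg hr hs hD hA hC hT, fun p => ?_⟩⟩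
  refine productField_induction (p := p) (P := fun D => ∃ u, Represents (warpedMetric gB gF f)
    (covDeriv (warpedMetric gB gF f) (productStructure J₁ J₂) D
      (lowerDeriv (warpedMetric gB gF f) (productStructure J₁ J₂) A C)) p u) ?_ ?_ ?_ ?_ ?_ hD
  · rintro D D' hD hD' hDD ⟨u, hu⟩
    refine ⟨u, fun T hT => ?_⟩
    rw [← hu T hT]
    exact covDeriv_congr hg hr hs hD hA hC hT hDD.symm (.refl _ _) (.refl _ _) (.refl _ _)
  · rintro D D' hD hD' ⟨u, hu⟩ ⟨u', hu'⟩
    refine ⟨u + u', fun T hT => ?_⟩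
    rw [covDeriv_add_left hg hr hs hD hD' hA hC hT, Pi.add_apply, hu T hT, hu' T hT, map_add,
      add_apply]
  · rintro h D hh hD ⟨u, hu⟩
    refine ⟨h p • u, fun T hT => ?_⟩
    rw [covDeriv_smul_left hg hr hs hh hD hA hC hT, Pi.mul_apply, hu T hT, map_smul, smul_apply,
      smul_eq_mul]
  · intro X hX
    refine exists_represents_covDeriv_of_lifts hg hr hs hX.liftBase ?_ ?_ ?_ ?_ hA hC
    · intro Y Z hY hZ
      refine (isTensorialAt_covDeriv hg hr hs hX.liftBase hY.liftBase hZ.liftBase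
        p).exists_represents_warped hB' (w := 0) fun Q hQ => ?_
      rw [covDeriv_base_base_base_fiber hB hB' hF hf hX hY hZ hQ]
      simp
    · intro Y V hY hV
      refine (isTensorialAt_covDeriv hg hr hs hX.liftBase hY.liftBase hV.liftFiber
        p).exists_represents_warped hB' (w := dirDeriv X (dirDeriv Y f) p.1 • V p.2)
          fun Q hQ => ?_
      rw [covDeriv_base_base_fiber_fiber hB hB' hF hf hX hY hV hQ]
      simp only [pairing, map_smul, smul_apply, smul_eq_mul]
      ring
    · intro Y V hY hV
      refine (isTensorialAt_covDeriv hg hr hs hX.liftBase hV.liftFiber hY.liftBase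
        p).exists_represents_warped hB' (w := (1 / 2 : ℝ) • (dirDeriv X (dirDeriv Y f) p.1 • V p.2 +
          dirDeriv X (dirDeriv (applyField J₁ Y) f) p.1 • J₂ p.2 (V p.2))) fun Q hQ => ?_
      rw [covDeriv_base_fiber_base_fiber hB hB' hF hf hX hY hV hQ]
      simp only [pairing, applyField, map_smul, smul_apply, smul_eq_mul, map_add, add_apply,
        hF₀.apply_left]
      ring
    · intro V W hV hW
      obtain ⟨u, hu⟩ := hF.isRepresentable V W hV hW p.2
      refine (isTensorialAt_covDeriv hg hr hs hX.liftBase hV.liftFiber hW.liftFiber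
        p).exists_represents_warped hB' (w := dirDeriv X f p.1 • u) fun Q hQ => ?_
      rw [covDeriv_base_fiber_fiber_fiber hB hB' hF hf hX hV hW hQ, hu Q hQ]
      simp only [map_smul, smul_apply, smul_eq_mul]
      ring
  · intro U hU
    refine exists_represents_covDeriv_of_lifts hg hr hs hU.liftFiber ?_ ?_ ?_ ?_ hA hC
    · intro X Y hX hY
      refine (isTensorialAt_covDeriv hg hr hs hU.liftFiber hX.liftBase hY.liftBase
        p).exists_represents_warped hB' (w := (1 / 2 : ℝ) •
          (contraction gB (lowerDeriv gB J₁ X Y) (differential I f) p.1 • U p.2 +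
            contraction gB (lowerDeriv gB J₁ X Y) (formComp (differential I f) J₁) p.1 •
              J₂ p.2 (U p.2))) fun Q hQ => ?_
      rw [covDeriv_fiber_base_base_fiber hB hB' hF hf hX hY hU hQ]
      simp only [pairing, applyField, map_smul, smul_apply, smul_eq_mul, map_add, add_apply,
        hF₀.apply_left]
      ring
    · intro X V hX hV
      obtain ⟨u, hu⟩ := hF.isRepresentable U V hU hV p.2
      refine (isTensorialAt_covDeriv hg hr hs hU.liftFiber hX.liftBase hV.liftFiber
        p).exists_represents_warped hB' (w := dirDeriv X f p.1 • u) fun Q hQ => ?_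
      rw [covDeriv_fiber_base_fiber_fiber hB hB' hF hf hX hU hV hQ, hu Q hQ]
      simp only [map_smul, smul_apply, smul_eq_mul]
      ring
    · intro X V hX hV
      obtain ⟨u, hu⟩ := hF.isRepresentable U V hU hV p.2
      obtain ⟨v, hv⟩ := hF.isRepresentable U _ hU (hF₀.isSmoothField_applyField hV) p.2
      refine (isTensorialAt_covDeriv hg hr hs hU.liftFiber hV.liftFiber hX.liftBase
        p).exists_represents_warped hB' (w := (1 / 2 : ℝ) • (dirDeriv X f p.1 • u +
          dirDeriv (applyField J₁ X) f p.1 • v)) fun Q hQ => ?_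
      rw [covDeriv_fiber_fiber_base_fiber hB hB' hF hf hX hU hV hQ, hu Q hQ, hv Q hQ]
      simp only [map_smul, smul_apply, smul_eq_mul, map_add, add_apply]
      ring
    · intro V W hV hW
      obtain ⟨u, hu⟩ := (hF.covDeriv_mem V W U hV hW hU).2 p.2
      refine (isTensorialAt_covDeriv hg hr hs hU.liftFiber hV.liftFiber hW.liftFiber
        p).exists_represents_warped hB' (w := f p.1 • (u + (-(1 / 4) : ℝ) •
          ((contraction gB (differential I f) (differential I f) p.1 * pairing gF V W p.2 +
            contraction gB (formComp (differential I f) J₁) (differential I f) p.1 *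
              pairing gF V (applyField J₂ W) p.2) • U p.2 +
          (contraction gB (formComp (differential I f) J₁) (differential I f) p.1 *
              pairing gF V W p.2 +
            contraction gB (formComp (differential I f) J₁) (formComp (differential I f) J₁) p.1 *
              pairing gF V (applyField J₂ W) p.2) • J₂ p.2 (U p.2)))) fun Q hQ => ?_
      rw [covDeriv_fiber_fiber_fiber_fiber hB hB' hF hf hU hV hW hQ, hu Q hQ]
      simp only [map_smul, smul_apply, smul_eq_mul, map_add, add_apply, hF₀.apply_left,
        show ∀ A C : (y : F) → TangentSpace I' y,
          gF p.2 (A p.2) (C p.2) = pairing gF A C p.2 from fun _ _ => rfl,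
        show gF p.2 (U p.2) (J₂ p.2 (Q p.2)) = pairing gF U (applyField J₂ Q) p.2 from rfl]
      ring

end WarpedSemiRegular

section WarpedCurvature

theorem lowerDeriv_zero_left {E : Type*} [NormedAddCommGroup E] [NormedSpace ℝ E]
    [FiniteDimensional ℝ E] {H : Type*} [TopologicalSpace H] {I : ModelWithCorners ℝ E H}
    {M : Type*} [TopologicalSpace M] [ChartedSpace H M] [IsManifold I ∞ M]
    {g : (x : M) → TangentSpace I x →L[ℝ] TangentSpace I x →L[ℝ] ℝ}
    {J : (x : M) → TangentSpace I x →L[ℝ] TangentSpace I x} {Y Z : (x : M) → TangentSpace I x}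
    (hg : IsAlmostProduct g J) (hY : IsSmoothField Y) (hZ : IsSmoothField Z) (x : M) :
    lowerDeriv g J 0 Y Z x = 0 := by
  have h := apKoszul_smul_left hg (h := (0 : M → ℝ)) contMDiff_const .zero hY hZ x
  rwa [zero_smul, Pi.zero_apply, zero_mul] at h

variable {E : Type*} [NormedAddCommGroup E] [NormedSpace ℝ E] [FiniteDimensional ℝ E]
  {H : Type*} [TopologicalSpace H] {I : ModelWithCorners ℝ E H} [I.Boundaryless]
  {B : Type*} [TopologicalSpace B] [ChartedSpace H B] [IsManifold I ∞ B] [T2Space B]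
  {E' : Type*} [NormedAddCommGroup E'] [NormedSpace ℝ E'] [FiniteDimensional ℝ E']
  {H' : Type*} [TopologicalSpace H'] {I' : ModelWithCorners ℝ E' H'} [I'.Boundaryless]
  {F : Type*} [TopologicalSpace F] [ChartedSpace H' F] [IsManifold I' ∞ F] [T2Space F]
  {X Y Z T : (x : B) → TangentSpace I x} {U V W Q : (y : F) → TangentSpace I' y}
  {gB : (x : B) → TangentSpace I x →L[ℝ] TangentSpace I x →L[ℝ] ℝ}
  {J₁ : (x : B) → TangentSpace I x →L[ℝ] TangentSpace I x}
  {gF : (y : F) → TangentSpace I' y →L[ℝ] TangentSpace I' y →L[ℝ] ℝ}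
  {J₂ : (y : F) → TangentSpace I' y →L[ℝ] TangentSpace I' y}
  {f : B → ℝ} (hB : IsAlmostProduct gB J₁) (hB' : IsNondegenerate gB) (hF : IsSemiRegular gF J₂)
  (hf : ContMDiff I 𝓘(ℝ, ℝ) ∞ f)
include hB hB' hF hf

theorem curvature_base_base_base_base (hX : IsSmoothField X) (hY : IsSmoothField Y)
    (hZ : IsSmoothField Z) (hT : IsSmoothField T) (p : B × F) :
    curvature (warpedMetric gB gF f) (productStructure J₁ J₂) (liftBase I' F X) (liftBase I' F Y)
      (liftBase I' F Z) (liftBase I' F T) p = curvature gB J₁ X Y Z T p.1 := by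
  unfold curvature
  rw [covDeriv_base_base_base_base hB hB' hF hf hX hY hZ hT,
    covDeriv_base_base_base_base hB hB' hF hf hY hX hZ hT, mlieBracket_liftBase_liftBase hX hY,
    lowerDeriv_base_base_base hB hF.isAlmostProduct hf (hX.mlieBracket hY) hZ hT]
  rfl

theorem curvature_base_base_base_fiber (hX : IsSmoothField X) (hY : IsSmoothField Y)
    (hZ : IsSmoothField Z) (hQ : IsSmoothField Q) (p : B × F) :
    curvature (warpedMetric gB gF f) (productStructure J₁ J₂) (liftBase I' F X) (liftBase I' F Y)
      (liftBase I' F Z) (liftFiber I B Q) p = 0 := by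
  unfold curvature
  rw [covDeriv_base_base_base_fiber hB hB' hF hf hX hY hZ hQ,
    covDeriv_base_base_base_fiber hB hB' hF hf hY hX hZ hQ, mlieBracket_liftBase_liftBase hX hY,
    lowerDeriv_base_base_fiber hB hF.isAlmostProduct hf (hX.mlieBracket hY) hZ hQ]
  simp

theorem curvature_base_fiber_base_base (hX : IsSmoothField X) (hY : IsSmoothField Y)
    (hZ : IsSmoothField Z) (hQ : IsSmoothField Q) (p : B × F) :
    curvature (warpedMetric gB gF f) (productStructure J₁ J₂) (liftBase I' F Z) (liftFiber I B Q)
      (liftBase I' F X) (liftBase I' F Y) p = 0 := by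
  unfold curvature
  rw [covDeriv_base_fiber_base_base hB hB' hF hf hX hY hZ hQ,
    covDeriv_fiber_base_base_base hB hB' hF hf hX hY hZ hQ, mlieBracket_liftBase_liftFiber hZ hQ,
    lowerDeriv_zero_left (isAlmostProduct_warped hB hF.isAlmostProduct hf) hX.liftBase hY.liftBase]
  simp

theorem curvature_base_base_fiber_fiber (hX : IsSmoothField X) (hY : IsSmoothField Y)
    (hW : IsSmoothField W) (hQ : IsSmoothField Q) (p : B × F) :
    curvature (warpedMetric gB gF f) (productStructure J₁ J₂) (liftBase I' F X) (liftBase I' F Y)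
      (liftFiber I B W) (liftFiber I B Q) p = 0 := by
  unfold curvature
  rw [covDeriv_base_base_fiber_fiber hB hB' hF hf hX hY hW hQ,
    covDeriv_base_base_fiber_fiber hB hB' hF hf hY hX hW hQ, mlieBracket_liftBase_liftBase hX hY,
    lowerDeriv_base_fiber_fiber hB hF.isAlmostProduct hf (hX.mlieBracket hY) hW hQ]
  simp only [sepFun, warpDeriv, Pi.mul_apply, dirDeriv_mlieBracket hX hY hf]
  ring

theorem curvature_fiber_fiber_base_base (hX : IsSmoothField X) (hY : IsSmoothField Y)
    (hW : IsSmoothField W) (hQ : IsSmoothField Q) (p : B × F) :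
    curvature (warpedMetric gB gF f) (productStructure J₁ J₂) (liftFiber I B W) (liftFiber I B Q)
      (liftBase I' F X) (liftBase I' F Y) p = 0 := by
  have hF₀ := hF.isAlmostProduct
  unfold curvature
  rw [covDeriv_fiber_fiber_base_base hB hB' hF hf hX hY hW hQ,
    covDeriv_fiber_fiber_base_base hB hB' hF hf hX hY hQ hW, mlieBracket_liftFiber_liftFiber hW hQ,
    lowerDeriv_fiber_base_base hB hF₀ hf hX hY (hW.mlieBracket hQ), pairing_comm hF₀ Q W,
    pairing_applyField_right hF₀ Q W, pairing_comm hF₀ (applyField J₂ Q) W]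
  simp

theorem curvature_base_fiber_fiber_base (hX : IsSmoothField X) (hT : IsSmoothField T)
    (hV : IsSmoothField V) (hW : IsSmoothField W) (p : B × F) :
    curvature (warpedMetric gB gF f) (productStructure J₁ J₂) (liftBase I' F X) (liftFiber I B V)
      (liftFiber I B W) (liftBase I' F T) p =
      - (1 / 2) * f p.1 * hessian gB J₁ f X T p.1 * pairing gF V W p.2
      - f p.1 / 2 * (dirDeriv X (dirDeriv (applyField J₁ T) f) p.1
          - contraction gB (lowerDeriv gB J₁ X T) (formComp (differential I f) J₁) p.1) *
        pairing gF V (applyField J₂ W) p.2 := by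
  have hp : p.1 ∈ regularSet gB := regularSet_eq_univ hB hB' ▸ mem_univ _
  unfold curvature hessian
  rw [covDeriv_base_fiber_fiber_base hB hB' hF hf hX hT hV hW,
    covDeriv_fiber_base_fiber_base hB hB' hF hf hX hT hV hW, mlieBracket_liftBase_liftFiber hX hV,
    lowerDeriv_zero_left (isAlmostProduct_warped hB hF.isAlmostProduct hf) hW.liftFiber
      hT.liftBase, covDeriv_of_mem hp]
  simp only [differential]
  ring

theorem curvature_fiber_fiber_base_fiber (hU : IsSmoothField U) (hV : IsSmoothField V)
    (hZ : IsSmoothField Z) (hQ : IsSmoothField Q) (p : B × F) :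
    curvature (warpedMetric gB gF f) (productStructure J₁ J₂) (liftFiber I B U) (liftFiber I B V)
      (liftBase I' F Z) (liftFiber I B Q) p =
      1 / 4 * f p.1 * dirDeriv Z f p.1 *
        (- koszul gF V Q U p.2 + koszul gF V (applyField J₂ Q) (applyField J₂ U) p.2
          + koszul gF U Q V p.2 - koszul gF U (applyField J₂ Q) (applyField J₂ V) p.2)
      - 1 / 4 * f p.1 * dirDeriv (applyField J₁ Z) f p.1 *
        (koszul gF V (applyField J₂ Q) U p.2 - koszul gF V Q (applyField J₂ U) p.2
          - koszul gF U (applyField J₂ Q) V p.2 + koszul gF U Q (applyField J₂ V) p.2) := by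
  have hF₀ := hF.isAlmostProduct
  unfold curvature
  rw [covDeriv_fiber_fiber_base_fiber hB hB' hF hf hZ hU hV hQ,
    covDeriv_fiber_fiber_base_fiber hB hB' hF hf hZ hV hU hQ,
    mlieBracket_liftFiber_liftFiber hU hV,
    lowerDeriv_fiber_base_fiber hB hF₀ hf hZ (hU.mlieBracket hV) hQ]
  simp only [sepFun, warpDeriv, Pi.mul_apply, Pi.add_apply, lowerDeriv, apKoszul,
    ← koszul_sub_koszul_swap hF₀ U V, applyField_applyField hF₀]
  have swap : ∀ A C, koszul gF A C Q p.2 =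
      dirDeriv A (pairing gF C Q) p.2 - koszul gF A Q C p.2 := fun A C => by
    rw [← koszul_add_koszul_swap hF₀]
    ring
  have swap' : ∀ A C, koszul gF A C (applyField J₂ Q) p.2 =
      dirDeriv A (pairing gF (applyField J₂ C) Q) p.2 - koszul gF A (applyField J₂ Q) C p.2 :=
    fun A C => by
      rw [← pairing_applyField_right hF₀, ← koszul_add_koszul_swap hF₀]
      ring
  simp only [swap, swap', applyField_applyField hF₀]
  ring

theorem curvature_base_fiber_fiber_fiber (hZ : IsSmoothField Z) (hQ : IsSmoothField Q)
    (hU : IsSmoothField U) (hV : IsSmoothField V) (p : B × F) :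
    curvature (warpedMetric gB gF f) (productStructure J₁ J₂) (liftBase I' F Z) (liftFiber I B Q)
      (liftFiber I B U) (liftFiber I B V) p = 0 := by
  unfold curvature
  rw [covDeriv_base_fiber_fiber_fiber hB hB' hF hf hZ hQ hU hV,
    covDeriv_fiber_base_fiber_fiber hB hB' hF hf hZ hQ hU hV, mlieBracket_liftBase_liftFiber hZ hQ,
    lowerDeriv_zero_left (isAlmostProduct_warped hB hF.isAlmostProduct hf) hU.liftFiber
      hV.liftFiber]
  simp

theorem curvature_fiber_fiber_fiber_fiber (hU : IsSmoothField U) (hV : IsSmoothField V)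
    (hW : IsSmoothField W) (hQ : IsSmoothField Q) (p : B × F) :
    curvature (warpedMetric gB gF f) (productStructure J₁ J₂) (liftFiber I B U) (liftFiber I B V)
      (liftFiber I B W) (liftFiber I B Q) p =
      f p.1 ^ 2 * curvature gF J₂ U V W Q p.2
      + f p.1 ^ 2 / 4 *
        (contraction gB (differential I f) (differential I f) p.1 *
          (pairing gF U W p.2 * pairing gF V Q p.2 - pairing gF V W p.2 * pairing gF U Q p.2)
        + contraction gB (formComp (differential I f) J₁) (differential I f) p.1 *
          (pairing gF U (applyField J₂ W) p.2 * pairing gF V Q p.2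
            + pairing gF U W p.2 * pairing gF V (applyField J₂ Q) p.2
            - pairing gF V (applyField J₂ W) p.2 * pairing gF U Q p.2
            - pairing gF V W p.2 * pairing gF U (applyField J₂ Q) p.2)
        + contraction gB (formComp (differential I f) J₁) (formComp (differential I f) J₁) p.1 *
          (pairing gF U (applyField J₂ W) p.2 * pairing gF V (applyField J₂ Q) p.2
            - pairing gF V (applyField J₂ W) p.2 * pairing gF U (applyField J₂ Q) p.2)) := by
  unfold curvature
  rw [covDeriv_fiber_fiber_fiber_fiber hB hB' hF hf hU hV hW hQ,
    covDeriv_fiber_fiber_fiber_fiber hB hB' hF hf hV hU hW hQ,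
    mlieBracket_liftFiber_liftFiber hU hV,
    lowerDeriv_fiber_fiber_fiber hB hF.isAlmostProduct hf (hU.mlieBracket hV) hW hQ]
  simp only [sepFun, Pi.mul_apply]
  ring

end WarpedCurvature

end SingularGeometry

end

open SingularGeometry in
theorem theorem4p17
    {E : Type*} [NormedAddCommGroup E] [NormedSpace ℝ E] [FiniteDimensional ℝ E]
    {H : Type*} [TopologicalSpace H] (I : ModelWithCorners ℝ E H) [I.Boundaryless]
    {B : Type*} [TopologicalSpace B] [ChartedSpace H B] [IsManifold I ∞ B]
    [T2Space B] [SigmaCompactSpace B]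
    {E' : Type*} [NormedAddCommGroup E'] [NormedSpace ℝ E'] [FiniteDimensional ℝ E']
    {H' : Type*} [TopologicalSpace H'] (I' : ModelWithCorners ℝ E' H') [I'.Boundaryless]
    {F : Type*} [TopologicalSpace F] [ChartedSpace H' F] [IsManifold I' ∞ F]
    [T2Space F] [SigmaCompactSpace F]
    (gB : (x : B) → TangentSpace I x →L[ℝ] TangentSpace I x →L[ℝ] ℝ)
    (J₁ : (x : B) → TangentSpace I x →L[ℝ] TangentSpace I x)
    (hB : IsAlmostProduct gB J₁) (hB' : IsNondegenerate gB)
    (gF : (y : F) → TangentSpace I' y →L[ℝ] TangentSpace I' y →L[ℝ] ℝ)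
    (J₂ : (y : F) → TangentSpace I' y →L[ℝ] TangentSpace I' y)
    (hF : IsSemiRegular gF J₂)
    (f : B → ℝ) (hf : ContMDiff I 𝓘(ℝ, ℝ) ∞ f) :
    IsSemiRegular (warpedMetric gB gF f) (productStructure J₁ J₂) ∧
    ∀ X Y Z T : (x : B) → TangentSpace I x,
      IsSmoothField X → IsSmoothField Y → IsSmoothField Z → IsSmoothField T →
    ∀ U V W Q : (y : F) → TangentSpace I' y,
      IsSmoothField U → IsSmoothField V → IsSmoothField W → IsSmoothField Q →
    ∀ (b : B) (q : F),
      let R := curvature (warpedMetric gB gF f) (productStructure J₁ J₂)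
      let lB := fun X : (x : B) → TangentSpace I x => liftBase I' F X
      let lF := fun V : (y : F) → TangentSpace I' y => liftFiber I B V
      let K := koszul gF
      let JB := applyField J₁
      let JF := applyField J₂
      let h := fun V W : (y : F) → TangentSpace I' y => pairing gF V W q
      let df := differential I f
      let dfJ := formComp (differential I f) J₁
      R (lB X) (lB Y) (lB Z) (lB T) (b, q) = curvature gB J₁ X Y Z T b ∧
      R (lB X) (lB Y) (lB Z) (lF Q) (b, q) = 0 ∧
      R (lB Z) (lF Q) (lB X) (lB Y) (b, q) = 0 ∧
      R (lB X) (lB Y) (lF W) (lF Q) (b, q) = 0 ∧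
      R (lF W) (lF Q) (lB X) (lB Y) (b, q) = 0 ∧
      R (lB X) (lF V) (lF W) (lB T) (b, q) =
        - (1 / 2) * f b * hessian gB J₁ f X T b * h V W
        - f b / 2 * (dirDeriv X (dirDeriv (JB T) f) b
            - contraction gB (lowerDeriv gB J₁ X T) dfJ b) * h V (JF W) ∧
      R (lF U) (lF V) (lB Z) (lF Q) (b, q) =
        1 / 4 * f b * dirDeriv Z f b *
          (- K V Q U q + K V (JF Q) (JF U) q + K U Q V q - K U (JF Q) (JF V) q)
        - 1 / 4 * f b * dirDeriv (JB Z) f b *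
          (K V (JF Q) U q - K V Q (JF U) q - K U (JF Q) V q + K U Q (JF V) q) ∧
      R (lB Z) (lF Q) (lF U) (lF V) (b, q) = 0 ∧
      R (lF U) (lF V) (lF W) (lF Q) (b, q) =
        f b ^ 2 * curvature gF J₂ U V W Q q
        + f b ^ 2 / 4 *
          (contraction gB df df b * (h U W * h V Q - h V W * h U Q)
          + contraction gB dfJ df b *
              (h U (JF W) * h V Q + h U W * h V (JF Q)
                - h V (JF W) * h U Q - h V W * h U (JF Q))
          + contraction gB dfJ dfJ b *
              (h U (JF W) * h V (JF Q) - h V (JF W) * h U (JF Q))) := by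
  have hg := isSemiRegular_warped hB hB' hF hf
  refine ⟨hg, fun X Y Z T hX hY hZ hT U V W Q hU hV hW hQ b q => ?_⟩
  exact ⟨curvature_base_base_base_base hB hB' hF hf hX hY hZ hT (b, q),
    curvature_base_base_base_fiber hB hB' hF hf hX hY hZ hQ (b, q),
    curvature_base_fiber_base_base hB hB' hF hf hX hY hZ hQ (b, q),
    curvature_base_base_fiber_fiber hB hB' hF hf hX hY hW hQ (b, q),
    curvature_fiber_fiber_base_base hB hB' hF hf hX hY hW hQ (b, q),
    curvature_base_fiber_fiber_base hB hB' hF hf hX hT hV hW (b, q),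
    curvature_fiber_fiber_base_fiber hB hB' hF hf hU hV hZ hQ (b, q),
    curvature_base_fiber_fiber_fiber hB hB' hF hf hZ hQ hU hV (b, q),
    curvature_fiber_fiber_fiber_fiber hB hB' hF hf hU hV hW hQ (b, q)⟩
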